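/- Let $d\ge 1$, let $\Omega\subset\mathbb R^d$ be a bounded Lipschitz domain (open, connected, nonempty) with outer unit normal $n$, let $\gamma>1$, $T>0$, and let $\rho_0\in L^\gamma(\Omega)$, $m_0\in L^{\frac{2\gamma}{\gamma+1}}(\Omega;\mathbb R^d)$. Put $\mathcal V=\{\varphi\in C^1(\overline\Omega;\mathbb R^d): \varphi\cdot n=0 \text{ on }\partial\Omega\}$ and $\mathcal E(\rho,m)=\int_\Omega\eta(\rho,m)\,dx\in[0,\infty]$, where $\eta(\rho,m)=\frac{|m|^2}{2\rho}+\frac{\rho^\gamma}{\gamma-1}$ if $\rho>0$, $\eta(0,0)=0$, and $\eta=\infty$ otherwise. For $\varphi\in\mathcal V$ put $$\tilde{\mathcal K}(\varphi)=\max\{2\|(\nabla\varphi)_{\mathrm{sym},-}\|_{L^\infty(\Omega)},\ (\gamma-1)\|(\operatorname{div}\varphi)_-\|_{L^\infty(\Omega)}\},$$ where $(\cdot)_{\mathrm{sym},-}$ is the negative semidefinite part of the symmetric part of a matrix, measured in the spectral norm, and $(a)_-=\max\{-a,0\}$. Consider $\rho\in L^\infty(0,T;L^\gamma(\Omega))$,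 $m\in L^\infty(0,T;L^{\frac{2\gamma}{\gamma+1}}(\Omega;\mathbb R^d))$ and a function $E:[0,T]\to\mathbb R$ of bounded variation. Functions of time, including $E$, are understood up to changes on null sets of times in $(0,T]$; in particular "$E$ is nonincreasing" means that $E$ agrees at $0$ and almost everywhere in $(0,T)$ with a nonincreasing function on $[0,T]$. Where $(\rho,m)=(0,0)$, we set $\frac{m\otimes m}{\rho}=0$. The triple $(\rho,m,E)$ is an *energy-variational solution* of the isentropic Euler system $$\partial_t\rho+\operatorname{div}m=0,\quad \partial_t m+\operatorname{div}\Big(\frac{m\otimes m}{\rho}\Big)+\nabla(\rho^\gamma)=0,\quad m\cdot n|_{\partial\Omega}=0,\quad(\rho,m)(0)=(\rho_0,m_0)$$ if $\mathcal E(\rho(t),m(t))\le E(t)$ for a.e. $t\in(0,T)$ and, for all $(\psi,\varphi)\in C^1([0,T];C^1(\overline\Omega)\times\mathcal V)$ and a.a. $s<t$ in $(0,T)$, including $s=0$ with $(\rho(0),m(0))=(\rho_0,m_0)$, $$\Big[E-\int_\Omega\rho\psi+m\cdot\varphi\,dx\Big]\Big|_s^t+\int_s^t\!\int_\Omega\rho\,\partial_t\psi+m\cdot\nabla\psi+m\cdot\partial_t\varphi+\Big(\frac{m\otimes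 m}{\rho}+\rho^\gamma I_d\Big):\nabla\varphi\,dx\,d\tau+\int_s^t\tilde{\mathcal K}(\varphi)\big(\mathcal E(\rho,m)-E\big)\,d\tau\le0 .$$ It is a *dissipative weak solution* if $E$ is nonincreasing and there are $\mathfrak R_1\in L^\infty_{w^*}(0,T;\mathcal M(\overline\Omega;\mathbb R^{d\times d}_{\mathrm{sym},+}))$ (values in the symmetric positive semidefinite matrices) and $\mathfrak R_2\in L^\infty_{w^*}(0,T;\mathcal M(\overline\Omega;\mathbb R_+))$, that is, essentially bounded and weakly* measurable families of finite measures on $\overline\Omega$, such that for all such $(\psi,\varphi)$ and $s<t$ (including $s=0$ as above) $$-\int_\Omega\rho\psi\,dx\Big|_s^t+\int_s^t\!\int_\Omega\rho\,\partial_t\psi+m\cdot\nabla\psi\,dx\,d\tau=0,$$ $$-\int_\Omega m\cdot\varphi\,dx\Big|_s^t+\int_s^t\!\int_\Omega m\cdot\partial_t\varphi+\Big(\frac{m\otimes m}{\rho}+\rho^\gamma I_d\Big):\nabla\varphi\,dx\,d\tau+\int_s^t\Big(\int_{\overline\Omega}(\nabla\varphi)_{\mathrm{sym}}:d\mathfrak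 R_1+\int_{\overline\Omega}\operatorname{div}\varphi\,d\mathfrak R_2\Big)d\tau=0,$$ and, for a.e. $t\in(0,T)$, $$\frac12\int_{\overline\Omega}d\operatorname{tr}(\mathfrak R_1)+\frac1{\gamma-1}\int_{\overline\Omega}d\mathfrak R_2\le E-\mathcal E(\rho,m).$$ **Theorem.** $(\rho,m,E)$ is an energy-variational solution if and only if it is a dissipative weak solution. -/

import Mathlib

open MeasureTheory Set Filter Topology
open scoped NNReal ENNReal

noncomputable section

namespace IsentropicEuler

/-- The Euclidean space `ℝ^d`. -/
abbrev Vec (d : ℕ) : Type := EuclideanSpace ℝ (Fin d)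

/-- Real `d × d` matrices. -/
abbrev Mat (d : ℕ) : Type := Matrix (Fin d) (Fin d) ℝ

/-! ### Lipschitz domains and their normals -/

/-- A bounded Lipschitz domain: a bounded, open, connected, nonempty set which near each of its
boundary points is, for a suitable choice of the vertical unit direction `e`, the part of space
lying strictly above the graph of a Lipschitz function `g` of the horizontal component
`y - (e · y) e`. -/
structure IsBoundedLipschitzDomain {d : ℕ} (Ω : Set (Vec d)) : Prop where
  isOpen : IsOpen Ω
  isConnected : IsConnected Ω
  isBounded : Bornology.IsBounded Ω
  lipschitz_boundary : ∀ x ∈ frontier Ω, ∃ e : Vec d, ‖e‖ = 1 ∧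
    ∃ (L : ℝ≥0) (g : Vec d → ℝ), LipschitzWith L g ∧
      ∃ r > 0, ∀ y ∈ Metric.ball x r, (y ∈ Ω ↔ g (y - inner ℝ e y • e) < inner ℝ e y)

/-- `n` is the outer unit normal of `Ω` at the boundary point `x`: infinitesimally at `x`, the set
`Ω` is the half space `{y | (y - x) · n < 0}`. For a Lipschitz domain such an `n` exists at `x`
exactly when the local graph function is differentiable at (the horizontal component of) `x`,
hence at almost every boundary point. -/
def IsOuterUnitNormal {d : ℕ} (Ω : Set (Vec d)) (x n : Vec d) : Prop :=
  ‖n‖ = 1 ∧ ∀ ε > 0, ∀ᶠ y in 𝓝 x,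
    (inner ℝ (y - x) n < -ε * ‖y - x‖ → y ∈ Ω) ∧ (ε * ‖y - x‖ < inner ℝ (y - x) n → y ∉ Ω)

/-! ### Function spaces -/

/-- `f ∈ L^∞(0,T; L^p(Ω; F))`, for a finite exponent `p`. -/
def MemLinftyLp {d : ℕ} {F : Type*} [NormedAddCommGroup F] (T : ℝ) (Ω : Set (Vec d)) (p : ℝ≥0∞)
    (f : ℝ → Vec d → F) : Prop :=
  AEStronglyMeasurable (fun q : ℝ × Vec d => f q.1 q.2)
      ((volume.restrict (Ioo 0 T)).prod (volume.restrict Ω)) ∧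
    ∃ C : ℝ≥0, ∀ᵐ t ∂(volume.restrict (Ioo 0 T)), eLpNorm (f t) p (volume.restrict Ω) ≤ C

/-- Elements of `C^1([0,T]; C^1(Ω̄; F))`, where `C^1(Ω̄; F)` consists of the continuous functions on
`Ω̄` that are differentiable in `Ω` with a derivative extending continuously to `Ω̄`. The functions
`grad`, `dt` and `gradDt` are the spatial derivative, the time derivative, and the spatial derivative
of the time derivative; on `[0,T] × Ω̄` they are determined by `val`. Only values on `[0,T] × Ω̄`
are relevant. -/
structure TestFunction {d : ℕ} (T : ℝ) (Ω : Set (Vec d)) (F : Type) [NormedAddCommGroup F]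
    [NormedSpace ℝ F] where
  val : ℝ → Vec d → F
  grad : ℝ → Vec d → (Vec d →L[ℝ] F)
  dt : ℝ → Vec d → F
  gradDt : ℝ → Vec d → (Vec d →L[ℝ] F)
  continuousOn_val :
    ContinuousOn (fun q : ℝ × Vec d => val q.1 q.2) (Icc 0 T ×ˢ closure Ω)
  continuousOn_grad :
    ContinuousOn (fun q : ℝ × Vec d => grad q.1 q.2) (Icc 0 T ×ˢ closure Ω)
  continuousOn_dt :
    ContinuousOn (fun q : ℝ × Vec d => dt q.1 q.2) (Icc 0 T ×ˢ closure Ω)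
  continuousOn_gradDt :
    ContinuousOn (fun q : ℝ × Vec d => gradDt q.1 q.2) (Icc 0 T ×ˢ closure Ω)
  hasFDerivAt_val : ∀ t ∈ Icc 0 T, ∀ x ∈ Ω, HasFDerivAt (val t) (grad t x) x
  hasFDerivAt_dt : ∀ t ∈ Icc 0 T, ∀ x ∈ Ω, HasFDerivAt (dt t) (gradDt t x) x
  hasDerivWithinAt_val : ∀ t ∈ Icc 0 T, ∀ x ∈ closure Ω,
    HasDerivWithinAt (fun s => val s x) (dt t x) (Icc 0 T) t

/-- The values of `φ` lie in `V = {φ ∈ C^1(Ω̄; ℝ^d) | φ · n = 0 on ∂Ω}`, the boundary condition being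
imposed wherever the normal exists. -/
def TestFunction.IsTangential {d : ℕ} {T : ℝ} {Ω : Set (Vec d)} (φ : TestFunction T Ω (Vec d)) :
    Prop :=
  ∀ t ∈ Icc 0 T, ∀ x ∈ frontier Ω, ∀ n, IsOuterUnitNormal Ω x n → inner ℝ n (φ.val t x) = 0

/-- A function of bounded variation on `[0,T]` is understood up to changes on null sets of times not
containing the initial time: `E` is nonincreasing if, up to such a change, it is nonincreasing as a
function on `[0,T]`. -/
def IsNonincreasing (T : ℝ) (E : ℝ → ℝ) : Prop :=
  ∃ E' : ℝ → ℝ, AntitoneOn E' (Icc 0 T) ∧ E' 0 = E 0 ∧ E' =ᵐ[volume.restrict (Ioo 0 T)] E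

/-- `P s t` holds for a.a. `s, t ∈ (0,T)` with `s < t`, including `s = 0`. -/
def ForAETimes (T : ℝ) (P : ℝ → ℝ → Prop) : Prop :=
  (∀ᵐ s ∂(volume.restrict (Ioo 0 T)), ∀ᵐ t ∂(volume.restrict (Ioo 0 T)), s < t → P s t) ∧
    ∀ᵐ t ∂(volume.restrict (Ioo 0 T)), P 0 t

/-! ### Matrices -/

/-- Frobenius product `A : B`. -/
def frob {d : ℕ} (A B : Mat d) : ℝ := ∑ i, ∑ j, A i j * B i j

/-- The matrix `(∂_j φ_i)_{ij}` of the derivative of a vector field. -/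
def jac {d : ℕ} (A : Vec d →L[ℝ] Vec d) : Mat d :=
  Matrix.of fun i j => A (EuclideanSpace.single j 1) i

/-- The symmetric part `(A + Aᵀ) / 2`. -/
def symPart {d : ℕ} (A : Mat d) : Mat d := (1 / 2 : ℝ) • (A + A.transpose)

/-- The spectral norm. -/
def spectralNorm {d : ℕ} (A : Mat d) : ℝ := ‖Matrix.toEuclideanCLM (n := Fin d) (𝕜 := ℝ) A‖

/-- The (absolute value of the) negative semidefinite part of the symmetric part of `A`, that is
`S⁻` in the decomposition `S = S⁺ - S⁻` of `S = (A + Aᵀ) / 2` given by the spectral theorem. -/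
def symNegPart {d : ℕ} (A : Mat d) : Mat d := (symPart A)⁻

/-- The norm of `L^∞(Ω)`. -/
def linftyNorm {d : ℕ} (Ω : Set (Vec d)) (f : Vec d → ℝ) : ℝ :=
  (eLpNorm f ∞ (volume.restrict Ω)).toReal

/-! ### Energy, flux and regularity weight -/

/-- The energy density. -/
def eta {d : ℕ} (γ : ℝ) (ρ : ℝ) (m : Vec d) : ℝ≥0∞ :=
  open Classical in
  if 0 < ρ then ENNReal.ofReal (‖m‖ ^ 2 / (2 * ρ) + ρ ^ γ / (γ - 1))
  else if ρ = 0 ∧ m = 0 then 0 else ∞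

/-- The total energy, with values in `[0,∞]`. -/
def energy {d : ℕ} (Ω : Set (Vec d)) (γ : ℝ) (ρ : Vec d → ℝ) (m : Vec d → Vec d) : ℝ≥0∞ :=
  ∫⁻ x in Ω, eta γ (ρ x) (m x)

/-- The momentum flux `(m ⊗ m) / ρ + ρ^γ I`. It is only used where the energy density is finite, so
that `m = 0` where `ρ = 0`; there the flux is `0`. -/
def flux {d : ℕ} (γ : ℝ) (ρ : ℝ) (m : Vec d) : Mat d :=
  (Matrix.of fun i j => m i * m j / ρ) + (ρ ^ γ) • (1 : Mat d)

/-- The regularity weight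
`max {2 ‖(∇φ)_{sym,-}‖_{L^∞(Ω)}, (γ - 1) ‖(div φ)_-‖_{L^∞(Ω)}}`, as a function of `G = ∇φ`. -/
def weight {d : ℕ} (Ω : Set (Vec d)) (γ : ℝ) (G : Vec d → Mat d) : ℝ :=
  max (2 * linftyNorm Ω fun x => spectralNorm (symNegPart (G x)))
    ((γ - 1) * linftyNorm Ω fun x => max (-(G x).trace) 0)

/-! ### Energy-variational solutions -/

/-- The energy-variational inequality between the times `s` and `t`. -/
def EnergyVariationalInequality {d : ℕ} {T : ℝ} {Ω : Set (Vec d)} (γ : ℝ)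
    (ρ : ℝ → Vec d → ℝ) (m : ℝ → Vec d → Vec d) (E : ℝ → ℝ)
    (ψ : TestFunction T Ω ℝ) (φ : TestFunction T Ω (Vec d)) (s t : ℝ) : Prop :=
  ((E t - ∫ x in Ω, (ρ t x * ψ.val t x + inner ℝ (m t x) (φ.val t x))) -
      (E s - ∫ x in Ω, (ρ s x * ψ.val s x + inner ℝ (m s x) (φ.val s x)))) +
    (∫ τ in s..t, ∫ x in Ω, (ρ τ x * ψ.dt τ x + ψ.grad τ x (m τ x))) +
    (∫ τ in s..t, ∫ x in Ω,
      (inner ℝ (m τ x) (φ.dt τ x) + frob (flux γ (ρ τ x) (m τ x)) (jac (φ.grad τ x)))) +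
    (∫ τ in s..t, weight Ω γ (fun x => jac (φ.grad τ x)) *
      ((energy Ω γ (ρ τ) (m τ)).toReal - E τ)) ≤ 0

/-- Energy-variational solutions with initial data `(ρ₀, m₀)`. The updates express
`(ρ(0), m(0)) = (ρ₀, m₀)`. -/
structure IsEnergyVariationalSolution {d : ℕ} (T : ℝ) (Ω : Set (Vec d)) (γ : ℝ)
    (ρ₀ : Vec d → ℝ) (m₀ : Vec d → Vec d)
    (ρ : ℝ → Vec d → ℝ) (m : ℝ → Vec d → Vec d) (E : ℝ → ℝ) : Prop where
  memLp_density : MemLinftyLp T Ω (ENNReal.ofReal γ) ρ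
  memLp_momentum : MemLinftyLp T Ω (ENNReal.ofReal (2 * γ / (γ + 1))) m
  boundedVariation : BoundedVariationOn E (Icc 0 T)
  energy_le : ∀ᵐ t ∂(volume.restrict (Ioo 0 T)),
    (energy Ω γ (ρ t) (m t) : EReal) ≤ (E t : EReal)
  inequality : ∀ (ψ : TestFunction T Ω ℝ) (φ : TestFunction T Ω (Vec d)), φ.IsTangential →
    ForAETimes T (EnergyVariationalInequality γ
      (Function.update ρ 0 ρ₀) (Function.update m 0 m₀) E ψ φ)

/-! ### Measure-valued functions of time -/

/-- The component `R_{ij}` of a matrix-valued measure. -/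
def entry {d : ℕ} {X : Type*} [MeasurableSpace X] (R : VectorMeasure X (Mat d)) (i j : Fin d) :
    SignedMeasure X :=
  R.mapRange (Matrix.entryAddMonoidHom ℝ i j)
    (show Continuous fun A : Mat d => A i j from continuous_id.matrix_elem i j)

/-- The integral `∫ B : dR` of a matrix field against a matrix-valued measure. -/
def matIntegral {d : ℕ} {X : Type*} [MeasurableSpace X] (B : X → Mat d)
    (R : VectorMeasure X (Mat d)) : ℝ :=
  ∑ i, ∑ j, (entry R i j).integral (fun x => B x i j) (ContinuousLinearMap.lsmul ℝ ℝ)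

/-- `R ∈ L^∞_{w*}(0,T; M(Ω̄; ℝ^{d×d}_{sym,+}))`: an essentially bounded weakly* measurable family of
finite measures on `Ω̄` whose values are symmetric positive semidefinite matrices. -/
structure IsPosSemidefMeasureFamily {d : ℕ} (T : ℝ) (Ω : Set (Vec d))
    (R : ℝ → VectorMeasure (closure Ω) (Mat d)) : Prop where
  posSemidef : ∀ t A, MeasurableSet A → (R t A).PosSemidef
  weakStar_measurable : ∀ B : C(closure Ω, Mat d),
    AEMeasurable (fun t => matIntegral B (R t)) (volume.restrict (Ioo 0 T))
  bounded : ∃ C : ℝ≥0, ∀ᵐ t ∂(volume.restrict (Ioo 0 T)),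
    ∀ i j, (entry (R t) i j).variation univ ≤ C

/-- `R ∈ L^∞_{w*}(0,T; M(Ω̄; ℝ_+))`. -/
structure IsNonnegMeasureFamily {d : ℕ} (T : ℝ) (Ω : Set (Vec d))
    (R : ℝ → FiniteMeasure (closure Ω)) : Prop where
  weakStar_measurable : ∀ f : C(closure Ω, ℝ),
    AEMeasurable (fun t => ∫ x, f x ∂(R t : Measure (closure Ω))) (volume.restrict (Ioo 0 T))
  bounded : ∃ C : ℝ≥0, ∀ᵐ t ∂(volume.restrict (Ioo 0 T)), (R t).mass ≤ C

/-! ### Dissipative weak solutions -/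

/-- The weak continuity equation between the times `s` and `t`. -/
def ContinuityEquation {d : ℕ} {T : ℝ} {Ω : Set (Vec d)}
    (ρ : ℝ → Vec d → ℝ) (m : ℝ → Vec d → Vec d) (ψ : TestFunction T Ω ℝ) (s t : ℝ) : Prop :=
  -((∫ x in Ω, ρ t x * ψ.val t x) - ∫ x in Ω, ρ s x * ψ.val s x) +
    (∫ τ in s..t, ∫ x in Ω, (ρ τ x * ψ.dt τ x + ψ.grad τ x (m τ x))) = 0

/-- The weak momentum equation with Reynolds stress `R₁ + R₂ I` between the times `s` and `t`. -/
def MomentumEquation {d : ℕ} {T : ℝ} {Ω : Set (Vec d)} (γ : ℝ)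
    (ρ : ℝ → Vec d → ℝ) (m : ℝ → Vec d → Vec d)
    (R₁ : ℝ → VectorMeasure (closure Ω) (Mat d)) (R₂ : ℝ → FiniteMeasure (closure Ω))
    (φ : TestFunction T Ω (Vec d)) (s t : ℝ) : Prop :=
  -((∫ x in Ω, inner ℝ (m t x) (φ.val t x)) - ∫ x in Ω, inner ℝ (m s x) (φ.val s x)) +
    (∫ τ in s..t, ∫ x in Ω,
      (inner ℝ (m τ x) (φ.dt τ x) + frob (flux γ (ρ τ x) (m τ x)) (jac (φ.grad τ x)))) +
    (∫ τ in s..t,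
      (matIntegral (fun x : closure Ω => symPart (jac (φ.grad τ x))) (R₁ τ) +
        ∫ x : closure Ω, (jac (φ.grad τ x)).trace ∂(R₂ τ : Measure (closure Ω)))) = 0

/-- Dissipative weak solutions with initial data `(ρ₀, m₀)`. The updates express
`(ρ(0), m(0)) = (ρ₀, m₀)`. -/
structure IsDissipativeWeakSolution {d : ℕ} (T : ℝ) (Ω : Set (Vec d)) (γ : ℝ)
    (ρ₀ : Vec d → ℝ) (m₀ : Vec d → Vec d)
    (ρ : ℝ → Vec d → ℝ) (m : ℝ → Vec d → Vec d) (E : ℝ → ℝ) : Prop where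
  memLp_density : MemLinftyLp T Ω (ENNReal.ofReal γ) ρ
  memLp_momentum : MemLinftyLp T Ω (ENNReal.ofReal (2 * γ / (γ + 1))) m
  boundedVariation : BoundedVariationOn E (Icc 0 T)
  nonincreasing : IsNonincreasing T E
  exists_reynolds : ∃ (R₁ : ℝ → VectorMeasure (closure Ω) (Mat d))
    (R₂ : ℝ → FiniteMeasure (closure Ω)),
    IsPosSemidefMeasureFamily T Ω R₁ ∧ IsNonnegMeasureFamily T Ω R₂ ∧
    (∀ (ψ : TestFunction T Ω ℝ) (φ : TestFunction T Ω (Vec d)), φ.IsTangential →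
      ForAETimes T fun s t =>
        ContinuityEquation (Function.update ρ 0 ρ₀) (Function.update m 0 m₀) ψ s t ∧
        MomentumEquation γ (Function.update ρ 0 ρ₀) (Function.update m 0 m₀) R₁ R₂ φ s t) ∧
    ∀ᵐ t ∂(volume.restrict (Ioo 0 T)),
      ((1 / 2 * (R₁ t univ).trace + 1 / (γ - 1) * ((R₂ t).mass : ℝ) : ℝ) : EReal) ≤
        (E t : EReal) - (energy Ω γ (ρ t) (m t) : EReal)

end IsentropicEuler

end

/-!
# Energy-variational and dissipative weak solutions of the isentropic Euler system

Both notions of solution leave a gap between the auxiliary energy `E` and the mechanical energy,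
the energy defect `D = E - 𝓔(ρ, m) ≥ 0` (`defect`). The energy-variational inequality charges the
defect with the regularity weight of the test function; a dissipative weak solution realises it by
a Reynolds stress `R₁ + R₂ I` with dissipation `½ tr R₁ + R₂ / (γ - 1) ≤ D`. The two are dual: the
weight `max {2 ‖S₋‖_∞, (γ - 1) ‖q₋‖_∞}` of a pair `(S, q)` is the support function of the set of
stresses of dissipation at most one, that is, the supremum of `-∫ S : dR₁ - ∫ q dR₂` over that
set.

*Dissipative to variational.* The easy half of this duality, `neg_weight_mul_le_stressPower`,
bounds the power of the stress from below by minus the weight times the dissipation. Added to the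
weak equations and to the monotonicity of `E`, it gives the inequality
(`EnergyState.forAETimes_inequality`).

*Variational to dissipative.* The inequality with zero test functions gives the monotonicity of
`E`; with integer multiples of a scalar test function, the continuity equation; with large
multiples of a vector test function, the bound of the momentum functional by the weight integrated
against `D`, without the term in `E`. On test functions that vanish near the final time the
momentum functional depends therefore only on `(∇φ, div φ)`, and the Hahn–Banach theorem extends
it to a linear functional `l` on continuous pairs `(S, q)` on `[0,T] × Ω̄` that is still bounded
by the integrated weight (`EnergyState.exists_functional`). The bound vanishes on nonnegative
pairs, so `-l` is monotone, and the Riesz theorem represents it by a positive semidefinite matrix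
density and a nonnegative scalar density with respect to the finite measure `θ` that measures the
dissipation (`exists_posSemidef_density`). The time marginal of `θ` is dominated by `D dt`; hence
`θ` disintegrates into measures on `Ω̄` of mass at most `D(t)` (`exists_time_disintegration`), and
multiplied by the densities these are the Reynolds stresses (`EnergyState.exists_stress`). Finally
a du Bois-Reymond argument with time-dependent factors (`ae_eq_add_integral_of_weak`) turns the
momentum equation tested on `[0,T]` into an identity between almost all times.

An `EnergyState` collects the hypotheses common to both notions; the initial data enter as the
values at time `0`.
-/

open MeasureTheory Set Filter Topology
open scoped NNReal ENNReal

noncomputable section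

namespace IsentropicEuler

/-! ### Symmetric matrices -/

section Matrices

open scoped MatrixOrder

variable {d : ℕ}

lemma dotProduct_self_eq_norm_sq (v : Fin d → ℝ) : v ⬝ᵥ v = ‖WithLp.toLp 2 v‖ ^ 2 := by
  rw [EuclideanSpace.norm_sq_eq]
  simp [dotProduct, sq]

lemma dotProduct_self_nonneg' (v : Fin d → ℝ) : 0 ≤ v ⬝ᵥ v := by
  rw [dotProduct_self_eq_norm_sq]; positivity

lemma symPart_isHermitian (A : Mat d) : (symPart A).IsHermitian := by
  unfold symPart
  rw [Matrix.IsHermitian, Matrix.conjTranspose_smul, Matrix.conjTranspose_add,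
    Matrix.conjTranspose_eq_transpose_of_trivial, Matrix.conjTranspose_eq_transpose_of_trivial,
    Matrix.transpose_transpose, add_comm]
  simp

lemma dotProduct_symPart_mulVec (A : Mat d) (v : Fin d → ℝ) :
    v ⬝ᵥ (symPart A).mulVec v = v ⬝ᵥ A.mulVec v := by
  unfold symPart
  rw [Matrix.smul_mulVec, Matrix.add_mulVec, dotProduct_smul, dotProduct_add]
  have : v ⬝ᵥ A.transpose.mulVec v = v ⬝ᵥ A.mulVec v := by
    rw [Matrix.mulVec_transpose, dotProduct_comm, Matrix.dotProduct_mulVec]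
  rw [this, smul_eq_mul]; ring

lemma symNegPart_posSemidef (A : Mat d) : (symNegPart A).PosSemidef :=
  Matrix.nonneg_iff_posSemidef.mp (CFC.negPart_nonneg (symPart A))

lemma posPart_sub_symNegPart (A : Mat d) : (symPart A)⁺ - symNegPart A = symPart A :=
  CFC.posPart_sub_negPart (symPart A) (symPart_isHermitian A)

lemma dotProduct_mulVec_comm_of_posSemidef {P : Mat d} (hP : P.PosSemidef) (v w : Fin d → ℝ) :
    v ⬝ᵥ P.mulVec w = P.mulVec v ⬝ᵥ w := by
  have h : P.transpose = P := by
    rw [← Matrix.conjTranspose_eq_transpose_of_trivial]; exact hP.isHermitian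
  rw [Matrix.dotProduct_mulVec, ← Matrix.mulVec_transpose, h]

/-- Cauchy–Schwarz for the form of a positive semidefinite matrix. -/
lemma sq_dotProduct_mulVec_le {P : Mat d} (hP : P.PosSemidef) (v w : Fin d → ℝ) :
    (v ⬝ᵥ P.mulVec w) ^ 2 ≤ (v ⬝ᵥ P.mulVec v) * (w ⬝ᵥ P.mulVec w) := by
  have key : ∀ s : ℝ, 0 ≤ (w ⬝ᵥ P.mulVec w) * (s * s) + (2 * (v ⬝ᵥ P.mulVec w)) * s
      + (v ⬝ᵥ P.mulVec v) := by
    intro s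
    have := hP.dotProduct_mulVec_nonneg (v + s • w)
    have hc : w ⬝ᵥ P.mulVec v = v ⬝ᵥ P.mulVec w := by
      rw [dotProduct_mulVec_comm_of_posSemidef hP, dotProduct_comm]
    simp only [star_trivial, Matrix.mulVec_add, Matrix.mulVec_smul, dotProduct_add, add_dotProduct,
      smul_dotProduct, dotProduct_smul, smul_eq_mul, hc] at this
    linarith
  have := discrim_le_zero key
  unfold discrim at this
  nlinarith

/-- The spectral norm of the negative part of the symmetric part of `A` is the least `c ≥ 0` such
that `ξ · A ξ ≥ -c |ξ|²` for all `ξ`. -/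
lemma spectralNorm_symNegPart_le_iff (A : Mat d) {c : ℝ} (hc : 0 ≤ c) :
    spectralNorm (symNegPart A) ≤ c ↔
      ∀ v : Fin d → ℝ, -(c * (v ⬝ᵥ v)) ≤ v ⬝ᵥ A.mulVec v := by
  have hP := symNegPart_posSemidef A
  have hdec := posPart_sub_symNegPart A
  constructor
  · intro h v
    have hpos : 0 ≤ v ⬝ᵥ ((symPart A)⁺).mulVec v := by
      have := (Matrix.nonneg_iff_posSemidef.mp
        (CFC.posPart_nonneg (symPart A))).dotProduct_mulVec_nonneg v
      simpa using this
    have h1 : v ⬝ᵥ A.mulVec v =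
        v ⬝ᵥ ((symPart A)⁺).mulVec v - v ⬝ᵥ (symNegPart A).mulVec v := by
      rw [← dotProduct_symPart_mulVec, ← dotProduct_sub, ← Matrix.sub_mulVec, hdec]
    have h2 : v ⬝ᵥ (symNegPart A).mulVec v ≤ c * (v ⬝ᵥ v) := by
      have h3 : v ⬝ᵥ (symNegPart A).mulVec v
          = inner ℝ (Matrix.toEuclideanCLM (n := Fin d) (𝕜 := ℝ) (symNegPart A) (WithLp.toLp 2 v))
            (WithLp.toLp 2 v) := by
        rw [Matrix.toEuclideanCLM_toLp, EuclideanSpace.inner_toLp_toLp]; simp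
      rw [h3, dotProduct_self_eq_norm_sq]
      refine (real_inner_le_norm _ _).trans ?_
      have := (Matrix.toEuclideanCLM (n := Fin d) (𝕜 := ℝ) (symNegPart A)).le_of_opNorm_le h
        (WithLp.toLp 2 v)
      nlinarith [norm_nonneg (WithLp.toLp 2 v)]
    linarith
  · intro h
    -- With `P` the negative part, the moments `a k = v · P ^ k v` are log-convex, and the
    -- hypothesis at `P v` reads `a 3 ≤ c a 2`; hence `a 2 ≤ c a 1` and `a 1 ≤ c a 0`.
    set P := symNegPart A with hPdef
    refine ContinuousLinearMap.opNorm_le_bound _ hc fun x => ?_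
    set v : Fin d → ℝ := x.ofLp with hv
    have hx : x = WithLp.toLp 2 v := rfl
    rw [hx, Matrix.toEuclideanCLM_toLp]
    have hmul : (symPart A) * P = -(P * P) := by
      have h0 : (symPart A)⁺ * P = 0 := CFC.posPart_mul_negPart (symPart A)
      rw [← hdec, sub_mul, h0, zero_sub]
    set u := P.mulVec v with hu
    have e1 : v ⬝ᵥ P.mulVec u = u ⬝ᵥ u := by
      rw [dotProduct_mulVec_comm_of_posSemidef hP]
    have e3 : u ⬝ᵥ A.mulVec u = -(u ⬝ᵥ P.mulVec u) := by
      rw [← dotProduct_symPart_mulVec, hu, Matrix.mulVec_mulVec, hmul, Matrix.neg_mulVec,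
        dotProduct_neg, Matrix.mulVec_mulVec]
    have i3 : u ⬝ᵥ P.mulVec u ≤ c * (u ⬝ᵥ u) := by have := h u; rw [e3] at this; linarith
    have i2 := sq_dotProduct_mulVec_le hP v u
    rw [e1] at i2
    have i1 : (v ⬝ᵥ u) ^ 2 ≤ (v ⬝ᵥ v) * (u ⬝ᵥ u) := by
      have := sq_dotProduct_mulVec_le (P := (1 : Mat d)) Matrix.PosSemidef.one v u
      simpa using this
    have n0 := dotProduct_self_nonneg' v
    have n2 := dotProduct_self_nonneg' u
    have n1 : 0 ≤ v ⬝ᵥ u := by simpa using hP.dotProduct_mulVec_nonneg v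
    have k2 : u ⬝ᵥ u ≤ c * (v ⬝ᵥ u) := by
      rcases n2.eq_or_lt with h0 | h0
      · rw [← h0]; positivity
      · have : (u ⬝ᵥ u) * (u ⬝ᵥ u) ≤ (u ⬝ᵥ u) * (c * (v ⬝ᵥ u)) := by
          nlinarith [mul_le_mul_of_nonneg_left i3 n1]
        exact le_of_mul_le_mul_left this h0
    have k1 : v ⬝ᵥ u ≤ c * (v ⬝ᵥ v) := by
      rcases n1.eq_or_lt with h0 | h0
      · rw [← h0]; positivity
      · have : (v ⬝ᵥ u) * (v ⬝ᵥ u) ≤ (v ⬝ᵥ u) * (c * (v ⬝ᵥ v)) := by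
          nlinarith [mul_le_mul_of_nonneg_left k2 n0]
        exact le_of_mul_le_mul_left this h0
    have k : ‖WithLp.toLp 2 u‖ ^ 2 ≤ (c * ‖WithLp.toLp 2 v‖) ^ 2 := by
      rw [mul_pow, ← dotProduct_self_eq_norm_sq, ← dotProduct_self_eq_norm_sq]
      nlinarith [mul_le_mul_of_nonneg_left k1 hc]
    exact le_of_sq_le_sq k (by positivity)

/-- The size of the negative part of the symmetric part, as a function of the matrix. -/
def negBound (A : Mat d) : ℝ := spectralNorm (symNegPart A)

lemma negBound_nonneg (A : Mat d) : 0 ≤ negBound A := norm_nonneg _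

lemma negBound_le_iff (A : Mat d) {c : ℝ} (hc : 0 ≤ c) :
    negBound A ≤ c ↔ ∀ v : Fin d → ℝ, -(c * (v ⬝ᵥ v)) ≤ v ⬝ᵥ A.mulVec v :=
  spectralNorm_symNegPart_le_iff A hc

lemma neg_negBound_mul_le (A : Mat d) (v : Fin d → ℝ) :
    -(negBound A * (v ⬝ᵥ v)) ≤ v ⬝ᵥ A.mulVec v :=
  (negBound_le_iff A (negBound_nonneg A)).mp le_rfl v

lemma negBound_add_le (A B : Mat d) : negBound (A + B) ≤ negBound A + negBound B := by
  rw [negBound_le_iff _ (add_nonneg (negBound_nonneg A) (negBound_nonneg B))]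
  intro v
  rw [Matrix.add_mulVec, dotProduct_add]
  linarith [neg_negBound_mul_le A v, neg_negBound_mul_le B v]

lemma negBound_smul_le {c : ℝ} (hc : 0 ≤ c) (A : Mat d) : negBound (c • A) ≤ c * negBound A := by
  rw [negBound_le_iff _ (mul_nonneg hc (negBound_nonneg A))]
  intro v
  rw [Matrix.smul_mulVec, dotProduct_smul, smul_eq_mul]
  nlinarith [mul_le_mul_of_nonneg_left (neg_negBound_mul_le A v) hc]

lemma negBound_smul {c : ℝ} (hc : 0 ≤ c) (A : Mat d) : negBound (c • A) = c * negBound A := by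
  refine le_antisymm (negBound_smul_le hc A) ?_
  rcases hc.eq_or_lt with h0 | h0
  · rw [← h0, zero_mul]; exact negBound_nonneg _
  · have := negBound_smul_le (inv_nonneg.mpr hc) (c • A)
    rw [smul_smul, inv_mul_cancel₀ h0.ne', one_smul] at this
    calc c * negBound A ≤ c * (c⁻¹ * negBound (c • A)) := by gcongr
      _ = negBound (c • A) := by rw [← mul_assoc, mul_inv_cancel₀ h0.ne', one_mul]

lemma negBound_eq_zero {A : Mat d} (h : ∀ v : Fin d → ℝ, 0 ≤ v ⬝ᵥ A.mulVec v) :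
    negBound A = 0 :=
  le_antisymm ((negBound_le_iff A le_rfl).mpr (by simpa using h)) (negBound_nonneg A)

lemma negBound_neg_smul_one_le {c : ℝ} (hc : 0 ≤ c) : negBound ((-c) • (1 : Mat d)) ≤ c := by
  rw [negBound_le_iff _ hc]
  intro v
  rw [Matrix.smul_mulVec, Matrix.one_mulVec, dotProduct_smul, smul_eq_mul, neg_mul]

lemma negBound_symPart (A : Mat d) : negBound (symPart A) = negBound A := by
  apply le_antisymm
  · rw [negBound_le_iff _ (negBound_nonneg A)]
    intro v; rw [dotProduct_symPart_mulVec]; exact neg_negBound_mul_le A v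
  · rw [negBound_le_iff _ (negBound_nonneg _)]
    intro v; rw [← dotProduct_symPart_mulVec]; exact neg_negBound_mul_le _ v

lemma abs_mul_le_dotProduct_self (v : Fin d → ℝ) (i j : Fin d) : |v i * v j| ≤ v ⬝ᵥ v := by
  have h : ∀ k, v k * v k ≤ v ⬝ᵥ v := fun k =>
    Finset.single_le_sum (f := fun k => v k * v k) (fun k _ => mul_self_nonneg _)
      (Finset.mem_univ k)
  rw [abs_le]
  constructor <;> nlinarith [h i, h j, sq_nonneg (v i - v j), sq_nonneg (v i + v j)]

lemma dotProduct_mulVec_eq_sum (A : Mat d) (v : Fin d → ℝ) :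
    v ⬝ᵥ A.mulVec v = ∑ i, ∑ j, A i j * (v i * v j) := by
  simp only [dotProduct, Matrix.mulVec, Finset.mul_sum]
  exact Finset.sum_congr rfl fun i _ => Finset.sum_congr rfl fun j _ => by ring

lemma negBound_le_sum_abs (A : Mat d) : negBound A ≤ ∑ i, ∑ j, |A i j| := by
  rw [negBound_le_iff _ (by positivity)]
  intro v
  rw [dotProduct_mulVec_eq_sum, Finset.sum_mul, ← Finset.sum_neg_distrib]
  refine Finset.sum_le_sum fun i _ => ?_
  rw [Finset.sum_mul, ← Finset.sum_neg_distrib]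
  refine Finset.sum_le_sum fun j _ => ?_
  refine neg_le_of_abs_le ?_
  rw [abs_mul]
  gcongr
  exact abs_mul_le_dotProduct_self v i j

lemma abs_negBound_sub_le (A B : Mat d) :
    |negBound A - negBound B| ≤ ∑ i, ∑ j, |A i j - B i j| := by
  have key : ∀ A B : Mat d, negBound A - negBound B ≤ ∑ i, ∑ j, |A i j - B i j| := by
    intro A B
    have h1 := negBound_add_le B (A - B)
    have h2 := negBound_le_sum_abs (A - B)
    rw [add_sub_cancel] at h1
    simp only [Matrix.sub_apply] at h2
    linarith
  rw [abs_le]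
  refine ⟨?_, key A B⟩
  have := key B A
  simp only [abs_sub_comm (B _ _)] at this
  linarith

lemma continuous_negBound : Continuous (negBound : Mat d → ℝ) := by
  rw [continuous_iff_continuousAt]
  intro A
  have h : Tendsto (fun B : Mat d => ∑ i, ∑ j, |B i j - A i j|) (𝓝 A) (𝓝 0) := by
    have hc : Continuous fun B : Mat d => ∑ i, ∑ j, |B i j - A i j| := by
      refine continuous_finsetSum _ fun i _ => continuous_finsetSum _ fun j _ => ?_
      exact ((continuous_id.matrix_elem i j).sub continuous_const).abs
    simpa using hc.tendsto A
  rw [ContinuousAt, tendsto_iff_dist_tendsto_zero]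
  exact squeeze_zero (fun _ => dist_nonneg) (fun B => abs_negBound_sub_le B A) h

lemma frob_conjTranspose_mul_self (A B : Mat d) :
    frob A (B.conjTranspose * B) = ∑ k, (B k) ⬝ᵥ A.mulVec (B k) := by
  simp only [dotProduct_mulVec_eq_sum, frob, Matrix.mul_apply, Matrix.conjTranspose_apply,
    star_trivial, Finset.mul_sum]
  rw [Finset.sum_comm' (t' := Finset.univ) (s' := fun _ => Finset.univ) (by simp)]
  rw [Finset.sum_congr rfl fun j _ => Finset.sum_comm]
  rw [Finset.sum_comm]
  rw [Finset.sum_congr rfl fun j _ => Finset.sum_comm]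

/-- The trace inequality behind the positivity of the turbulent dissipation. -/
lemma neg_negBound_mul_trace_le_frob (A : Mat d) {P : Mat d} (hP : P.PosSemidef) :
    -(negBound A * P.trace) ≤ frob A P := by
  obtain ⟨B, rfl⟩ : ∃ B : Mat d, P = B.conjTranspose * B := by
    refine ⟨CFC.sqrt P, ?_⟩
    have h1 : (CFC.sqrt P).conjTranspose = CFC.sqrt P :=
      (Matrix.nonneg_iff_posSemidef.mp (CFC.sqrt_nonneg P)).isHermitian
    rw [h1, CFC.sqrt_mul_sqrt_self P (Matrix.nonneg_iff_posSemidef.mpr hP)]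
  have ht : (B.conjTranspose * B).trace = ∑ k, (B k) ⬝ᵥ (B k) := by
    simp only [Matrix.trace, Matrix.diag, Matrix.mul_apply, Matrix.conjTranspose_apply,
      star_trivial, dotProduct]
    exact Finset.sum_comm
  rw [frob_conjTranspose_mul_self, ht, Finset.mul_sum, ← Finset.sum_neg_distrib]
  exact Finset.sum_le_sum fun k _ => neg_negBound_mul_le A (B k)

/-- Positivity of a quadratic form may be tested on rational vectors. -/
lemma posSemidef_of_forall_rat {P : Mat d} (hs : ∀ i j, P i j = P j i)
    (h : ∀ v : Fin d → ℚ, 0 ≤ ∑ i, ∑ j, P i j * ((v i : ℝ) * (v j : ℝ))) : P.PosSemidef := by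
  refine Matrix.PosSemidef.of_dotProduct_mulVec_nonneg ?_ fun v => ?_
  · ext i j; simpa using hs j i
  · rw [star_trivial, dotProduct_mulVec_eq_sum]
    have hd : DenseRange fun (v : Fin d → ℚ) (i : Fin d) => (v i : ℝ) :=
      DenseRange.piMap fun _ => Rat.denseRange_cast
    have hc : IsClosed {v : Fin d → ℝ | 0 ≤ ∑ i, ∑ j, P i j * (v i * v j)} :=
      isClosed_le continuous_const (by fun_prop)
    exact hd.induction_on (p := fun v => 0 ≤ ∑ i, ∑ j, P i j * (v i * v j)) v hc h

lemma abs_apply_le_trace {P : Mat d} (hP : P.PosSemidef) (i j : Fin d) : |P i j| ≤ P.trace := by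
  have hs : P j i = P i j := by simpa using congrFun (congrFun hP.isHermitian i) j
  have hd : ∀ k, 0 ≤ P k k := fun k => hP.diag_nonneg
  have ht : ∀ k, P k k ≤ P.trace := fun k =>
    Finset.single_le_sum (f := fun k => P k k) (fun k _ => hd k) (Finset.mem_univ k)
  have key : P i j ^ 2 ≤ P i i * P j j := by
    have := sq_dotProduct_mulVec_le hP (Pi.single i 1) (Pi.single j 1)
    simpa using this
  have h0 : 0 ≤ P.trace := (hd i).trans (ht i)
  refine abs_le_of_sq_le_sq' (by nlinarith [hd i, hd j, ht i, ht j]) h0 |> abs_le.mpr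

end Matrices

/-! ### Functionals on continuous functions over a compact metric space -/

lemma measure_ext_of_integral_continuousMap {X : Type*} [MetricSpace X]
    [MeasurableSpace X] [BorelSpace X] {μ ν : Measure X}
    [IsFiniteMeasure μ] [IsFiniteMeasure ν] (h : ∀ f : C(X, ℝ), ∫ x, f x ∂μ = ∫ x, f x ∂ν) :
    μ = ν :=
  ext_of_forall_integral_eq_of_IsFiniteMeasure fun f => h f.toContinuousMap

section Riesz

variable {X : Type*} [MetricSpace X] [CompactSpace X] [MeasurableSpace X] [BorelSpace X]

lemma integrable_continuousMap (f : C(X, ℝ)) (μ : Measure X) [IsFiniteMeasure μ] :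
    Integrable (fun x => f x) μ :=
  Integrable.of_bound f.continuous.aestronglyMeasurable ‖f‖ (ae_of_all _ f.norm_coe_le_norm)

/-- The Riesz–Markov–Kakutani theorem on a compact space. -/
lemma exists_measure_of_nonneg (Λ : C(X, ℝ) →ₗ[ℝ] ℝ) (hΛ : ∀ f, 0 ≤ f → 0 ≤ Λ f) :
    ∃ μ : Measure X, IsFiniteMeasure μ ∧ ∀ f : C(X, ℝ), ∫ x, f x ∂μ = Λ f := by
  open scoped CompactlySupported in
  let toC : C_c(X, ℝ) →ₗ[ℝ] C(X, ℝ) :=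
    { toFun := fun f => f.toContinuousMap
      map_add' := fun _ _ => rfl
      map_smul' := fun _ _ => rfl }
  let L := PositiveLinearMap.mk₀ (Λ ∘ₗ toC) fun f hf => hΛ _ hf
  have : (RealRMK.rieszMeasure L).Regular := RealRMK.regular_rieszMeasure L
  refine ⟨RealRMK.rieszMeasure L, inferInstance, fun f => ?_⟩
  exact RealRMK.integral_rieszMeasure L
    (CompactlySupportedContinuousMap.continuousMapEquiv f)

/-- Finite measures are ordered as their integrals against nonnegative continuous functions: the
difference of the integrals is again represented by a measure. -/
lemma measure_le_of_integral_continuousMap {μ ν : Measure X} [IsFiniteMeasure μ]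
    [IsFiniteMeasure ν] (h : ∀ f : C(X, ℝ), 0 ≤ f → ∫ x, f x ∂μ ≤ ∫ x, f x ∂ν) : μ ≤ ν := by
  let Λ : C(X, ℝ) →ₗ[ℝ] ℝ :=
    { toFun := fun f => ∫ x, f x ∂ν - ∫ x, f x ∂μ
      map_add' := fun f g => by
        simp only [ContinuousMap.add_apply]
        rw [integral_add (integrable_continuousMap f ν) (integrable_continuousMap g ν),
          integral_add (integrable_continuousMap f μ) (integrable_continuousMap g μ)]
        ring
      map_smul' := fun c f => by
        simp only [ContinuousMap.smul_apply, smul_eq_mul, RingHom.id_apply, integral_const_mul]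
        ring }
  obtain ⟨σ, hσ, hσΛ⟩ := exists_measure_of_nonneg Λ fun f hf => sub_nonneg.mpr (h f hf)
  have : ν = μ + σ := measure_ext_of_integral_continuousMap fun f => by
    rw [integral_add_measure (integrable_continuousMap f μ) (integrable_continuousMap f σ), hσΛ f]
    simp [Λ]
  rw [this]
  exact Measure.le_add_right le_rfl

lemma integrable_continuousMap_mul (f : C(X, ℝ)) {μ : Measure X} {g : X → ℝ}
    (hg : Integrable g μ) : Integrable (fun x => f x * g x) μ :=
  hg.bdd_mul f.continuous.aestronglyMeasurable (ae_of_all _ f.norm_coe_le_norm)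

/-- A functional dominated by the integral against `θ` has a density with respect to `θ`. -/
lemma exists_density (lam : C(X, ℝ) →ₗ[ℝ] ℝ) (θ : Measure X) [IsFiniteMeasure θ] (C : ℝ)
    (h : ∀ f : C(X, ℝ), 0 ≤ f → |lam f| ≤ C * ∫ x, f x ∂θ) :
    ∃ g : X → ℝ, Measurable g ∧ Integrable g θ ∧ ∀ f : C(X, ℝ), lam f = ∫ x, f x * g x ∂θ := by
  have hC : ∀ f : C(X, ℝ), 0 ≤ f → 0 ≤ C * ∫ x, f x ∂θ := fun f hf => (abs_nonneg _).trans (h f hf)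
  let I : C(X, ℝ) →ₗ[ℝ] ℝ :=
    { toFun := fun f => ∫ x, f x ∂θ
      map_add' := fun f g =>
        integral_add (integrable_continuousMap f θ) (integrable_continuousMap g θ)
      map_smul' := fun c f => integral_const_mul c _ }
  obtain ⟨σ, hσ, hσΛ⟩ := exists_measure_of_nonneg (lam + C • I) fun f hf => by
    have := (abs_le.mp (h f hf)).1
    simp only [LinearMap.add_apply, LinearMap.smul_apply, smul_eq_mul]
    change 0 ≤ lam f + C * ∫ x, f x ∂θ
    linarith
  have hle : σ ≤ (2 * C).toNNReal • θ := by
    refine measure_le_of_integral_continuousMap fun f hf => ?_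
    rw [hσΛ, integral_smul_nnreal_measure, NNReal.smul_def, smul_eq_mul]
    have h1 := (abs_le.mp (h f hf)).2
    have h2 : (2 * C) * ∫ x, f x ∂θ ≤ ((2 * C).toNNReal : ℝ) * ∫ x, f x ∂θ :=
      mul_le_mul_of_nonneg_right (Real.le_coe_toNNReal _) (integral_nonneg hf)
    change lam f + C * ∫ x, f x ∂θ ≤ _
    linarith
  have hac : σ ≪ θ :=
    (Measure.absolutelyContinuous_of_le hle).trans (Measure.smul_absolutelyContinuous)
  have hint : Integrable (fun x => (σ.rnDeriv θ x).toReal) θ := Measure.integrable_toReal_rnDeriv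
  refine ⟨fun x => (σ.rnDeriv θ x).toReal - C, by fun_prop,
    hint.sub (integrable_const C), fun f => ?_⟩
  have e1 : ∫ x, f x * (σ.rnDeriv θ x).toReal ∂θ = ∫ x, f x ∂σ := by
    rw [← integral_rnDeriv_smul hac]
    exact integral_congr_ae (ae_of_all _ fun x => by simp [mul_comm])
  have e2 : ∫ x, f x ∂σ = lam f + C * ∫ x, f x ∂θ := hσΛ f
  simp only [mul_sub]
  rw [integral_sub (integrable_continuousMap_mul f hint)
    ((integrable_continuousMap f θ).mul_const C), e1, e2, integral_mul_const]
  ring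

/-- A density is nonnegative if it pairs nonnegatively with nonnegative continuous functions. -/
lemma ae_nonneg_of_integral_continuousMap {θ : Measure X} [IsFiniteMeasure θ] {g : X → ℝ}
    (hg : Integrable g θ) (h : ∀ f : C(X, ℝ), 0 ≤ f → 0 ≤ ∫ x, f x * g x ∂θ) : 0 ≤ᵐ[θ] g := by
  have hfin : ∀ g : X → ℝ, Integrable g θ →
      IsFiniteMeasure (θ.withDensity fun x => ENNReal.ofReal (g x)) := fun g hg =>
    isFiniteMeasure_withDensity_ofReal hg.2
  have hint : ∀ g : X → ℝ, Integrable g θ → ∀ f : C(X, ℝ),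
      ∫ x, f x ∂(θ.withDensity fun x => ENNReal.ofReal (g x)) = ∫ x, f x * max (g x) 0 ∂θ := by
    intro g hg f
    rw [integral_withDensity_eq_integral_toReal_smul₀ hg.1.aemeasurable.ennreal_ofReal
      (ae_of_all _ fun _ => ENNReal.ofReal_lt_top)]
    exact integral_congr_ae (ae_of_all _ fun x => by
      simp only [ENNReal.toReal_ofReal', smul_eq_mul]; ring)
  have := hfin g hg
  have := hfin (-g) hg.neg
  have hle : θ.withDensity (fun x => ENNReal.ofReal ((-g) x)) ≤
      θ.withDensity fun x => ENNReal.ofReal (g x) := by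
    refine measure_le_of_integral_continuousMap fun f hf => ?_
    rw [hint g hg, hint (-g) hg.neg, ← sub_nonneg, ← integral_sub
      (integrable_continuousMap_mul f hg.pos_part) (integrable_continuousMap_mul f hg.neg.pos_part)]
    refine (h f hf).trans_eq (integral_congr_ae (ae_of_all _ fun x => ?_))
    simp only [Pi.neg_apply]
    rcases le_total (g x) 0 with h0 | h0
    · rw [max_eq_right h0, max_eq_left (by linarith)]; ring
    · rw [max_eq_left h0, max_eq_right (by linarith)]; ring
  have hae := ae_le_of_forall_setLIntegral_le_of_sigmaFinite₀ (μ := θ)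
    (f := fun x => ENNReal.ofReal ((-g) x)) (g := fun x => ENNReal.ofReal (g x))
    hg.neg.1.aemeasurable.ennreal_ofReal fun s hs _ => by
      rw [← withDensity_apply _ hs, ← withDensity_apply _ hs]; exact hle s
  filter_upwards [hae] with x hx
  by_contra hneg
  have hneg' : g x < 0 := not_le.mp hneg
  rw [ENNReal.ofReal_of_nonpos hneg'.le, nonpos_iff_eq_zero, ENNReal.ofReal_eq_zero] at hx
  simp only [Pi.neg_apply] at hx
  linarith

end Riesz

/-! ### Functionals on continuous matrix fields -/

section MatrixFunctionals

variable {X : Type*} [TopologicalSpace X] {d : ℕ}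

/-- The matrix field `f A`, for a scalar function `f` and a constant matrix `A`. -/
def smulMat (A : Mat d) : C(X, ℝ) →ₗ[ℝ] C(X, Mat d) where
  toFun f := ⟨fun x => f x • A, by fun_prop⟩
  map_add' f g := by ext x : 1; simp [add_smul]
  map_smul' c f := by ext x : 1; simp [mul_smul]

@[simp] lemma smulMat_apply (A : Mat d) (f : C(X, ℝ)) (x : X) : smulMat A f x = f x • A := rfl

lemma smulMat_add (A B : Mat d) (f : C(X, ℝ)) :
    smulMat (A + B) f = smulMat A f + smulMat B f := by
  ext x : 1; simp

lemma smulMat_smul (c : ℝ) (A : Mat d) (f : C(X, ℝ)) :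
    smulMat (c • A) f = c • smulMat A f := by
  ext x : 1
  exact smul_comm (f x) c A

/-- The symmetric matrix unit `(e_i ⊗ e_j + e_j ⊗ e_i) / 2`. -/
def symUnit (i j : Fin d) : Mat d := symPart (Matrix.single i j 1)

lemma symUnit_comm (i j : Fin d) : symUnit i j = symUnit j i := by
  simp [symUnit, symPart, Matrix.transpose_single, add_comm]

lemma symPart_eq_sum (A : Mat d) : symPart A = ∑ i, ∑ j, A i j • symUnit i j := by
  have h : ∀ A : Mat d, A = ∑ i, ∑ j, A i j • Matrix.single i j (1 : ℝ) := fun A => by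
    conv_lhs => rw [Matrix.matrix_eq_sum_single A]
    simp [Matrix.smul_single]
  have hlin : symPart (∑ i, ∑ j, A i j • Matrix.single i j (1 : ℝ)) =
      ∑ i, ∑ j, A i j • symUnit i j := by
    simp only [symUnit, symPart, Matrix.transpose_sum, Matrix.transpose_smul, Finset.smul_sum,
      ← Finset.sum_add_distrib, smul_add, smul_comm (1 / 2 : ℝ)]
  rw [← hlin, ← h A]

lemma symPart_vecMulVec (v : Fin d → ℝ) :
    symPart (Matrix.vecMulVec v v) = Matrix.vecMulVec v v := by
  ext i j
  simp [symPart, Matrix.vecMulVec_apply]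
  ring

lemma sum_symUnit_diag : ∑ i : Fin d, symUnit i i = (1 : Mat d) := by
  have : ∀ i : Fin d, symUnit i i = Matrix.single i i (1 : ℝ) := by
    intro i
    simp only [symUnit, symPart, Matrix.transpose_single, ← two_smul ℝ (Matrix.single i i (1 : ℝ)),
      smul_smul]
    norm_num
  simp only [this]
  rw [Matrix.sum_single_one]

/-- The representation of a functional on pairs of a matrix field and a scalar field which is
nonpositive on nonnegative pairs: it is given by a positive semidefinite density `P` and a
nonnegative density `b` with respect to one measure `θ`, normalised by the functional of
`(a f I, c f)`. -/
theorem exists_posSemidef_density {X : Type*} [MetricSpace X] [CompactSpace X] [MeasurableSpace X]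
    [BorelSpace X] (l : C(X, Mat d) × C(X, ℝ) →ₗ[ℝ] ℝ)
    (hl : ∀ S q, (∀ x (v : Fin d → ℝ), 0 ≤ v ⬝ᵥ (S x).mulVec v) → (∀ x, 0 ≤ q x) → l (S, q) ≤ 0)
    {a c : ℝ} (ha : 0 < a) (hc : 0 < c) :
    ∃ (θ : Measure X) (P : X → Mat d) (b : X → ℝ), IsFiniteMeasure θ ∧
      (∀ i j, Measurable fun x => P x i j) ∧ Measurable b ∧ (∀ x, (P x).PosSemidef) ∧
      (∀ x, 0 ≤ b x) ∧ (∀ x, a * (P x).trace + c * b x ≤ 1) ∧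
      (∀ S q, -l (S, q) = ∫ x, (frob (S x) (P x) + q x * b x) ∂θ) ∧
      ∀ f : C(X, ℝ), ∫ x, f x ∂θ = -l (smulMat (a • 1) f, c • f) := by
  have hform : ∀ (r : ℝ) (A : Mat d) (v : Fin d → ℝ),
      v ⬝ᵥ (r • A).mulVec v = r * (v ⬝ᵥ A.mulVec v) := fun r A v => by
    rw [Matrix.smul_mulVec, dotProduct_smul, smul_eq_mul]
  have hadd : ∀ S S' q q', l (S + S', q + q') = l (S, q) + l (S', q') := fun S S' q q' =>
    l.map_add (S, q) (S', q')
  have hsmul : ∀ (r : ℝ) S q, l (r • S, r • q) = r * l (S, q) := fun r S q => l.map_smul r (S, q)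
  -- the normalising measure
  let Θ : C(X, ℝ) →ₗ[ℝ] ℝ := -(l ∘ₗ (LinearMap.prod (smulMat (a • 1)) (c • LinearMap.id)))
  have hΘ : ∀ f, Θ f = -l (smulMat (a • 1) f, c • f) := fun f => rfl
  obtain ⟨θ, hθ, hθΘ⟩ := exists_measure_of_nonneg Θ fun f hf => by
    rw [hΘ, neg_nonneg]
    refine hl _ _ (fun x v => ?_) fun x => ?_
    · rw [smulMat_apply, hform, hform, Matrix.one_mulVec]
      exact mul_nonneg (hf x) (mul_nonneg ha.le (dotProduct_self_nonneg' v))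
    · exact mul_nonneg hc.le (hf x)
  -- the functionals given by constant matrices and by scalars
  let lamM : Mat d → C(X, ℝ) →ₗ[ℝ] ℝ := fun A => -(l ∘ₗ LinearMap.prod (smulMat A) 0)
  have hlamM : ∀ A f, lamM A f = -l (smulMat A f, 0) := fun A f => rfl
  let lamS : C(X, ℝ) →ₗ[ℝ] ℝ := -(l ∘ₗ LinearMap.prod 0 LinearMap.id)
  have hlamS : ∀ f, lamS f = -l (0, f) := fun f => rfl
  have hboundM : ∀ A : Mat d, ∀ f : C(X, ℝ), 0 ≤ f →
      lamM A f ≤ ((∑ i, ∑ j, |A i j|) / a) * ∫ x, f x ∂θ := by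
    intro A f hf
    set C := ∑ i, ∑ j, |A i j| with hC
    have hC0 : 0 ≤ C := by positivity
    rw [hθΘ, hΘ, hlamM]
    have h1 := hl (smulMat (C • 1 - A) f) ((C / a * c) • f) (fun x v => by
      have h2 := neg_negBound_mul_le (-A) v
      have h3 := negBound_le_sum_abs (-A)
      simp only [Matrix.neg_apply, abs_neg] at h3
      rw [smulMat_apply, hform]
      refine mul_nonneg (hf x) ?_
      rw [Matrix.sub_mulVec, dotProduct_sub, hform, Matrix.one_mulVec]
      rw [Matrix.neg_mulVec, dotProduct_neg] at h2
      nlinarith [mul_le_mul_of_nonneg_right h3 (dotProduct_self_nonneg' v)])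
      (fun x => mul_nonneg (mul_nonneg (div_nonneg hC0 ha.le) hc.le) (hf x))
    have h2 : (smulMat (C • 1 - A) f, (C / a * c) • f) =
        (C / a) • (smulMat (a • 1) f, c • f) + (-1 : ℝ) • (smulMat A f, (0 : C(X, ℝ))) := by
      refine Prod.ext ?_ ?_
      · simp only [Prod.fst_add, Prod.smul_fst, ← smulMat_smul, ← smulMat_add, smul_smul]
        rw [div_mul_cancel₀ _ ha.ne', neg_one_smul, sub_eq_add_neg]
      · simp [smul_smul]
    rw [h2, map_add, map_smul, map_smul, smul_eq_mul, smul_eq_mul] at h1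
    linarith
  have hboundM' : ∀ A : Mat d, ∀ f : C(X, ℝ), 0 ≤ f →
      |lamM A f| ≤ ((∑ i, ∑ j, |A i j|) / a) * ∫ x, f x ∂θ := by
    intro A f hf
    rw [abs_le']
    refine ⟨hboundM A f hf, ?_⟩
    have h1 := hboundM (-A) f hf
    simp only [Matrix.neg_apply, abs_neg] at h1
    have h2 : lamM (-A) f = -lamM A f := by
      rw [hlamM, hlamM, ← neg_one_smul ℝ A, smulMat_smul]
      have := hsmul (-1) (smulMat A f) 0
      rw [smul_zero] at this
      rw [this]; ring
    rwa [h2] at h1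
  have hSnonneg : ∀ f : C(X, ℝ), 0 ≤ f → 0 ≤ lamS f := fun f hf => by
    rw [hlamS, neg_nonneg]
    exact hl 0 f (fun x v => by simp) hf
  have hboundS : ∀ f : C(X, ℝ), 0 ≤ f → |lamS f| ≤ c⁻¹ * ∫ x, f x ∂θ := by
    intro f hf
    rw [abs_of_nonneg (hSnonneg f hf), hθΘ, hΘ, hlamS]
    have h1 := hl (smulMat (a • 1) f) 0 (fun x v => by
      rw [smulMat_apply, hform, hform, Matrix.one_mulVec]
      exact mul_nonneg (hf x) (mul_nonneg ha.le (dotProduct_self_nonneg' v))) (fun x => le_rfl)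
    have h2 := hadd (smulMat (a • 1) f) 0 0 (c • f)
    have h3 := hsmul c 0 f
    rw [add_zero, zero_add] at h2
    rw [smul_zero] at h3
    rw [h2, h3, neg_add, mul_add]
    have h4 : c⁻¹ * -(c * l (0, f)) = -l (0, f) := by field_simp
    rw [h4]
    have : 0 ≤ c⁻¹ * -l (smulMat (a • 1) f, 0) := mul_nonneg (inv_nonneg.mpr hc.le) (by linarith)
    linarith
  choose g hgm hgi hg using fun A : Mat d => exists_density (lamM A) θ _ (hboundM' A)
  obtain ⟨β, hβm, hβi, hβ⟩ := exists_density lamS θ _ hboundS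
  let P₀ : X → Mat d := fun x => Matrix.of fun i j => g (symUnit i j) x
  have hP₀ : ∀ x i j, P₀ x i j = g (symUnit i j) x := fun _ _ _ => rfl
  have hP₀m : ∀ i j, Measurable fun x => P₀ x i j := fun i j => hgm _
  have hP₀i : ∀ i j, Integrable (fun x => P₀ x i j) θ := fun i j => hgi _
  have hsumlin : ∀ (A : Fin d → Fin d → C(X, ℝ)),
      ∑ i, ∑ j, lamM (symUnit i j) (A i j) =
        -l (∑ i, ∑ j, smulMat (symUnit i j) (A i j), 0) := by
    intro A
    let inl : C(X, Mat d) →ₗ[ℝ] C(X, Mat d) × C(X, ℝ) := LinearMap.inl ℝ _ _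
    have : ∀ S, l (S, 0) = (l ∘ₗ inl) S := fun S => rfl
    simp only [hlamM, this, map_sum, Finset.sum_neg_distrib]
  -- the densities are positive semidefinite, nonnegative, normalised
  have hpsd : ∀ᵐ x ∂θ, ∀ v : Fin d → ℚ, 0 ≤ ∑ i, ∑ j, P₀ x i j * ((v i : ℝ) * (v j : ℝ)) := by
    rw [ae_all_iff]
    intro v
    have hi : Integrable (fun x => ∑ i, ∑ j, P₀ x i j * ((v i : ℝ) * (v j : ℝ))) θ :=
      integrable_finsetSum _ fun i _ => integrable_finsetSum _ fun j _ => (hP₀i i j).mul_const _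
    refine ae_nonneg_of_integral_continuousMap hi fun f hf => ?_
    have e : ∫ x, f x * ∑ i, ∑ j, P₀ x i j * ((v i : ℝ) * (v j : ℝ)) ∂θ =
        ∑ i, ∑ j, lamM (symUnit i j) (((v i : ℝ) * (v j : ℝ)) • f) := by
      simp only [hg, Finset.mul_sum]
      rw [integral_finsetSum _ fun i _ => integrable_finsetSum _ fun j _ =>
        integrable_continuousMap_mul f ((hP₀i i j).mul_const _)]
      refine Finset.sum_congr rfl fun i _ => ?_
      rw [integral_finsetSum _ fun j _ =>
        integrable_continuousMap_mul f ((hP₀i i j).mul_const _)]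
      refine Finset.sum_congr rfl fun j _ => integral_congr_ae (ae_of_all _ fun x => ?_)
      simp only [ContinuousMap.smul_apply, smul_eq_mul, hP₀]; ring
    rw [e, hsumlin]
    have e2 : ∑ i, ∑ j, smulMat (symUnit i j) (((v i : ℝ) * (v j : ℝ)) • f) =
        smulMat (Matrix.vecMulVec (fun i => (v i : ℝ)) fun i => (v i : ℝ)) f := by
      rw [← symPart_vecMulVec, symPart_eq_sum]
      ext x : 1
      simp only [ContinuousMap.sum_apply, smulMat_apply, ContinuousMap.smul_apply,
        Matrix.vecMulVec_apply, Finset.smul_sum, smul_smul, smul_eq_mul]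
      exact Finset.sum_congr rfl fun i _ => Finset.sum_congr rfl fun j _ => by
        rw [mul_comm]
    rw [e2, neg_nonneg]
    refine hl _ _ (fun x w => ?_) fun x => le_rfl
    rw [smulMat_apply, hform]
    refine mul_nonneg (hf x) ?_
    have : w ⬝ᵥ (Matrix.vecMulVec (fun i => (v i : ℝ)) fun i => (v i : ℝ)).mulVec w =
        (w ⬝ᵥ fun i => (v i : ℝ)) * (w ⬝ᵥ fun i => (v i : ℝ)) := by
      rw [dotProduct_mulVec_eq_sum]
      simp only [dotProduct, Finset.sum_mul_sum, Matrix.vecMulVec_apply]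
      exact Finset.sum_congr rfl fun i _ => Finset.sum_congr rfl fun j _ => by ring
    rw [this]
    exact mul_self_nonneg _
  have hβ0 : ∀ᵐ x ∂θ, 0 ≤ β x := ae_nonneg_of_integral_continuousMap hβi fun f hf => by
    rw [← hβ]; exact hSnonneg f hf
  have htri : Integrable (fun x => (P₀ x).trace) θ :=
    integrable_finsetSum _ fun i _ => hP₀i i i
  have htr : ∀ᵐ x ∂θ, a * (P₀ x).trace + c * β x ≤ 1 := by
    have hi : Integrable (fun x => 1 - (a * (P₀ x).trace + c * β x)) θ :=
      (integrable_const 1).sub ((htri.const_mul a).add (hβi.const_mul c))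
    have := ae_nonneg_of_integral_continuousMap hi fun f hf => by
      have e1 : ∫ x, f x * (P₀ x).trace ∂θ = lamM 1 f := by
        have h1 : lamM 1 f = ∑ i, lamM (symUnit i i) f := by
          have h2 : smulMat (1 : Mat d) f = ∑ i, smulMat (symUnit i i) f := by
            rw [← sum_symUnit_diag]
            ext x : 1
            simp [Finset.smul_sum]
          let inl : C(X, Mat d) →ₗ[ℝ] C(X, Mat d) × C(X, ℝ) := LinearMap.inl ℝ _ _
          have : ∀ S, l (S, 0) = (l ∘ₗ inl) S := fun S => rfl
          simp only [hlamM, h2, this, map_sum, Finset.sum_neg_distrib]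
        rw [h1]
        simp only [hg, Matrix.trace, Matrix.diag, Finset.mul_sum, hP₀]
        exact integral_finsetSum _ fun i _ => integrable_continuousMap_mul f (hP₀i i i)
      have e2 : ∫ x, f x * (1 - (a * (P₀ x).trace + c * β x)) ∂θ =
          ∫ x, f x ∂θ - (a * ∫ x, f x * (P₀ x).trace ∂θ + c * ∫ x, f x * β x ∂θ) := by
        rw [← integral_const_mul, ← integral_const_mul, ← integral_add
          ((integrable_continuousMap_mul f htri).const_mul a)
          ((integrable_continuousMap_mul f hβi).const_mul c), ← integral_sub
          (integrable_continuousMap f θ) (by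
            exact ((integrable_continuousMap_mul f htri).const_mul a).add
              ((integrable_continuousMap_mul f hβi).const_mul c))]
        exact integral_congr_ae (ae_of_all _ fun x => by ring)
      rw [e2, e1, ← hβ, hθΘ, hΘ, hlamM, hlamS]
      have h2 := hadd (smulMat (a • 1) f) 0 0 (c • f)
      have h3 := hsmul c 0 f
      have h4 := hsmul a (smulMat 1 f) 0
      rw [add_zero, zero_add] at h2
      rw [smul_zero] at h3 h4
      rw [h2, h3, smulMat_smul, h4]
      linarith
    filter_upwards [this] with x hx
    have : 0 ≤ 1 - (a * (P₀ x).trace + c * β x) := hx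
    linarith
  -- modification on a null set
  let G : Set X := {x | ∀ v : Fin d → ℚ, 0 ≤ ∑ i, ∑ j, P₀ x i j * ((v i : ℝ) * (v j : ℝ))} ∩
    ({x | 0 ≤ β x} ∩ {x | a * (P₀ x).trace + c * β x ≤ 1})
  have hGm : MeasurableSet G := by
    refine MeasurableSet.inter ?_ (MeasurableSet.inter ?_ ?_)
    · rw [Set.ofPred_forall]
      refine MeasurableSet.iInter fun v => measurableSet_le measurable_const ?_
      exact Finset.measurable_sum _ fun i _ => Finset.measurable_sum _ fun j _ =>
        (hP₀m i j).mul_const _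
    · exact measurableSet_le measurable_const hβm
    · refine measurableSet_le (((Finset.measurable_sum _ fun i _ => hP₀m i i).const_mul a).add
        (hβm.const_mul c)) measurable_const
  have hGae : ∀ᵐ x ∂θ, x ∈ G := by
    filter_upwards [hpsd, hβ0, htr] with x h1 h2 h3 using ⟨h1, h2, h3⟩
  refine ⟨θ, G.indicator P₀, G.indicator β, hθ, fun i j => ?_, hβm.indicator hGm, fun x => ?_,
    fun x => ?_, fun x => ?_, fun S q => ?_, fun f => by rw [hθΘ, hΘ]⟩
  · have : (fun x => G.indicator P₀ x i j) = G.indicator fun x => P₀ x i j := by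
      ext x
      by_cases hx : x ∈ G <;> simp [hx]
    rw [this]
    exact (hP₀m i j).indicator hGm
  · by_cases hx : x ∈ G
    · rw [indicator_of_mem hx]
      exact posSemidef_of_forall_rat (fun i j => by simp only [hP₀, symUnit_comm i j]) hx.1
    · rw [indicator_of_notMem hx]; exact Matrix.PosSemidef.zero
  · by_cases hx : x ∈ G
    · rw [indicator_of_mem hx]; exact hx.2.1
    · rw [indicator_of_notMem hx]
  · by_cases hx : x ∈ G
    · rw [indicator_of_mem hx, indicator_of_mem hx]; exact hx.2.2
    · rw [indicator_of_notMem hx, indicator_of_notMem hx]; simp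
  · -- only the symmetric part of `S` matters
    let Sc : Fin d → Fin d → C(X, ℝ) := fun i j =>
      ⟨fun x => S x i j, S.continuous.matrix_elem i j⟩
    let S' : C(X, Mat d) := ∑ i, ∑ j, smulMat (symUnit i j) (Sc i j)
    have hS' : ∀ x, S' x = symPart (S x) := fun x => by
      simp only [S', ContinuousMap.sum_apply, smulMat_apply]
      exact (symPart_eq_sum (S x)).symm
    have hS'form : ∀ x (v : Fin d → ℝ), v ⬝ᵥ (S' x).mulVec v = v ⬝ᵥ (S x).mulVec v := fun x v => by
      rw [hS', dotProduct_symPart_mulVec]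
    have e1 : l (S, 0) = l (S', 0) := by
      have h1 := hl (S - S') 0 (fun x v => by
        rw [ContinuousMap.sub_apply, Matrix.sub_mulVec, dotProduct_sub, hS'form, sub_self])
        fun x => le_rfl
      have h2 := hl (S' - S) 0 (fun x v => by
        rw [ContinuousMap.sub_apply, Matrix.sub_mulVec, dotProduct_sub, hS'form, sub_self])
        fun x => le_rfl
      have h3 := hadd (S - S') S' 0 0
      have h4 := hadd (S' - S) S 0 0
      rw [sub_add_cancel, add_zero] at h3 h4
      linarith
    have e2 : -l (S, q) = ∑ i, ∑ j, lamM (symUnit i j) (Sc i j) + lamS q := by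
      have h2 := hadd S 0 0 q
      rw [add_zero, zero_add] at h2
      rw [hsumlin, hlamS, h2, e1]
      ring
    have hi1 : Integrable (fun x => frob (S x) (P₀ x)) θ :=
      integrable_finsetSum _ fun i _ => integrable_finsetSum _ fun j _ =>
        integrable_continuousMap_mul (Sc i j) (hP₀i i j)
    have e3 : ∫ x, (frob (S x) (G.indicator P₀ x) + q x * G.indicator β x) ∂θ =
        ∫ x, (frob (S x) (P₀ x) + q x * β x) ∂θ := by
      refine integral_congr_ae ?_
      filter_upwards [hGae] with x hx
      rw [indicator_of_mem hx, indicator_of_mem hx]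
    rw [e2, e3, integral_add hi1 (integrable_continuousMap_mul q hβi), ← hβ]
    congr 1
    change _ = ∫ x, ∑ i, ∑ j, Sc i j x * P₀ x i j ∂θ
    rw [integral_finsetSum _ fun i _ => integrable_finsetSum _ fun j _ =>
        integrable_continuousMap_mul (Sc i j) (hP₀i i j)]
    refine Finset.sum_congr rfl fun i _ => ?_
    rw [integral_finsetSum _ fun j _ => integrable_continuousMap_mul (Sc i j) (hP₀i i j)]
    exact Finset.sum_congr rfl fun j _ => hg _ _

end MatrixFunctionals

/-! ### Matrix-valued measures -/

section VectorMeasures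

variable {X : Type*} [MeasurableSpace X] {d : ℕ}

lemma integral_lsmul_toSignedMeasure (μ : Measure X) [IsFiniteMeasure μ] (f : X → ℝ) :
    μ.toSignedMeasure.integral f (ContinuousLinearMap.lsmul ℝ ℝ) = ∫ x, f x ∂μ := by
  have h : (ContinuousLinearMap.lsmul ℝ ℝ : ℝ →L[ℝ] ℝ →L[ℝ] ℝ) =
      (ContinuousLinearMap.lsmul ℝ ℝ (E := ℝ)).flip := by
    ext; simp
  rw [h]
  exact VectorMeasure.integral_toSignedMeasure

lemma integral_withDensityᵥ {θ : Measure X} {f g : X → ℝ} {C : ℝ} (hg : Integrable g θ)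
    (hf : Measurable f) (hfC : ∀ x, |f x| ≤ C) :
    (θ.withDensityᵥ g).integral f (ContinuousLinearMap.lsmul ℝ ℝ) = ∫ x, f x * g x ∂θ := by
  have hp : IsFiniteMeasure (θ.withDensity fun x => ENNReal.ofReal (g x)) :=
    isFiniteMeasure_withDensity_ofReal hg.2
  have hn : IsFiniteMeasure (θ.withDensity fun x => ENNReal.ofReal (-g x)) :=
    isFiniteMeasure_withDensity_ofReal hg.neg.2
  have hint : ∀ μ : Measure X, IsFiniteMeasure μ → Integrable f μ := fun μ _ =>
    Integrable.of_bound hf.aestronglyMeasurable C (ae_of_all _ hfC)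
  have hw : ∀ h : X → ℝ, Integrable h θ →
      ∫ x, f x ∂(θ.withDensity fun x => ENNReal.ofReal (h x)) = ∫ x, f x * max (h x) 0 ∂θ := by
    intro h hh
    rw [integral_withDensity_eq_integral_toReal_smul₀ hh.1.aemeasurable.ennreal_ofReal
      (ae_of_all _ fun _ => ENNReal.ofReal_lt_top)]
    exact integral_congr_ae (ae_of_all _ fun x => by
      simp only [ENNReal.toReal_ofReal', smul_eq_mul]; ring)
  have hb : ∀ h : X → ℝ, Integrable h θ → Integrable (fun x => f x * h x) θ := fun h hh =>
    hh.bdd_mul hf.aestronglyMeasurable (ae_of_all _ hfC)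
  rw [withDensityᵥ_eq_withDensity_pos_part_sub_withDensity_neg_part hg,
    VectorMeasure.integral_sub_vectorMeasure, integral_lsmul_toSignedMeasure,
    integral_lsmul_toSignedMeasure, hw g hg, hw (fun x => -g x) hg.neg,
    ← integral_sub (hb _ hg.pos_part) (hb (fun x => max (-g x) 0) hg.neg.pos_part)]
  · refine integral_congr_ae (ae_of_all _ fun x => ?_)
    dsimp only
    rcases le_total (g x) 0 with h0 | h0
    · rw [max_eq_right h0, max_eq_left (by linarith)]; ring
    · rw [max_eq_left h0, max_eq_right (by linarith)]; ring
  · rw [VectorMeasure.Integrable, Measure.variation_toSignedMeasure]; exact hint _ hp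
  · rw [VectorMeasure.Integrable, Measure.variation_toSignedMeasure]; exact hint _ hn

/-- The matrix-valued measure with density `P` with respect to `θ`. -/
def matWithDensity (θ : Measure X) (P : X → Mat d) : VectorMeasure X (Mat d) where
  measureOf' A := Matrix.of fun i j => θ.withDensityᵥ (fun x => P x i j) A
  empty' := by ext i j; simp
  not_measurable' A hA := by
    ext i j; exact VectorMeasure.not_measurable _ hA
  m_iUnion' f hf hd := by
    refine Pi.hasSum.mpr fun i => Pi.hasSum.mpr fun j => ?_
    exact VectorMeasure.m_iUnion _ hf hd

lemma matWithDensity_apply (θ : Measure X) (P : X → Mat d) (A : Set X) (i j : Fin d) :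
    matWithDensity θ P A i j = θ.withDensityᵥ (fun x => P x i j) A := rfl

lemma entry_apply (R : VectorMeasure X (Mat d)) (i j : Fin d) (A : Set X) :
    entry R i j A = R A i j := rfl

lemma entry_matWithDensity (θ : Measure X) (P : X → Mat d) (i j : Fin d) :
    entry (matWithDensity θ P) i j = θ.withDensityᵥ fun x => P x i j := by
  ext A _; rfl

variable {θ : Measure X} {P : X → Mat d}

lemma matIntegral_matWithDensity {B : X → Mat d} {C : ℝ}
    (hP : ∀ i j, Integrable (fun x => P x i j) θ) (hB : ∀ i j, Measurable fun x => B x i j)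
    (hBC : ∀ x i j, |B x i j| ≤ C) :
    matIntegral B (matWithDensity θ P) = ∫ x, frob (B x) (P x) ∂θ := by
  have hi : ∀ i j, Integrable (fun x => B x i j * P x i j) θ := fun i j =>
    (hP i j).bdd_mul (hB i j).aestronglyMeasurable (ae_of_all _ fun x => hBC x i j)
  unfold frob matIntegral
  rw [integral_finsetSum _ fun i _ => integrable_finsetSum _ fun j _ => hi i j]
  refine Finset.sum_congr rfl fun i _ => ?_
  rw [integral_finsetSum _ fun j _ => hi i j]
  refine Finset.sum_congr rfl fun j _ => ?_
  rw [entry_matWithDensity, integral_withDensityᵥ (hP i j) (hB i j) fun x => hBC x i j]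

/-- The form of a matrix-valued measure with density, on a measurable set. -/
lemma sum_matWithDensity_mul (hP : ∀ i j, Integrable (fun x => P x i j) θ) {A : Set X}
    (hA : MeasurableSet A) (v : Fin d → ℝ) :
    ∑ i, ∑ j, matWithDensity θ P A i j * (v i * v j) =
      ∫ x in A, ∑ i, ∑ j, P x i j * (v i * v j) ∂θ := by
  have hi : ∀ i j, Integrable (fun x => P x i j * (v i * v j)) (θ.restrict A) := fun i j =>
    (hP i j).restrict.mul_const _
  rw [integral_finsetSum _ fun i _ => integrable_finsetSum _ fun j _ => hi i j]
  refine Finset.sum_congr rfl fun i _ => ?_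
  rw [integral_finsetSum _ fun j _ => hi i j]
  refine Finset.sum_congr rfl fun j _ => ?_
  rw [matWithDensity_apply, withDensityᵥ_apply (hP i j) hA, integral_mul_const]

lemma matWithDensity_posSemidef (hP : ∀ i j, Integrable (fun x => P x i j) θ)
    (hpsd : ∀ x, (P x).PosSemidef) {A : Set X} (hA : MeasurableSet A) :
    (matWithDensity θ P A).PosSemidef := by
  refine posSemidef_of_forall_rat (fun i j => ?_) fun v => ?_
  · have : (fun x => P x i j) = fun x => P x j i := by
      ext x; simpa using congrFun (congrFun (hpsd x).isHermitian j) i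
    rw [matWithDensity_apply, matWithDensity_apply, this]
  · rw [sum_matWithDensity_mul hP hA]
    refine integral_nonneg fun x => ?_
    have := (hpsd x).dotProduct_mulVec_nonneg fun i => (v i : ℝ)
    rwa [star_trivial, dotProduct_mulVec_eq_sum] at this

lemma trace_matWithDensity (hP : ∀ i j, Integrable (fun x => P x i j) θ) :
    (matWithDensity θ P univ).trace = ∫ x, (P x).trace ∂θ := by
  unfold Matrix.trace
  simp only [Matrix.diag_apply]
  rw [integral_finsetSum _ fun i _ => hP i i]
  refine Finset.sum_congr rfl fun i _ => ?_
  rw [matWithDensity_apply, withDensityᵥ_apply (hP i i) MeasurableSet.univ,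
    setIntegral_univ]

lemma isFiniteMeasure_variation (s : SignedMeasure X) : IsFiniteMeasure s.variation := by
  rw [← SignedMeasure.totalVariation_eq_variation]
  unfold SignedMeasure.totalVariation
  infer_instance

/-- Every matrix-valued measure has a density with respect to a finite measure. -/
lemma exists_eq_matWithDensity (R : VectorMeasure X (Mat d)) :
    ∃ (θ : Measure X) (P : X → Mat d), IsFiniteMeasure θ ∧
      (∀ i j, Integrable (fun x => P x i j) θ) ∧ R = matWithDensity θ P := by
  have hfin := fun i j => isFiniteMeasure_variation (entry R i j)
  let θ : Measure X := ∑ i, ∑ j, (entry R i j).variation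
  have hθ : IsFiniteMeasure θ := by
    have h : ∀ i, IsFiniteMeasure (∑ j, (entry R i j).variation) := fun i => inferInstance
    exact inferInstance
  have hac : ∀ i j, entry R i j ≪ᵥ θ.toENNRealVectorMeasure := by
    intro i j
    refine VectorMeasure.AbsolutelyContinuous.mk fun A hA h0 => ?_
    rw [Measure.toENNRealVectorMeasure_apply_measurable hA] at h0
    have hle : (entry R i j).variation A ≤ θ A := by
      simp only [θ, Measure.finsetSum_apply]
      exact (Finset.single_le_sum (f := fun j => (entry R i j).variation A) (fun _ _ => zero_le)
        (Finset.mem_univ j)).trans (Finset.single_le_sum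
          (f := fun i => ∑ j, (entry R i j).variation A) (fun _ _ => zero_le)
        (Finset.mem_univ i))
    have h1 := VectorMeasure.enorm_measure_le_variation (entry R i j) A
    rw [h0] at hle
    simpa using h1.trans hle
  refine ⟨θ, fun x => Matrix.of fun i j => (entry R i j).rnDeriv θ x, hθ, fun i j => ?_, ?_⟩
  · exact SignedMeasure.integrable_rnDeriv _ _
  · ext A hA i j
    rw [matWithDensity_apply, ← entry_apply]
    have := SignedMeasure.withDensityᵥ_rnDeriv_eq (entry R i j) θ (hac i j)
    exact (congrArg (fun s : SignedMeasure X => s A) this).symm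

/-- The trace inequality, integrated against a measure with positive semidefinite values. -/
theorem neg_mul_trace_le_matIntegral (R : VectorMeasure X (Mat d))
    (hR : ∀ A, MeasurableSet A → (R A).PosSemidef) {B : X → Mat d} {C c : ℝ}
    (hB : ∀ i j, Measurable fun x => B x i j) (hBC : ∀ x i j, |B x i j| ≤ C)
    (hc : ∀ x, negBound (B x) ≤ c) : -(c * (R univ).trace) ≤ matIntegral B R := by
  obtain ⟨θ, P, hθ, hP, rfl⟩ := exists_eq_matWithDensity R
  have hform : ∀ᵐ x ∂θ, ∀ v : Fin d → ℚ, 0 ≤ ∑ i, ∑ j, P x i j * ((v i : ℝ) * (v j : ℝ)) := by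
    rw [ae_all_iff]
    intro v
    refine ae_nonneg_of_forall_setIntegral_nonneg
      (integrable_finsetSum _ fun i _ => integrable_finsetSum _ fun j _ => (hP i j).mul_const _)
      fun A hA _ => ?_
    rw [← sum_matWithDensity_mul hP hA]
    have := (hR A hA).dotProduct_mulVec_nonneg fun i => (v i : ℝ)
    rwa [star_trivial, dotProduct_mulVec_eq_sum] at this
  have hsym : ∀ᵐ x ∂θ, ∀ i j, P x i j = P x j i := by
    rw [ae_all_iff]; intro i
    rw [ae_all_iff]; intro j
    refine (hP i j).ae_eq_of_forall_setIntegral_eq _ _ (hP j i) fun A hA _ => ?_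
    rw [← withDensityᵥ_apply (hP i j) hA, ← withDensityᵥ_apply (hP j i) hA,
      ← matWithDensity_apply θ P A i j, ← matWithDensity_apply θ P A j i]
    simpa using congrFun (congrFun (hR A hA).isHermitian j) i
  rw [matIntegral_matWithDensity hP hB hBC, trace_matWithDensity hP, ← integral_const_mul,
    ← integral_neg]
  have hi : ∀ i j, Integrable (fun x => B x i j * P x i j) θ := fun i j =>
    (hP i j).bdd_mul (hB i j).aestronglyMeasurable (ae_of_all _ fun x => hBC x i j)
  refine integral_mono_ae
    ((integrable_finsetSum _ fun i _ => hP i i).const_mul c).neg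
    (integrable_finsetSum _ fun i _ => integrable_finsetSum _ fun j _ => hi i j) ?_
  filter_upwards [hform, hsym] with x h1 h2
  have hpsd := posSemidef_of_forall_rat h2 h1
  refine le_trans ?_ (neg_negBound_mul_trace_le_frob (B x) hpsd)
  exact neg_le_neg (mul_le_mul_of_nonneg_right (hc x) hpsd.trace_nonneg)

end VectorMeasures

/-! ### Test functions -/

section TestFunctions

variable {d : ℕ} {T : ℝ} {Ω : Set (Vec d)} {F : Type} [NormedAddCommGroup F] [NormedSpace ℝ F]

namespace TestFunction

/-- The zero test function. -/
def zero (T : ℝ) (Ω : Set (Vec d)) (F : Type) [NormedAddCommGroup F] [NormedSpace ℝ F] :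
    TestFunction T Ω F where
  val _ _ := 0
  grad _ _ := 0
  dt _ _ := 0
  gradDt _ _ := 0
  continuousOn_val := continuousOn_const
  continuousOn_grad := continuousOn_const
  continuousOn_dt := continuousOn_const
  continuousOn_gradDt := continuousOn_const
  hasFDerivAt_val _ _ _ _ := hasFDerivAt_const _ _
  hasFDerivAt_dt _ _ _ _ := hasFDerivAt_const _ _
  hasDerivWithinAt_val _ _ _ _ := hasDerivWithinAt_const _ _ _

/-- The sum of two test functions. -/
def add (φ χ : TestFunction T Ω F) : TestFunction T Ω F where
  val t x := φ.val t x + χ.val t x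
  grad t x := φ.grad t x + χ.grad t x
  dt t x := φ.dt t x + χ.dt t x
  gradDt t x := φ.gradDt t x + χ.gradDt t x
  continuousOn_val := φ.continuousOn_val.add χ.continuousOn_val
  continuousOn_grad := φ.continuousOn_grad.add χ.continuousOn_grad
  continuousOn_dt := φ.continuousOn_dt.add χ.continuousOn_dt
  continuousOn_gradDt := φ.continuousOn_gradDt.add χ.continuousOn_gradDt
  hasFDerivAt_val t ht x hx := (φ.hasFDerivAt_val t ht x hx).add (χ.hasFDerivAt_val t ht x hx)
  hasFDerivAt_dt t ht x hx := (φ.hasFDerivAt_dt t ht x hx).add (χ.hasFDerivAt_dt t ht x hx)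
  hasDerivWithinAt_val t ht x hx :=
    (φ.hasDerivWithinAt_val t ht x hx).add (χ.hasDerivWithinAt_val t ht x hx)

/-- The product of a test function with a `C^1` function `h` of time, with derivative `h'`. -/
def mulTime (φ : TestFunction T Ω F) (h h' : ℝ → ℝ) (hh : ∀ t, HasDerivAt h (h' t) t)
    (hh' : Continuous h') : TestFunction T Ω F :=
  have hc : Continuous h := continuous_iff_continuousAt.mpr fun t => (hh t).continuousAt
  have hcon : ContinuousOn (fun q : ℝ × Vec d => h q.1) (Icc 0 T ×ˢ closure Ω) :=
    (hc.comp continuous_fst).continuousOn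
  have hcon' : ContinuousOn (fun q : ℝ × Vec d => h' q.1) (Icc 0 T ×ˢ closure Ω) :=
    (hh'.comp continuous_fst).continuousOn
  { val := fun t x => h t • φ.val t x
    grad := fun t x => h t • φ.grad t x
    dt := fun t x => h t • φ.dt t x + h' t • φ.val t x
    gradDt := fun t x => h t • φ.gradDt t x + h' t • φ.grad t x
    continuousOn_val := hcon.smul φ.continuousOn_val
    continuousOn_grad := hcon.smul φ.continuousOn_grad
    continuousOn_dt := (hcon.smul φ.continuousOn_dt).add (hcon'.smul φ.continuousOn_val)
    continuousOn_gradDt := (hcon.smul φ.continuousOn_gradDt).add (hcon'.smul φ.continuousOn_grad)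
    hasFDerivAt_val := fun t ht x hx => (φ.hasFDerivAt_val t ht x hx).const_smul (h t)
    hasFDerivAt_dt := fun t ht x hx => ((φ.hasFDerivAt_dt t ht x hx).const_smul (h t)).add
      ((φ.hasFDerivAt_val t ht x hx).const_smul (h' t))
    hasDerivWithinAt_val := fun t ht x hx =>
      (hh t).hasDerivWithinAt.smul (φ.hasDerivWithinAt_val t ht x hx) }

/-- A constant multiple of a test function. -/
def constSMul (c : ℝ) (φ : TestFunction T Ω F) : TestFunction T Ω F :=
  φ.mulTime (fun _ => c) (fun _ => 0) (fun t => hasDerivAt_const t c) continuous_const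

@[simp] lemma zero_val (t : ℝ) (x : Vec d) : (zero T Ω F).val t x = 0 := rfl
@[simp] lemma zero_grad (t : ℝ) (x : Vec d) : (zero T Ω F).grad t x = 0 := rfl
@[simp] lemma zero_dt (t : ℝ) (x : Vec d) : (zero T Ω F).dt t x = 0 := rfl

@[simp] lemma add_val (φ χ : TestFunction T Ω F) (t : ℝ) (x : Vec d) :
    (φ.add χ).val t x = φ.val t x + χ.val t x := rfl
@[simp] lemma add_grad (φ χ : TestFunction T Ω F) (t : ℝ) (x : Vec d) :
    (φ.add χ).grad t x = φ.grad t x + χ.grad t x := rfl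
@[simp] lemma add_dt (φ χ : TestFunction T Ω F) (t : ℝ) (x : Vec d) :
    (φ.add χ).dt t x = φ.dt t x + χ.dt t x := rfl

section MulTime

variable (φ : TestFunction T Ω F) {h h' : ℝ → ℝ} (hh : ∀ t, HasDerivAt h (h' t) t)
  (hh' : Continuous h')

@[simp] lemma mulTime_val (t : ℝ) (x : Vec d) :
    (φ.mulTime h h' hh hh').val t x = h t • φ.val t x := rfl
@[simp] lemma mulTime_grad (t : ℝ) (x : Vec d) :
    (φ.mulTime h h' hh hh').grad t x = h t • φ.grad t x := rfl
@[simp] lemma mulTime_dt (t : ℝ) (x : Vec d) :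
    (φ.mulTime h h' hh hh').dt t x = h t • φ.dt t x + h' t • φ.val t x := rfl

end MulTime

@[simp] lemma constSMul_val (c : ℝ) (φ : TestFunction T Ω F) (t : ℝ) (x : Vec d) :
    (φ.constSMul c).val t x = c • φ.val t x := rfl
@[simp] lemma constSMul_grad (c : ℝ) (φ : TestFunction T Ω F) (t : ℝ) (x : Vec d) :
    (φ.constSMul c).grad t x = c • φ.grad t x := rfl
@[simp] lemma constSMul_dt (c : ℝ) (φ : TestFunction T Ω F) (t : ℝ) (x : Vec d) :
    (φ.constSMul c).dt t x = c • φ.dt t x := by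
  simp [constSMul]

lemma isTangential_zero : (zero T Ω (Vec d)).IsTangential := fun t _ x _ n _ => by simp

lemma IsTangential.add {φ χ : TestFunction T Ω (Vec d)} (hφ : φ.IsTangential)
    (hχ : χ.IsTangential) : (φ.add χ).IsTangential := fun t ht x hx n hn => by
  rw [add_val, inner_add_right, hφ t ht x hx n hn, hχ t ht x hx n hn, add_zero]

lemma IsTangential.mulTime {φ : TestFunction T Ω (Vec d)} (hφ : φ.IsTangential) {h h' : ℝ → ℝ}
    (hh : ∀ t, HasDerivAt h (h' t) t) (hh' : Continuous h') :
    (φ.mulTime h h' hh hh').IsTangential := fun t ht x hx n hn => by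
  rw [mulTime_val, inner_smul_right, hφ t ht x hx n hn, mul_zero]

lemma IsTangential.constSMul {φ : TestFunction T Ω (Vec d)} (hφ : φ.IsTangential) (c : ℝ) :
    (φ.constSMul c).IsTangential := hφ.mulTime _ _

end TestFunction

lemma jac_add (A B : Vec d →L[ℝ] Vec d) : jac (A + B) = jac A + jac B := by
  ext i j; simp [jac]

lemma jac_smul (c : ℝ) (A : Vec d →L[ℝ] Vec d) : jac (c • A) = c • jac A := by
  ext i j; simp [jac]

lemma continuous_jac : Continuous (jac : (Vec d →L[ℝ] Vec d) → Mat d) := by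
  refine continuous_matrix fun i j => ?_
  change Continuous fun A : Vec d →L[ℝ] Vec d => (EuclideanSpace.proj i : Vec d →L[ℝ] ℝ)
    (A (EuclideanSpace.single j 1))
  fun_prop

/-- The gradient of a vector field as a continuous matrix field on `[0,T] × Ω̄`. -/
def gradField (φ : TestFunction T Ω (Vec d)) : C(Icc 0 T × closure Ω, Mat d) where
  toFun q := jac (φ.grad q.1 q.2)
  continuous_toFun := continuous_jac.comp (φ.continuousOn_grad.comp_continuous
    (f := fun q : Icc 0 T × closure Ω => ((q.1 : ℝ), (q.2 : Vec d))) (by fun_prop)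
    fun q => ⟨q.1.2, q.2.2⟩)

/-- The divergence of a vector field as a continuous function on `[0,T] × Ω̄`. -/
def divField (φ : TestFunction T Ω (Vec d)) : C(Icc 0 T × closure Ω, ℝ) where
  toFun q := (gradField φ q).trace
  continuous_toFun := (gradField φ).continuous.matrix_trace

lemma gradField_apply (φ : TestFunction T Ω (Vec d)) (q : Icc 0 T × closure Ω) :
    gradField φ q = jac (φ.grad q.1 q.2) := rfl

lemma divField_apply (φ : TestFunction T Ω (Vec d)) (q : Icc 0 T × closure Ω) :
    divField φ q = (jac (φ.grad q.1 q.2)).trace := rfl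

lemma gradField_add (φ χ : TestFunction T Ω (Vec d)) :
    gradField (φ.add χ) = gradField φ + gradField χ := by
  ext q : 1; simp [gradField_apply, jac_add]

lemma divField_add (φ χ : TestFunction T Ω (Vec d)) :
    divField (φ.add χ) = divField φ + divField χ := by
  ext q : 1; simp [divField_apply, jac_add]

lemma gradField_constSMul (c : ℝ) (φ : TestFunction T Ω (Vec d)) :
    gradField (φ.constSMul c) = c • gradField φ := by
  ext q : 1; simp [gradField_apply, jac_smul]

lemma divField_constSMul (c : ℝ) (φ : TestFunction T Ω (Vec d)) :
    divField (φ.constSMul c) = c • divField φ := by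
  ext q : 1; simp [divField_apply, jac_smul]

end TestFunctions

/-! ### The regularity weight -/

section Weight

variable {I K : Type*} [TopologicalSpace I] [TopologicalSpace K] {d : ℕ}

/-- The negative part of the symmetric part of a matrix field, measured in the spectral norm. -/
def negBoundField (S : C(I × K, Mat d)) : C(I × K, ℝ) := ⟨_, continuous_negBound.comp S.continuous⟩

/-- The negative part of a scalar field. -/
def negPartField (q : C(I × K, ℝ)) : C(I × K, ℝ) :=
  ⟨fun x => max (-q x) 0, q.continuous.neg.max continuous_const⟩

@[simp] lemma negBoundField_apply (S : C(I × K, Mat d)) (x : I × K) :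
    negBoundField S x = negBound (S x) := rfl

@[simp] lemma negPartField_apply (q : C(I × K, ℝ)) (x : I × K) :
    negPartField q x = max (-q x) 0 := rfl

variable [CompactSpace K]

/-- The regularity weight of a pair of a matrix field and a scalar field, as a function of time. -/
def timeWeight (γ : ℝ) (S : C(I × K, Mat d)) (q : C(I × K, ℝ)) (t : I) : ℝ :=
  max (2 * ‖(negBoundField S).curry t‖) ((γ - 1) * ‖(negPartField q).curry t‖)

lemma continuous_timeWeight (γ : ℝ) (S : C(I × K, Mat d)) (q : C(I × K, ℝ)) :
    Continuous (timeWeight γ S q) :=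
  (((negBoundField S).curry.continuous.norm).const_mul 2).max
    (((negPartField q).curry.continuous.norm).const_mul _)

lemma timeWeight_nonneg (γ : ℝ) (S : C(I × K, Mat d)) (q : C(I × K, ℝ)) (t : I) :
    0 ≤ timeWeight γ S q t :=
  le_max_of_le_left (by positivity)

lemma two_mul_negBound_le_timeWeight (γ : ℝ) (S : C(I × K, Mat d)) (q : C(I × K, ℝ)) (t : I)
    (x : K) : 2 * negBound (S (t, x)) ≤ timeWeight γ S q t := by
  refine le_max_of_le_left ?_
  have := ((negBoundField S).curry t).norm_coe_le_norm x
  rw [Real.norm_eq_abs, ContinuousMap.curry_apply] at this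
  linarith [le_abs_self (negBoundField S (t, x)), negBoundField_apply S (t, x)]

lemma neg_le_timeWeight {γ : ℝ} (hγ : 1 < γ) (S : C(I × K, Mat d)) (q : C(I × K, ℝ)) (t : I)
    (x : K) : (γ - 1) * (-q (t, x)) ≤ timeWeight γ S q t := by
  refine le_max_of_le_right (mul_le_mul_of_nonneg_left ?_ (by linarith))
  have := ((negPartField q).curry t).norm_coe_le_norm x
  rw [Real.norm_eq_abs, ContinuousMap.curry_apply] at this
  linarith [le_abs_self (negPartField q (t, x)), negPartField_apply q (t, x),
    le_max_left (-q (t, x)) 0]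

/-- The bounds defining the weight. -/
lemma timeWeight_le {γ : ℝ} (hγ : 1 < γ) {S : C(I × K, Mat d)} {q : C(I × K, ℝ)} {t : I} {c : ℝ}
    (hc : 0 ≤ c) (hS : ∀ x, 2 * negBound (S (t, x)) ≤ c) (hq : ∀ x, (γ - 1) * (-q (t, x)) ≤ c) :
    timeWeight γ S q t ≤ c := by
  have hγ' : 0 < γ - 1 := by linarith
  refine max_le ?_ ?_
  · have : ‖(negBoundField S).curry t‖ ≤ c / 2 := by
      refine (ContinuousMap.norm_le _ (by positivity)).mpr fun x => ?_
      rw [ContinuousMap.curry_apply, negBoundField_apply, Real.norm_of_nonneg (negBound_nonneg _)]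
      linarith [hS x]
    linarith
  · have : ‖(negPartField q).curry t‖ ≤ c / (γ - 1) := by
      refine (ContinuousMap.norm_le _ (by positivity)).mpr fun x => ?_
      rw [ContinuousMap.curry_apply, negPartField_apply, Real.norm_of_nonneg (le_max_right _ _)]
      refine max_le ?_ (by positivity)
      rw [le_div_iff₀ hγ']
      linarith [hq x]
    rw [le_div_iff₀ hγ'] at this
    linarith

lemma timeWeight_add_le {γ : ℝ} (hγ : 1 < γ) (S S' : C(I × K, Mat d)) (q q' : C(I × K, ℝ))
    (t : I) :
    timeWeight γ (S + S') (q + q') t ≤ timeWeight γ S q t + timeWeight γ S' q' t := by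
  refine timeWeight_le hγ (add_nonneg (timeWeight_nonneg _ _ _ _) (timeWeight_nonneg _ _ _ _))
    (fun x => ?_) fun x => ?_
  · rw [ContinuousMap.add_apply]
    linarith [negBound_add_le (S (t, x)) (S' (t, x)), two_mul_negBound_le_timeWeight γ S q t x,
      two_mul_negBound_le_timeWeight γ S' q' t x]
  · rw [ContinuousMap.add_apply]
    linarith [neg_le_timeWeight hγ S q t x, neg_le_timeWeight hγ S' q' t x]

lemma timeWeight_smul_le {γ : ℝ} (hγ : 1 < γ) {c : ℝ} (hc : 0 ≤ c) (S : C(I × K, Mat d))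
    (q : C(I × K, ℝ)) (t : I) : timeWeight γ (c • S) (c • q) t ≤ c * timeWeight γ S q t := by
  refine timeWeight_le hγ (mul_nonneg hc (timeWeight_nonneg _ _ _ _)) (fun x => ?_) fun x => ?_
  · rw [ContinuousMap.smul_apply, negBound_smul hc]
    linarith [mul_le_mul_of_nonneg_left (two_mul_negBound_le_timeWeight γ S q t x) hc]
  · rw [ContinuousMap.smul_apply, smul_eq_mul]
    linarith [mul_le_mul_of_nonneg_left (neg_le_timeWeight hγ S q t x) hc]

lemma timeWeight_smul {γ : ℝ} (hγ : 1 < γ) {c : ℝ} (hc : 0 < c) (S : C(I × K, Mat d))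
    (q : C(I × K, ℝ)) (t : I) : timeWeight γ (c • S) (c • q) t = c * timeWeight γ S q t := by
  refine le_antisymm (timeWeight_smul_le hγ hc.le S q t) ?_
  have := timeWeight_smul_le hγ (inv_nonneg.mpr hc.le) (c • S) (c • q) t
  rw [smul_smul, smul_smul, inv_mul_cancel₀ hc.ne', one_smul, one_smul] at this
  calc c * timeWeight γ S q t ≤ c * (c⁻¹ * timeWeight γ (c • S) (c • q) t) := by gcongr
    _ = timeWeight γ (c • S) (c • q) t := by rw [← mul_assoc, mul_inv_cancel₀ hc.ne', one_mul]

end Weight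

section WeightEq

variable {d : ℕ} {T : ℝ} {Ω : Set (Vec d)}

/-- For continuous functions the `L^∞` norm over an open set is the maximum over its closure. -/
lemma linftyNorm_eq_norm (hΩ : IsOpen Ω) [CompactSpace (closure Ω)] (F : C(closure Ω, ℝ))
    (f : Vec d → ℝ) (h : ∀ x : closure Ω, f x = F x) : linftyNorm Ω f = ‖F‖ := by
  have hb : ∀ᵐ x ∂(volume.restrict Ω), ‖f x‖ ≤ ‖F‖ := by
    filter_upwards [ae_restrict_mem hΩ.measurableSet] with x hx
    rw [h ⟨x, subset_closure hx⟩]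
    exact F.norm_coe_le_norm _
  have hle : eLpNorm f ∞ (volume.restrict Ω) ≤ ENNReal.ofReal ‖F‖ := by
    rw [eLpNorm_exponent_top]
    exact eLpNormEssSup_le_of_ae_bound hb
  have hfin : eLpNorm f ∞ (volume.restrict Ω) ≠ ∞ := ne_top_of_le_ne_top ENNReal.ofReal_ne_top hle
  refine le_antisymm (ENNReal.toReal_le_of_le_ofReal (norm_nonneg _) hle) ?_
  set c := linftyNorm Ω f with hc
  have hae : ∀ᵐ x ∂(volume.restrict Ω), ‖f x‖ ≤ c := by
    filter_upwards [ae_le_eLpNormEssSup (f := f) (μ := volume.restrict Ω)] with x hx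
    rw [← eLpNorm_exponent_top] at hx
    rw [← toReal_enorm]
    exact ENNReal.toReal_mono hfin hx
  have hcont : ContinuousOn f Ω := by
    rw [continuousOn_iff_continuous_domRestrict]
    have : Ω.domRestrict f = fun x : Ω => F ⟨x, subset_closure x.2⟩ := by
      ext x; exact h ⟨x, subset_closure x.2⟩
    rw [this]
    fun_prop
  have hall : ∀ x ∈ Ω, ‖f x‖ ≤ c := by
    intro x hx
    by_contra hlt
    have hU : IsOpen (Ω ∩ (fun y => ‖f y‖) ⁻¹' Ioi c) :=
      hcont.norm.isOpen_inter_preimage hΩ isOpen_Ioi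
    have hpos := hU.measure_pos volume ⟨x, hx, not_le.mp hlt⟩
    rw [ae_restrict_iff' hΩ.measurableSet, ae_iff] at hae
    refine hpos.ne' (measure_mono_null (fun y hy => ?_) hae)
    simp only [Set.mem_ofPred_eq, Classical.not_imp]
    exact ⟨hy.1, not_le.mpr hy.2⟩
  refine (ContinuousMap.norm_le _ ENNReal.toReal_nonneg).mpr fun x => ?_
  have hcl : IsClosed (Subtype.val '' {y : closure Ω | ‖F y‖ ≤ c}) :=
    isClosed_closure.isClosedEmbedding_subtypeVal.isClosedMap _
      (isClosed_le F.continuous.norm continuous_const)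
  have hsub : Ω ⊆ Subtype.val '' {y : closure Ω | ‖F y‖ ≤ c} := fun y hy =>
    ⟨⟨y, subset_closure hy⟩, by
      have := hall y hy
      rwa [h ⟨y, subset_closure hy⟩] at this, rfl⟩
  obtain ⟨y, hy, hyx⟩ := closure_minimal hsub hcl x.2
  rwa [Subtype.ext hyx] at hy

lemma weight_eq_timeWeight (hΩ : IsOpen Ω) [CompactSpace (closure Ω)] (γ : ℝ)
    (φ : TestFunction T Ω (Vec d)) {t : ℝ} (ht : t ∈ Icc 0 T) :
    weight Ω γ (fun x => jac (φ.grad t x)) =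
      timeWeight γ (gradField φ) (divField φ) ⟨t, ht⟩ := by
  unfold weight timeWeight
  rw [linftyNorm_eq_norm hΩ ((negBoundField (gradField φ)).curry ⟨t, ht⟩) _ fun x => rfl,
    linftyNorm_eq_norm hΩ ((negPartField (divField φ)).curry ⟨t, ht⟩) _ fun x => rfl]

end WeightEq

/-! ### Bounds by the energy -/

section Energy

variable {d : ℕ} {γ : ℝ}

lemma measurable_eta : Measurable fun p : ℝ × Vec d => eta γ p.1 p.2 := by
  unfold eta
  refine Measurable.ite (measurableSet_lt measurable_const measurable_fst) (by fun_prop) ?_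
  refine Measurable.ite ?_ measurable_const measurable_const
  exact (measurableSet_eq_fun measurable_fst measurable_const).inter
    (measurableSet_eq_fun measurable_snd measurable_const)

/-- Where the energy density is finite, either there is vacuum with no momentum, or the density is
positive. -/
lemma eta_ne_top_cases {ρ : ℝ} {m : Vec d} (h : eta γ ρ m ≠ ∞) (hγ : 1 < γ) :
    (ρ = 0 ∧ m = 0 ∧ (eta γ ρ m).toReal = 0) ∨
      (0 < ρ ∧ (eta γ ρ m).toReal = ‖m‖ ^ 2 / (2 * ρ) + ρ ^ γ / (γ - 1)) := by
  have hγ' : 0 < γ - 1 := by linarith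
  unfold eta at h ⊢
  split_ifs at h ⊢ with h1 h2
  · right
    refine ⟨h1, ENNReal.toReal_ofReal ?_⟩
    have : 0 ≤ ρ ^ γ := Real.rpow_nonneg h1.le _
    positivity
  · left; exact ⟨h2.1, h2.2, rfl⟩
  · exact absurd rfl h

lemma abs_density_le {ρ : ℝ} {m : Vec d} (h : eta γ ρ m ≠ ∞) (hγ : 1 < γ) :
    |ρ| ≤ 1 + (γ - 1) * (eta γ ρ m).toReal := by
  have hγ' : 0 < γ - 1 := by linarith
  rcases eta_ne_top_cases h hγ with ⟨h1, -, h3⟩ | ⟨h1, h2⟩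
  · rw [h1] at h3 ⊢; rw [h3]; simp
  · rw [h2, abs_of_pos h1, mul_add, mul_div_cancel₀ _ hγ'.ne']
    have h3 : 0 ≤ ‖m‖ ^ 2 / (2 * ρ) := by positivity
    have h4 : ρ ≤ 1 + ρ ^ γ := by
      rcases le_total ρ 1 with h5 | h5
      · linarith [Real.rpow_nonneg h1.le γ]
      · have := Real.rpow_le_rpow_of_exponent_le h5 hγ.le
        rw [Real.rpow_one] at this
        linarith
    nlinarith

lemma norm_momentum_le {ρ : ℝ} {m : Vec d} (h : eta γ ρ m ≠ ∞) (hγ : 1 < γ) :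
    ‖m‖ ≤ 1 + γ * (eta γ ρ m).toReal := by
  have hγ' : 0 < γ - 1 := by linarith
  have hη : 0 ≤ (eta γ ρ m).toReal := ENNReal.toReal_nonneg
  have hρ := abs_density_le h hγ
  rcases eta_ne_top_cases h hγ with ⟨h1, h2, h3⟩ | ⟨h1, h2⟩
  · rw [h2] at h3 ⊢
    rw [h3, norm_zero]; linarith
  · rw [abs_of_pos h1] at hρ
    have h3 : 0 ≤ ρ ^ γ / (γ - 1) := div_nonneg (Real.rpow_nonneg h1.le _) hγ'.le
    have h4 : ‖m‖ ≤ ‖m‖ ^ 2 / (2 * ρ) + ρ / 2 := by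
      rw [div_add' _ _ _ (by positivity), le_div_iff₀ (by positivity)]
      nlinarith [sq_nonneg (‖m‖ - ρ)]
    nlinarith

lemma abs_flux_le {ρ : ℝ} {m : Vec d} (h : eta γ ρ m ≠ ∞) (hγ : 1 < γ) (i j : Fin d) :
    |flux γ ρ m i j| ≤ (γ + 1) * (eta γ ρ m).toReal := by
  have hγ' : 0 < γ - 1 := by linarith
  rcases eta_ne_top_cases h hγ with ⟨h1, h2, h3⟩ | ⟨h1, h2⟩
  · rw [h3]
    simp [flux, h1, h2, Real.zero_rpow (by linarith : γ ≠ 0)]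
  · have hpow : 0 ≤ ρ ^ γ := Real.rpow_nonneg h1.le _
    have hcomp : ∀ k, |m k| ≤ ‖m‖ := fun k => PiLp.norm_apply_le m k
    have e1 : |m i * m j / ρ| ≤ ‖m‖ ^ 2 / ρ := by
      rw [abs_div, abs_of_pos h1, abs_mul, sq]
      gcongr
      · exact hcomp i
      · exact hcomp j
    have e2 : |ρ ^ γ * (1 : Mat d) i j| ≤ ρ ^ γ := by
      rw [abs_mul, abs_of_nonneg hpow, Matrix.one_apply]
      split_ifs <;> simp [hpow]
    have e3 : flux γ ρ m i j = m i * m j / ρ + ρ ^ γ * (1 : Mat d) i j := by simp [flux]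
    rw [e3, h2]
    refine (abs_add_le _ _).trans ((add_le_add e1 e2).trans ?_)
    have h4 : ‖m‖ ^ 2 / ρ = 2 * (‖m‖ ^ 2 / (2 * ρ)) := by field_simp
    have h5 : ρ ^ γ = (γ - 1) * (ρ ^ γ / (γ - 1)) := by field_simp
    have h6 : 0 ≤ ‖m‖ ^ 2 / (2 * ρ) := by positivity
    have h7 : 0 ≤ ρ ^ γ / (γ - 1) := by positivity
    rw [h4]
    nlinarith

end Energy

/-! ### Integrability along a state of finite energy -/

section Integrability

/-- A pair of density and momentum with essentially bounded energy, together with integrable initial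
values at time `0`. -/
structure FiniteEnergyState {d : ℕ} (T : ℝ) (Ω : Set (Vec d)) (γ : ℝ) (ρ : ℝ → Vec d → ℝ)
    (m : ℝ → Vec d → Vec d) : Prop where
  measurable_density : AEStronglyMeasurable (fun q : ℝ × Vec d => ρ q.1 q.2)
    ((volume.restrict (Ioo 0 T)).prod (volume.restrict Ω))
  measurable_momentum : AEStronglyMeasurable (fun q : ℝ × Vec d => m q.1 q.2)
    ((volume.restrict (Ioo 0 T)).prod (volume.restrict Ω))
  energy_le : ∃ C : ℝ≥0, ∀ᵐ t ∂(volume.restrict (Ioo 0 T)), energy Ω γ (ρ t) (m t) ≤ C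
  integrable_density_zero : Integrable (ρ 0) (volume.restrict Ω)
  integrable_momentum_zero : Integrable (m 0) (volume.restrict Ω)

/-- Pairing an integrable function with a continuous one over a compact set. -/
lemma integrable_pairing {α F G : Type*} [TopologicalSpace α] [MeasurableSpace α] [BorelSpace α]
    [SecondCountableTopology α] [TopologicalSpace.PseudoMetrizableSpace α]
    [NormedAddCommGroup F] [NormedAddCommGroup G] {ν : Measure α} {s : Set α} (hs : IsCompact s)
    (hsm : MeasurableSet s) (hν : ∀ᵐ a ∂ν, a ∈ s) {f : α → F} {c : α → G}
    (hf : Integrable f ν) (hc : ContinuousOn c s) {B : F → G → ℝ}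
    (hB : Continuous fun p : F × G => B p.1 p.2) (hbd : ∀ a b, |B a b| ≤ ‖a‖ * ‖b‖) :
    Integrable (fun a => B (f a) (c a)) ν := by
  obtain ⟨C, hC⟩ := hs.exists_bound_of_continuousOn hc
  have hcm : AEStronglyMeasurable c ν := by
    have := hc.aestronglyMeasurable_of_isCompact (μ := ν) hs hsm
    rwa [Measure.restrict_eq_self_of_ae_mem hν] at this
  refine (hf.norm.mul_const C).mono' (hB.comp_aestronglyMeasurable₂ hf.1 hcm) ?_
  filter_upwards [hν] with a ha
  exact (hbd _ _).trans (mul_le_mul_of_nonneg_left (hC a ha) (norm_nonneg _))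

variable {d : ℕ} {T : ℝ} {Ω : Set (Vec d)} {γ : ℝ} {ρ : ℝ → Vec d → ℝ} {m : ℝ → Vec d → Vec d}

/-- The integral of density against a scalar test function. -/
def massPairing (ρ : ℝ → Vec d → ℝ) (ψ : TestFunction T Ω ℝ) (t : ℝ) : ℝ :=
  ∫ x in Ω, ρ t x * ψ.val t x

/-- The integral of momentum against a vector test function. -/
def momentumPairing (m : ℝ → Vec d → Vec d) (φ : TestFunction T Ω (Vec d)) (t : ℝ) : ℝ :=
  ∫ x in Ω, inner ℝ (m t x) (φ.val t x)

/-- The integrand in time of the weak continuity equation. -/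
def massRate (ρ : ℝ → Vec d → ℝ) (m : ℝ → Vec d → Vec d) (ψ : TestFunction T Ω ℝ) (τ : ℝ) : ℝ :=
  ∫ x in Ω, (ρ τ x * ψ.dt τ x + ψ.grad τ x (m τ x))

/-- The integrand in time of the weak momentum equation, without the Reynolds stress. -/
def momentumRate (γ : ℝ) (ρ : ℝ → Vec d → ℝ) (m : ℝ → Vec d → Vec d)
    (φ : TestFunction T Ω (Vec d)) (τ : ℝ) : ℝ :=
  ∫ x in Ω, (inner ℝ (m τ x) (φ.dt τ x) + frob (flux γ (ρ τ x) (m τ x)) (jac (φ.grad τ x)))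

lemma ae_mem_cylinder (hΩ : IsOpen Ω) :
    ∀ᵐ q ∂((volume.restrict (Ioo 0 T)).prod (volume.restrict Ω)),
      q ∈ (Icc 0 T ×ˢ closure Ω : Set (ℝ × Vec d)) := by
  rw [Measure.prod_restrict]
  filter_upwards [ae_restrict_mem (measurableSet_Ioo.prod hΩ.measurableSet)] with q hq
  exact ⟨Ioo_subset_Icc_self hq.1, subset_closure hq.2⟩

namespace FiniteEnergyState

variable (h : FiniteEnergyState T Ω γ ρ m)
include h

lemma aemeasurable_eta : AEMeasurable (fun q : ℝ × Vec d => eta γ (ρ q.1 q.2) (m q.1 q.2))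
    ((volume.restrict (Ioo 0 T)).prod (volume.restrict Ω)) :=
  measurable_eta.comp_aemeasurable
    (h.measurable_density.aemeasurable.prodMk h.measurable_momentum.aemeasurable)

lemma aemeasurable_energy :
    AEMeasurable (fun t => energy Ω γ (ρ t) (m t)) (volume.restrict (Ioo 0 T)) :=
  h.aemeasurable_eta.lintegral_prod_right'

lemma lintegral_eta_ne_top : ∫⁻ q, eta γ (ρ q.1 q.2) (m q.1 q.2)
    ∂((volume.restrict (Ioo 0 T)).prod (volume.restrict Ω)) ≠ ∞ := by
  obtain ⟨C, hC⟩ := h.energy_le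
  rw [lintegral_prod _ h.aemeasurable_eta]
  refine ne_top_of_le_ne_top ?_ (lintegral_mono_ae hC)
  rw [lintegral_const]
  refine ENNReal.mul_ne_top ENNReal.coe_ne_top (measure_ne_top _ _)

lemma ae_eta_ne_top : ∀ᵐ q ∂((volume.restrict (Ioo 0 T)).prod (volume.restrict Ω)),
    eta γ (ρ q.1 q.2) (m q.1 q.2) ≠ ∞ := by
  filter_upwards [ae_lt_top' h.aemeasurable_eta h.lintegral_eta_ne_top] with q hq using hq.ne

lemma integrable_eta : Integrable (fun q : ℝ × Vec d => (eta γ (ρ q.1 q.2) (m q.1 q.2)).toReal)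
    ((volume.restrict (Ioo 0 T)).prod (volume.restrict Ω)) :=
  integrable_toReal_of_lintegral_ne_top h.aemeasurable_eta h.lintegral_eta_ne_top

variable (hΩb : Bornology.IsBounded Ω) (hΩ : IsOpen Ω) (hγ : 1 < γ)

include hΩb in
omit h in
lemma isFiniteMeasure_restrict : IsFiniteMeasure (volume.restrict Ω) :=
  ⟨by rw [Measure.restrict_apply_univ]; exact hΩb.measure_lt_top⟩

include hΩb hγ

lemma integrable_density : Integrable (fun q : ℝ × Vec d => ρ q.1 q.2)
    ((volume.restrict (Ioo 0 T)).prod (volume.restrict Ω)) := by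
  have := isFiniteMeasure_restrict hΩb
  refine ((integrable_const 1).add (h.integrable_eta.const_mul (γ - 1))).mono'
    h.measurable_density ?_
  filter_upwards [h.ae_eta_ne_top] with q hq using abs_density_le hq hγ

lemma integrable_momentum : Integrable (fun q : ℝ × Vec d => m q.1 q.2)
    ((volume.restrict (Ioo 0 T)).prod (volume.restrict Ω)) := by
  have := isFiniteMeasure_restrict hΩb
  refine ((integrable_const 1).add (h.integrable_eta.const_mul γ)).mono' h.measurable_momentum ?_
  filter_upwards [h.ae_eta_ne_top] with q hq using norm_momentum_le hq hγ

omit hΩb in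
lemma integrable_flux (i j : Fin d) :
    Integrable (fun q : ℝ × Vec d => flux γ (ρ q.1 q.2) (m q.1 q.2) i j)
    ((volume.restrict (Ioo 0 T)).prod (volume.restrict Ω)) := by
  have hmeas : Measurable fun p : ℝ × Vec d => flux γ p.1 p.2 i j := by
    simp only [flux, Matrix.add_apply, Matrix.of_apply, Matrix.smul_apply, smul_eq_mul]
    have hk : ∀ k, Measurable fun p : ℝ × Vec d => p.2 k := fun k => by fun_prop
    exact (((hk i).mul (hk j)).div measurable_fst).add ((measurable_fst.pow_const γ).mul_const _)
  refine (h.integrable_eta.const_mul (γ + 1)).mono' (hmeas.comp_aemeasurable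
    (h.measurable_density.aemeasurable.prodMk h.measurable_momentum.aemeasurable)
    ).aestronglyMeasurable ?_
  filter_upwards [h.ae_eta_ne_top] with q hq using abs_flux_le hq hγ i j

include hΩ

lemma integrable_mass_prod {c : ℝ × Vec d → ℝ} (hc : ContinuousOn c (Icc 0 T ×ˢ closure Ω)) :
    Integrable (fun q : ℝ × Vec d => ρ q.1 q.2 * c q)
      ((volume.restrict (Ioo 0 T)).prod (volume.restrict Ω)) :=
  integrable_pairing (isCompact_Icc.prod hΩb.isCompact_closure)
    (measurableSet_Icc.prod isClosed_closure.measurableSet) (ae_mem_cylinder hΩ)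
    (h.integrable_density hΩb hγ) hc (B := fun a b => a * b) (by fun_prop)
    fun a b => (abs_mul a b).le

lemma integrable_inner_prod {c : ℝ × Vec d → Vec d}
    (hc : ContinuousOn c (Icc 0 T ×ˢ closure Ω)) :
    Integrable (fun q : ℝ × Vec d => inner ℝ (m q.1 q.2) (c q))
      ((volume.restrict (Ioo 0 T)).prod (volume.restrict Ω)) :=
  integrable_pairing (isCompact_Icc.prod hΩb.isCompact_closure)
    (measurableSet_Icc.prod isClosed_closure.measurableSet) (ae_mem_cylinder hΩ)
    (h.integrable_momentum hΩb hγ) hc (B := fun a b => inner ℝ a b) (by fun_prop)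
    fun a b => abs_real_inner_le_norm a b

lemma integrable_frob_prod {c : ℝ × Vec d → Mat d}
    (hc : ContinuousOn c (Icc 0 T ×ˢ closure Ω)) :
    Integrable (fun q : ℝ × Vec d => frob (flux γ (ρ q.1 q.2) (m q.1 q.2)) (c q))
      ((volume.restrict (Ioo 0 T)).prod (volume.restrict Ω)) :=
  integrable_finsetSum _ fun i _ => integrable_finsetSum _ fun j _ =>
    integrable_pairing (isCompact_Icc.prod hΩb.isCompact_closure)
    (measurableSet_Icc.prod isClosed_closure.measurableSet) (ae_mem_cylinder hΩ)
    (h.integrable_flux hγ i j) (c := fun q => c q i j)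
    ((continuous_id.matrix_elem i j).comp_continuousOn hc) (B := fun a b => a * b) (by fun_prop)
    fun a b => (abs_mul a b).le

lemma integrable_momentumRate (φ : TestFunction T Ω (Vec d)) :
    IntegrableOn (momentumRate γ ρ m φ) (Ioo 0 T) :=
  ((h.integrable_inner_prod hΩb hΩ hγ φ.continuousOn_dt).add
    (h.integrable_frob_prod hΩb hΩ hγ
      (continuous_jac.comp_continuousOn φ.continuousOn_grad))).integral_prod_left

lemma integrable_momentumPairing (φ : TestFunction T Ω (Vec d)) :
    IntegrableOn (momentumPairing m φ) (Ioo 0 T) :=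
  (h.integrable_inner_prod hΩb hΩ hγ φ.continuousOn_val).integral_prod_left

lemma ae_integrable_mass (ψ : TestFunction T Ω ℝ) : ∀ᵐ t ∂(volume.restrict (Ioo 0 T)),
    Integrable (fun x => ρ t x * ψ.val t x) (volume.restrict Ω) :=
  (h.integrable_mass_prod hΩb hΩ hγ ψ.continuousOn_val).prod_right_ae

lemma ae_integrable_momentum (φ : TestFunction T Ω (Vec d)) : ∀ᵐ t ∂(volume.restrict (Ioo 0 T)),
    Integrable (fun x => inner ℝ (m t x) (φ.val t x)) (volume.restrict Ω) :=
  (h.integrable_inner_prod hΩb hΩ hγ φ.continuousOn_val).prod_right_ae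

lemma ae_integrable_momentumRate (φ : TestFunction T Ω (Vec d)) :
    ∀ᵐ t ∂(volume.restrict (Ioo 0 T)),
      Integrable (fun x => inner ℝ (m t x) (φ.dt t x) +
        frob (flux γ (ρ t x) (m t x)) (jac (φ.grad t x))) (volume.restrict Ω) :=
  ((h.integrable_inner_prod hΩb hΩ hγ φ.continuousOn_dt).add
    (h.integrable_frob_prod hΩb hΩ hγ
      (continuous_jac.comp_continuousOn φ.continuousOn_grad))).prod_right_ae

omit hγ
variable (hT : 0 ≤ T)
include hT

lemma integrable_mass_zero (ψ : TestFunction T Ω ℝ) :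
    Integrable (fun x => ρ 0 x * ψ.val 0 x) (volume.restrict Ω) :=
  integrable_pairing hΩb.isCompact_closure isClosed_closure.measurableSet
    ((ae_restrict_mem hΩ.measurableSet).mono fun x hx => subset_closure hx)
    h.integrable_density_zero
    (ψ.continuousOn_val.comp (f := fun x : Vec d => ((0 : ℝ), x)) (by fun_prop)
      fun x hx => ⟨left_mem_Icc.mpr hT, hx⟩) (B := fun a b => a * b) (by fun_prop)
    fun a b => (abs_mul a b).le

lemma integrable_momentum_zero' (φ : TestFunction T Ω (Vec d)) :
    Integrable (fun x => inner ℝ (m 0 x) (φ.val 0 x)) (volume.restrict Ω) :=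
  integrable_pairing hΩb.isCompact_closure isClosed_closure.measurableSet
    ((ae_restrict_mem hΩ.measurableSet).mono fun x hx => subset_closure hx)
    h.integrable_momentum_zero
    (φ.continuousOn_val.comp (f := fun x : Vec d => ((0 : ℝ), x)) (by fun_prop)
      fun x hx => ⟨left_mem_Icc.mpr hT, hx⟩) (B := fun a b => inner ℝ a b) (by fun_prop)
    fun a b => abs_real_inner_le_norm a b

end FiniteEnergyState

end Integrability

/-! ### Statements for almost all times -/

section Times

variable {T : ℝ} {P Q : ℝ → ℝ → Prop}

lemma ForAETimes.of_ae {G : ℝ → Prop} (h0 : G 0) (hG : ∀ᵐ t ∂(volume.restrict (Ioo 0 T)), G t)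
    (h : ∀ s t, 0 ≤ s → s < t → t < T → G s → G t → P s t) : ForAETimes T P := by
  have hmem : ∀ᵐ t ∂(volume.restrict (Ioo 0 T)), t ∈ Ioo 0 T := ae_restrict_mem measurableSet_Ioo
  refine ⟨?_, ?_⟩
  · filter_upwards [hG, hmem] with s hs hsm
    filter_upwards [hG, hmem] with t ht htm hst
    exact h s t hsm.1.le hst htm.2 hs ht
  · filter_upwards [hG, hmem] with t ht htm using h 0 t le_rfl htm.1 htm.2 h0 ht

lemma ForAETimes.mp (hP : ForAETimes T P) (h : ForAETimes T fun s t => P s t → Q s t) :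
    ForAETimes T Q := by
  refine ⟨?_, ?_⟩
  · filter_upwards [hP.1, h.1] with s hs hs'
    filter_upwards [hs, hs'] with t ht ht' hst using ht' hst (ht hst)
  · filter_upwards [hP.2, h.2] with t ht ht' using ht' ht

lemma ForAETimes.and (hP : ForAETimes T P) (hQ : ForAETimes T Q) :
    ForAETimes T fun s t => P s t ∧ Q s t := by
  refine ⟨?_, ?_⟩
  · filter_upwards [hP.1, hQ.1] with s hs hs'
    filter_upwards [hs, hs'] with t ht ht' hst using ⟨ht hst, ht' hst⟩
  · filter_upwards [hP.2, hQ.2] with t ht ht' using ⟨ht, ht'⟩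

lemma ForAETimes.forall_of_countable {ι : Type*} [Countable ι] {P : ι → ℝ → ℝ → Prop}
    (h : ∀ i, ForAETimes T (P i)) : ForAETimes T fun s t => ∀ i, P i s t := by
  refine ⟨?_, ?_⟩
  · filter_upwards [ae_all_iff.mpr fun i => (h i).1] with s hs
    filter_upwards [ae_all_iff.mpr hs] with t ht hst i using ht i hst
  · exact ae_all_iff.mpr fun i => (h i).2

end Times

section BoundedVariation

variable {T : ℝ} {E : ℝ → ℝ}

lemma aemeasurable_of_boundedVariationOn (hE : BoundedVariationOn E (Icc 0 T)) :
    AEMeasurable E (volume.restrict (Ioo 0 T)) := by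
  obtain ⟨p, q, hp, hq, hpq⟩ := hE.locallyBoundedVariationOn.exists_monotoneOn_sub_monotoneOn
  rw [hpq]
  exact (aemeasurable_restrict_of_monotoneOn measurableSet_Ioo
    (hp.mono Ioo_subset_Icc_self)).sub (aemeasurable_restrict_of_monotoneOn measurableSet_Ioo
    (hq.mono Ioo_subset_Icc_self))

lemma exists_abs_le_of_boundedVariationOn (hT : 0 ≤ T) (hE : BoundedVariationOn E (Icc 0 T)) :
    ∃ C, 0 ≤ C ∧ ∀ t ∈ Icc 0 T, |E t| ≤ C := by
  refine ⟨|E 0| + (eVariationOn E (Icc 0 T)).toReal, by positivity, fun t ht => ?_⟩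
  have h := hE.dist_le ht (left_mem_Icc.mpr hT)
  rw [Real.dist_eq] at h
  have := abs_add_le (E t - E 0) (E 0)
  rw [sub_add_cancel] at this
  linarith

end BoundedVariation

/-! ### The energy defect -/

section Defect

variable {d : ℕ} {T : ℝ} {Ω : Set (Vec d)} {γ : ℝ} {ρ : ℝ → Vec d → ℝ} {m : ℝ → Vec d → Vec d}
  {E : ℝ → ℝ}

lemma energy_ne_top_and_toReal_le {e : ℝ≥0∞} {E : ℝ} (h : (e : EReal) ≤ (E : EReal)) :
    e ≠ ∞ ∧ e.toReal ≤ E := by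
  have htop : e ≠ ∞ := by
    rintro rfl
    simp at h
  refine ⟨htop, ?_⟩
  lift e to ℝ≥0 using htop
  rw [EReal.coe_nnreal_eq_coe_real, EReal.coe_le_coe_iff] at h
  exact h

lemma le_sub_toReal_of_coe_le_sub {e : ℝ≥0∞} {E x : ℝ}
    (h : (x : EReal) ≤ (E : EReal) - (e : EReal)) : e ≠ ∞ ∧ x ≤ E - e.toReal := by
  have htop : e ≠ ∞ := by
    rintro rfl
    simp at h
  refine ⟨htop, ?_⟩
  lift e to ℝ≥0 using htop
  rw [EReal.coe_nnreal_eq_coe_real, ← EReal.coe_sub, EReal.coe_le_coe_iff] at h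
  exact h

lemma coe_le_sub_of_le_sub_toReal {e : ℝ≥0∞} {E x : ℝ} (he : e ≠ ∞) (h : x ≤ E - e.toReal) :
    (x : EReal) ≤ (E : EReal) - (e : EReal) := by
  lift e to ℝ≥0 using he
  rw [EReal.coe_nnreal_eq_coe_real, ← EReal.coe_sub, EReal.coe_le_coe_iff]
  exact h

/-- The gap between the auxiliary energy `E` and the mechanical energy. -/
def defect (Ω : Set (Vec d)) (γ : ℝ) (ρ : ℝ → Vec d → ℝ) (m : ℝ → Vec d → Vec d) (E : ℝ → ℝ)
    (t : ℝ) : ℝ :=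
  E t - (energy Ω γ (ρ t) (m t)).toReal

/-- The data common to both notions of solution. -/
structure EnergyState {d : ℕ} (T : ℝ) (Ω : Set (Vec d)) (γ : ℝ) (ρ : ℝ → Vec d → ℝ)
    (m : ℝ → Vec d → Vec d) (E : ℝ → ℝ) : Prop extends FiniteEnergyState T Ω γ ρ m where
  isOpen : IsOpen Ω
  isBounded : Bornology.IsBounded Ω
  one_lt : 1 < γ
  pos : 0 < T
  boundedVariation : BoundedVariationOn E (Icc 0 T)
  energy_le_E : ∀ᵐ t ∂(volume.restrict (Ioo 0 T)),
    energy Ω γ (ρ t) (m t) ≠ ∞ ∧ (energy Ω γ (ρ t) (m t)).toReal ≤ E t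

lemma ae_update_eq {α : Type*} (f : ℝ → α) (a : α) :
    ∀ᵐ t ∂(volume.restrict (Ioo 0 T)), Function.update f 0 a t = f t := by
  filter_upwards [ae_restrict_mem measurableSet_Ioo] with t ht
  exact Function.update_of_ne ht.1.ne' _ _

lemma ae_prod_update_eq {F : Type*} (f : ℝ → Vec d → F) (a : Vec d → F) :
    (fun q : ℝ × Vec d => f q.1 q.2) =ᵐ[(volume.restrict (Ioo 0 T)).prod (volume.restrict Ω)]
      fun q : ℝ × Vec d => Function.update f 0 a q.1 q.2 := by
  filter_upwards [Measure.quasiMeasurePreserving_fst.ae (ae_update_eq (T := T) f a)] with q hq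
  rw [hq]

lemma energyState_update (hΩ : IsOpen Ω) (hΩb : Bornology.IsBounded Ω) (hγ : 1 < γ) (hT : 0 < T)
    {ρ₀ : Vec d → ℝ} (hρ₀ : MemLp ρ₀ (ENNReal.ofReal γ) (volume.restrict Ω))
    {m₀ : Vec d → Vec d}
    (hm₀ : MemLp m₀ (ENNReal.ofReal (2 * γ / (γ + 1))) (volume.restrict Ω))
    (hρ : MemLinftyLp T Ω (ENNReal.ofReal γ) ρ)
    (hm : MemLinftyLp T Ω (ENNReal.ofReal (2 * γ / (γ + 1))) m)
    (hE : BoundedVariationOn E (Icc 0 T))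
    (hen : ∀ᵐ t ∂(volume.restrict (Ioo 0 T)),
      energy Ω γ (ρ t) (m t) ≠ ∞ ∧ (energy Ω γ (ρ t) (m t)).toReal ≤ E t) :
    EnergyState T Ω γ (Function.update ρ 0 ρ₀) (Function.update m 0 m₀) E := by
  have hfin := FiniteEnergyState.isFiniteMeasure_restrict hΩb
  have hen' : ∀ᵐ t ∂(volume.restrict (Ioo 0 T)),
      energy Ω γ (Function.update ρ 0 ρ₀ t) (Function.update m 0 m₀ t) ≠ ∞ ∧
      (energy Ω γ (Function.update ρ 0 ρ₀ t) (Function.update m 0 m₀ t)).toReal ≤ E t := by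
    filter_upwards [hen, ae_update_eq ρ ρ₀, ae_update_eq m m₀] with t h1 h2 h3
    rwa [h2, h3]
  refine ⟨⟨hρ.1.congr (ae_prod_update_eq ρ ρ₀), hm.1.congr (ae_prod_update_eq m m₀), ?_, ?_, ?_⟩,
    hΩ, hΩb, hγ, hT, hE, hen'⟩
  · obtain ⟨C, hC0, hC⟩ := exists_abs_le_of_boundedVariationOn hT.le hE
    refine ⟨C.toNNReal, ?_⟩
    filter_upwards [hen', ae_restrict_mem measurableSet_Ioo] with t ht htm
    rw [← ENNReal.ofReal_toReal ht.1]
    exact ENNReal.ofReal_le_ofReal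
      (ht.2.trans ((le_abs_self _).trans (hC t (Ioo_subset_Icc_self htm))))
  · rw [Function.update_self]
    exact hρ₀.integrable (by rw [← ENNReal.ofReal_one]; exact ENNReal.ofReal_le_ofReal hγ.le)
  · rw [Function.update_self]
    refine hm₀.integrable ?_
    rw [← ENNReal.ofReal_one]
    refine ENNReal.ofReal_le_ofReal ?_
    rw [le_div_iff₀ (by linarith)]
    linarith

namespace EnergyState

variable (h : EnergyState T Ω γ ρ m E)
include h

lemma ae_defect_nonneg : ∀ᵐ t ∂(volume.restrict (Ioo 0 T)), 0 ≤ defect Ω γ ρ m E t := by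
  filter_upwards [h.energy_le_E] with t ht using sub_nonneg.mpr ht.2

lemma exists_ae_defect_le :
    ∃ C : ℝ, 0 ≤ C ∧ ∀ᵐ t ∂(volume.restrict (Ioo 0 T)), defect Ω γ ρ m E t ≤ C := by
  obtain ⟨C, hC0, hC⟩ := exists_abs_le_of_boundedVariationOn h.pos.le h.boundedVariation
  refine ⟨C, hC0, ?_⟩
  filter_upwards [ae_restrict_mem measurableSet_Ioo] with t ht
  have h1 := (le_abs_self _).trans (hC t (Ioo_subset_Icc_self ht))
  have h2 : 0 ≤ (energy Ω γ (ρ t) (m t)).toReal := ENNReal.toReal_nonneg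
  unfold defect
  linarith

lemma aemeasurable_defect : AEMeasurable (defect Ω γ ρ m E) (volume.restrict (Ioo 0 T)) :=
  (aemeasurable_of_boundedVariationOn h.boundedVariation).sub h.aemeasurable_energy.ennreal_toReal

lemma integrable_defect : IntegrableOn (defect Ω γ ρ m E) (Ioo 0 T) := by
  obtain ⟨C, hC0, hC⟩ := h.exists_ae_defect_le
  refine Integrable.of_bound h.aemeasurable_defect.aestronglyMeasurable C ?_
  filter_upwards [hC, h.ae_defect_nonneg] with t h1 h2
  rwa [Real.norm_of_nonneg h2]

lemma compactSpace_closure : CompactSpace (closure Ω) :=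
  isCompact_iff_compactSpace.mp h.isBounded.isCompact_closure

/-- Bounded continuous weights against the defect are integrable. -/
lemma integrable_mul_defect {f : ℝ → ℝ} (hf : Continuous f) :
    IntegrableOn (fun t => f t * defect Ω γ ρ m E t) (Ioo 0 T) := by
  obtain ⟨C, hC⟩ := isCompact_Icc.exists_bound_of_continuousOn (s := Icc 0 T) hf.continuousOn
  refine h.integrable_defect.bdd_mul (c := C) hf.aestronglyMeasurable ?_
  filter_upwards [ae_restrict_mem measurableSet_Ioo] with t ht
  exact hC t (Ioo_subset_Icc_self ht)

end EnergyState

lemma intervalIntegrable_of_Ioo {f : ℝ → ℝ} (hf : IntegrableOn f (Ioo 0 T)) {s t : ℝ}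
    (hs : 0 ≤ s) (hst : s ≤ t) (ht : t ≤ T) : IntervalIntegrable f volume s t := by
  rw [intervalIntegrable_iff_integrableOn_Ioo_of_le hst]
  exact hf.mono_set (Ioo_subset_Ioo hs ht)

lemma ae_restrict_interval {p : ℝ → Prop} (hp : ∀ᵐ t ∂(volume.restrict (Ioo 0 T)), p t) {s t : ℝ}
    (hs : 0 ≤ s) (ht : t ≤ T) : ∀ᵐ τ ∂(volume.restrict (Ioc s t)), p τ := by
  rw [← restrict_Ioo_eq_restrict_Ioc]
  exact ae_restrict_of_ae_restrict_of_subset (Ioo_subset_Ioo hs ht) hp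

end Defect

/-! ### The energy-variational inequality term by term -/

section Reduction

variable {d : ℕ} {T : ℝ} {Ω : Set (Vec d)} {γ : ℝ} {ρ : ℝ → Vec d → ℝ} {m : ℝ → Vec d → Vec d}
  {E : ℝ → ℝ}

/-- The weight of a test function, extended to all times. -/
def weightAt [CompactSpace (closure Ω)] (hT : 0 ≤ T) (γ : ℝ) (φ : TestFunction T Ω (Vec d))
    (τ : ℝ) : ℝ :=
  timeWeight γ (gradField φ) (divField φ) (projIcc 0 T hT τ)

lemma continuous_weightAt [CompactSpace (closure Ω)] (hT : 0 ≤ T) (γ : ℝ)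
    (φ : TestFunction T Ω (Vec d)) : Continuous (weightAt hT γ φ) :=
  (continuous_timeWeight γ _ _).comp continuous_projIcc

/-- The energy-variational inequality with all its terms separated. -/
lemma EnergyState.inequality_iff (h : EnergyState T Ω γ ρ m E) [CompactSpace (closure Ω)]
    (ψ : TestFunction T Ω ℝ) (φ : TestFunction T Ω (Vec d)) :
    ForAETimes T fun s t => (EnergyVariationalInequality γ ρ m E ψ φ s t ↔
      E t - E s + (-(massPairing ρ ψ t - massPairing ρ ψ s) + ∫ τ in s..t, massRate ρ m ψ τ) +
        (-(momentumPairing m φ t - momentumPairing m φ s) + ∫ τ in s..t, momentumRate γ ρ m φ τ) ≤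
        ∫ τ in s..t, weightAt h.pos.le γ φ τ * defect Ω γ ρ m E τ) := by
  refine ForAETimes.of_ae (G := fun t =>
      Integrable (fun x => ρ t x * ψ.val t x) (volume.restrict Ω) ∧
      Integrable (fun x => inner ℝ (m t x) (φ.val t x)) (volume.restrict Ω))
    ⟨h.integrable_mass_zero h.isBounded h.isOpen h.pos.le ψ,
      h.integrable_momentum_zero' h.isBounded h.isOpen h.pos.le φ⟩ ?_ ?_
  · exact (h.ae_integrable_mass h.isBounded h.isOpen h.one_lt ψ).and
      (h.ae_integrable_momentum h.isBounded h.isOpen h.one_lt φ)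
  · intro s t hs hst ht hGs hGt
    unfold EnergyVariationalInequality
    rw [integral_add hGs.1 hGs.2, integral_add hGt.1 hGt.2]
    have e1 : ∫ τ in s..t, weight Ω γ (fun x => jac (φ.grad τ x)) *
        ((energy Ω γ (ρ τ) (m τ)).toReal - E τ) =
        -∫ τ in s..t, weightAt h.pos.le γ φ τ * defect Ω γ ρ m E τ := by
      rw [← intervalIntegral.integral_neg]
      refine intervalIntegral.integral_congr fun τ hτ => ?_
      rw [uIcc_of_le hst.le] at hτ
      have hτ' : τ ∈ Icc 0 T := ⟨hs.trans hτ.1, hτ.2.trans ht.le⟩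
      rw [weight_eq_timeWeight h.isOpen γ φ hτ', weightAt, projIcc_of_mem h.pos.le hτ', defect]
      ring
    rw [e1]
    simp only [massPairing, momentumPairing, massRate, momentumRate]
    constructor <;> intro hle <;> linarith

end Reduction

/-! ### Dissipative weak solutions are energy-variational -/

section DissipativeToVariational

variable {d : ℕ} {T : ℝ} {Ω : Set (Vec d)} {γ : ℝ} {ρ : ℝ → Vec d → ℝ} {m : ℝ → Vec d → Vec d}
  {E : ℝ → ℝ}

lemma IsNonincreasing.forAETimes (hE : IsNonincreasing T E) :
    ForAETimes T fun s t => E t ≤ E s := by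
  obtain ⟨E', hanti, h0, hae⟩ := hE
  refine ForAETimes.of_ae (G := fun t => E' t = E t) h0 hae fun s t hs hst ht hGs hGt => ?_
  rw [← hGs, ← hGt]
  exact hanti ⟨hs, hst.le.trans ht.le⟩ ⟨hs.trans hst.le, ht.le⟩ hst.le

/-- The power of the Reynolds stress at one time. -/
def stressPower (R₁ : ℝ → VectorMeasure (closure Ω) (Mat d)) (R₂ : ℝ → FiniteMeasure (closure Ω))
    (φ : TestFunction T Ω (Vec d)) (τ : ℝ) : ℝ :=
  matIntegral (fun x : closure Ω => symPart (jac (φ.grad τ x))) (R₁ τ) +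
    ∫ x : closure Ω, (jac (φ.grad τ x)).trace ∂(R₂ τ : Measure (closure Ω))

lemma continuous_symPart : Continuous (symPart : Mat d → Mat d) := by
  unfold symPart; fun_prop

lemma exists_abs_apply_le {X : Type*} [TopologicalSpace X] [CompactSpace X] {B : X → Mat d}
    (hB : Continuous B) : ∃ C, 0 ≤ C ∧ ∀ x i j, |B x i j| ≤ C := by
  choose C hC using fun i j => isCompact_univ.exists_bound_of_continuousOn
    (hB.matrix_elem i j).continuousOn
  refine ⟨∑ i, ∑ j, |C i j|, Finset.sum_nonneg fun _ _ => Finset.sum_nonneg fun _ _ =>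
    abs_nonneg _, fun x i j => ((hC i j x (mem_univ _)).trans (le_abs_self _)).trans ?_⟩
  exact (Finset.single_le_sum (f := fun j => |C i j|) (fun _ _ => abs_nonneg _)
    (Finset.mem_univ j)).trans (Finset.single_le_sum (f := fun i => ∑ j, |C i j|)
    (fun _ _ => Finset.sum_nonneg fun _ _ => abs_nonneg _) (Finset.mem_univ i))

/-- The power of the Reynolds stress is bounded below by the weight times the dissipation. -/
lemma neg_weight_mul_le_stressPower [CompactSpace (closure Ω)] (hγ : 1 < γ) (hT : 0 ≤ T)
    {R₁ : ℝ → VectorMeasure (closure Ω) (Mat d)} {R₂ : ℝ → FiniteMeasure (closure Ω)}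
    (hR₁ : ∀ t A, MeasurableSet A → (R₁ t A).PosSemidef) (φ : TestFunction T Ω (Vec d)) {τ : ℝ}
    (hτ : τ ∈ Icc 0 T) :
    -(weightAt hT γ φ τ * (1 / 2 * (R₁ τ univ).trace + 1 / (γ - 1) * ((R₂ τ).mass : ℝ))) ≤
      stressPower R₁ R₂ φ τ := by
  have hγ' : 0 < γ - 1 := by linarith
  rw [weightAt, projIcc_of_mem hT hτ]
  set t : Icc 0 T := ⟨τ, hτ⟩ with ht
  set w := timeWeight γ (gradField φ) (divField φ) t with hw
  have hgc : Continuous fun x : closure Ω => gradField φ (t, x) := by fun_prop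
  have h1 : -(w / 2 * (R₁ τ univ).trace) ≤
      matIntegral (fun x : closure Ω => symPart (jac (φ.grad τ x))) (R₁ τ) := by
    have hc : Continuous fun x : closure Ω => symPart (gradField φ (t, x)) :=
      continuous_symPart.comp hgc
    obtain ⟨C, -, hC⟩ := exists_abs_apply_le hc
    refine neg_mul_trace_le_matIntegral (R₁ τ) (hR₁ τ)
      (fun i j => (hc.matrix_elem i j).measurable) hC fun x => ?_
    change negBound (symPart (gradField φ (t, x))) ≤ w / 2
    rw [negBound_symPart]
    linarith [two_mul_negBound_le_timeWeight γ (gradField φ) (divField φ) t x]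
  have h2 : -(w / (γ - 1) * ((R₂ τ).mass : ℝ)) ≤
      ∫ x : closure Ω, (jac (φ.grad τ x)).trace ∂(R₂ τ : Measure (closure Ω)) := by
    have hdc : Continuous fun x : closure Ω => divField φ (t, x) := by fun_prop
    have hi : Integrable (fun x : closure Ω => divField φ (t, x)) (R₂ τ : Measure (closure Ω)) :=
      integrable_continuousMap ⟨_, hdc⟩ _
    have h3 := integral_mono (integrable_const (-(w / (γ - 1)))) hi fun x => by
      have := neg_le_timeWeight hγ (gradField φ) (divField φ) t x
      have h4 : -divField φ (t, x) ≤ w / (γ - 1) := by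
        rw [le_div_iff₀ hγ']; linarith
      change -(w / (γ - 1)) ≤ divField φ (t, x)
      linarith
    rw [integral_const, smul_eq_mul] at h3
    have hmass : (R₂ τ : Measure (closure Ω)).real univ = ((R₂ τ).mass : ℝ) := rfl
    rw [hmass] at h3
    refine le_trans (le_of_eq ?_) h3
    ring
  unfold stressPower
  have e : -(w * (1 / 2 * (R₁ τ univ).trace + 1 / (γ - 1) * ((R₂ τ).mass : ℝ))) =
      -(w / 2 * (R₁ τ univ).trace) + -(w / (γ - 1) * ((R₂ τ).mass : ℝ)) := by ring
  rw [e]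
  exact add_le_add h1 h2

/-- A function below a nonnegative integrable one has the smaller integral, also when it is not
integrable: its integral is then `0`. The integrability of the power of the Reynolds stress is not
part of the definition of a dissipative weak solution. -/
lemma integral_le_of_ae_le_of_nonneg {α : Type*} [MeasurableSpace α] {μ : Measure α} {f g : α → ℝ}
    (hg : Integrable g μ) (hg0 : 0 ≤ᵐ[μ] g) (hfg : f ≤ᵐ[μ] g) : ∫ x, f x ∂μ ≤ ∫ x, g x ∂μ := by
  by_cases hf : Integrable f μ
  · exact integral_mono_ae hf hg hfg
  · rw [integral_undef hf]
    exact integral_nonneg_of_ae hg0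

/-- Along a dissipative weak solution the weak equations, the monotonicity of `E` and the lower
bound for the power of the Reynolds stress add up to the energy-variational inequality. -/
theorem EnergyState.forAETimes_inequality (h : EnergyState T Ω γ ρ m E)
    (hE : IsNonincreasing T E) {R₁ : ℝ → VectorMeasure (closure Ω) (Mat d)}
    {R₂ : ℝ → FiniteMeasure (closure Ω)}
    (hR₁ : ∀ t A, MeasurableSet A → (R₁ t A).PosSemidef)
    (hdiss : ∀ᵐ t ∂(volume.restrict (Ioo 0 T)),
      1 / 2 * (R₁ t univ).trace + 1 / (γ - 1) * ((R₂ t).mass : ℝ) ≤ defect Ω γ ρ m E t)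
    {ψ : TestFunction T Ω ℝ} {φ : TestFunction T Ω (Vec d)}
    (heq : ForAETimes T fun s t => ContinuityEquation ρ m ψ s t ∧
      MomentumEquation γ ρ m R₁ R₂ φ s t) :
    ForAETimes T (EnergyVariationalInequality γ ρ m E ψ φ) := by
  have hcs := h.compactSpace_closure
  refine ((heq.and hE.forAETimes).and (h.inequality_iff ψ φ)).mp ?_
  refine ForAETimes.of_ae (G := fun _ => True) trivial (ae_of_all _ fun _ => trivial) ?_
  rintro s t hs hst ht - - ⟨⟨⟨hcont, hmom⟩, hEst⟩, hiff⟩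
  rw [hiff]
  have hpow : -∫ τ in s..t, stressPower R₁ R₂ φ τ ≤
      ∫ τ in s..t, weightAt h.pos.le γ φ τ * defect Ω γ ρ m E τ := by
    rw [← intervalIntegral.integral_neg, intervalIntegral.integral_of_le hst.le,
      intervalIntegral.integral_of_le hst.le]
    have hw0 : ∀ τ, 0 ≤ weightAt h.pos.le γ φ τ := fun τ => timeWeight_nonneg _ _ _ _
    refine integral_le_of_ae_le_of_nonneg
      (intervalIntegrable_of_Ioo (h.integrable_mul_defect (continuous_weightAt h.pos.le γ φ)) hs
        hst.le ht.le).1 ?_ ?_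
    · filter_upwards [ae_restrict_interval h.ae_defect_nonneg hs ht.le] with τ hτ
      exact mul_nonneg (hw0 τ) hτ
    · filter_upwards [ae_restrict_interval hdiss hs ht.le,
        ae_restrict_mem measurableSet_Ioc] with τ hτ hτm
      have h1 := neg_weight_mul_le_stressPower (R₂ := R₂) h.one_lt h.pos.le hR₁ φ
        (τ := τ) ⟨hs.trans hτm.1.le, hτm.2.trans ht.le⟩
      have h2 := mul_le_mul_of_nonneg_left hτ (hw0 τ)
      linarith
  have hcont' : -(massPairing ρ ψ t - massPairing ρ ψ s) + ∫ τ in s..t, massRate ρ m ψ τ = 0 :=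
    hcont
  have hmom' : -(momentumPairing m φ t - momentumPairing m φ s) +
      (∫ τ in s..t, momentumRate γ ρ m φ τ) + (∫ τ in s..t, stressPower R₁ R₂ φ τ) = 0 := hmom
  linarith

end DissipativeToVariational

/-! ### Monotonicity of the energy and scaling of the test functions -/

section Nonincreasing

variable {T : ℝ} {E : ℝ → ℝ}

lemma ae_continuousAt_of_boundedVariationOn (hT : 0 < T) (hE : BoundedVariationOn E (Icc 0 T)) :
    ∀ᵐ t, t ∈ Ioo 0 T → ContinuousAt E t := by
  have hext : ∀ p : ℝ → ℝ, MonotoneOn p (Icc 0 T) → ∃ P, Monotone P ∧ EqOn p P (Icc 0 T) := by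
    intro p hp
    refine hp.exists_monotone_extension ⟨p 0, ?_⟩ ⟨p T, ?_⟩
    · rintro _ ⟨t, ht, rfl⟩; exact hp (left_mem_Icc.mpr hT.le) ht ht.1
    · rintro _ ⟨t, ht, rfl⟩; exact hp ht (right_mem_Icc.mpr hT.le) ht.2
  obtain ⟨p, q, hp, hq, hpq⟩ := hE.locallyBoundedVariationOn.exists_monotoneOn_sub_monotoneOn
  obtain ⟨P, hP, hPp⟩ := hext p hp
  obtain ⟨Q, hQ, hQq⟩ := hext q hq
  filter_upwards [hP.countable_not_continuousAt.ae_notMem volume,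
    hQ.countable_not_continuousAt.ae_notMem volume] with t h1 h2 ht
  have h1' : ContinuousAt P t := not_not.mp h1
  have h2' : ContinuousAt Q t := not_not.mp h2
  refine (h1'.sub h2').congr ?_
  filter_upwards [Icc_mem_nhds ht.1 ht.2] with s hs
  rw [hpq]
  simp only [Pi.sub_apply]
  rw [hPp hs, hQq hs]

/-- If the inequality `E t ≤ E s` holds at almost all times, then it holds at all points of
continuity, and `E` coincides there with a nonincreasing function. -/
lemma isNonincreasing_of_forAETimes (hT : 0 < T) (hE : BoundedVariationOn E (Icc 0 T))
    (h : ForAETimes T fun s t => E t ≤ E s) : IsNonincreasing T E := by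
  have hcont := ae_continuousAt_of_boundedVariationOn hT hE
  have lim : ∀ {p : ℝ → Prop} {t c : ℝ} {r : ℝ → ℝ → Prop}, (∀ᵐ x, p x) → ContinuousAt E t →
      IsClosed {y | r y c} → (∀ᶠ x in 𝓝 t, p x → r (E x) c) → r (E t) c := by
    intro p t c r hp hc hcl hev
    have hd : Dense {x | p x} := Measure.dense_of_ae hp
    have hne : (𝓝[{x | p x}] t).NeBot := mem_closure_iff_nhdsWithin_neBot.mp (hd t)
    refine hcl.mem_of_tendsto (hc.tendsto.mono_left nhdsWithin_le_nhds :
      Tendsto E (𝓝[{x | p x}] t) (𝓝 (E t))) ?_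
    filter_upwards [mem_nhdsWithin_of_mem_nhds hev, self_mem_nhdsWithin] with x hx hpx using hx hpx
  have up : ∀ {s t : ℝ}, (∀ᵐ x ∂(volume.restrict (Ioo 0 T)), s < x → E x ≤ E s) →
      t ∈ Ioo 0 T → ContinuousAt E t → s < t → E t ≤ E s := by
    intro s t hs ht hc hst
    rw [ae_restrict_iff' measurableSet_Ioo] at hs
    refine lim (r := fun y c => y ≤ c) hs hc (isClosed_le continuous_id continuous_const) ?_
    filter_upwards [Ioo_mem_nhds ht.1 ht.2, Ioi_mem_nhds hst] with x hx1 hx2 hx using hx hx1 hx2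
  let S : Set ℝ := {t | t ∈ Ioo 0 T ∧ ContinuousAt E t}
  have hSS : ∀ s ∈ S, ∀ t ∈ S, s < t → E t ≤ E s := by
    intro s hs t ht hst
    have h1 := h.1
    rw [ae_restrict_iff' measurableSet_Ioo] at h1
    refine lim (r := fun y c => c ≤ y) (c := E t) h1 hs.2
      (isClosed_le continuous_const continuous_id) ?_
    filter_upwards [Ioo_mem_nhds hs.1.1 hs.1.2, Iio_mem_nhds hst] with x hx1 hx2 hx
    exact up (hx hx1) ht.1 ht.2 hx2
  have h0S : ∀ t ∈ S, E t ≤ E 0 := fun t ht =>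
    up (h.2.mono fun x hx _ => hx) ht.1 ht.2 ht.1.1
  have hanti : AntitoneOn E (insert 0 S) := by
    rintro s (rfl | hs) t (rfl | ht) hst
    · exact le_rfl
    · exact h0S t ht
    · exact absurd hs.1.1 (not_lt.mpr hst)
    · rcases hst.eq_or_lt with rfl | hlt
      · exact le_rfl
      · exact hSS s hs t ht hlt
  obtain ⟨C, hC0, hC⟩ := exists_abs_le_of_boundedVariationOn hT.le hE
  have hmem : ∀ t ∈ insert 0 S, t ∈ Icc 0 T := by
    rintro t (rfl | ht)
    · exact left_mem_Icc.mpr hT.le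
    · exact Ioo_subset_Icc_self ht.1
  obtain ⟨g, hg, hgE⟩ := hanti.exists_antitone_extension
    ⟨-C, by rintro _ ⟨t, ht, rfl⟩; exact (abs_le.mp (hC t (hmem t ht))).1⟩
    ⟨C, by rintro _ ⟨t, ht, rfl⟩; exact (abs_le.mp (hC t (hmem t ht))).2⟩
  refine ⟨g, hg.antitoneOn _, (hgE (mem_insert _ _)).symm, ?_⟩
  filter_upwards [ae_restrict_of_ae hcont, ae_restrict_mem measurableSet_Ioo] with t h1 h2
  exact (hgE (mem_insert_of_mem _ ⟨h2, h1 h2⟩)).symm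

end Nonincreasing

section Scaling

variable {d : ℕ} {T : ℝ} {Ω : Set (Vec d)} {γ : ℝ} {ρ : ℝ → Vec d → ℝ} {m : ℝ → Vec d → Vec d}
  {E : ℝ → ℝ}

lemma frob_smul_right (c : ℝ) (A B : Mat d) : frob A (c • B) = c * frob A B := by
  simp only [frob, Matrix.smul_apply, smul_eq_mul, Finset.mul_sum]
  exact Finset.sum_congr rfl fun i _ => Finset.sum_congr rfl fun j _ => by ring

lemma frob_add_right (A B C : Mat d) : frob A (B + C) = frob A B + frob A C := by
  simp only [frob, Matrix.add_apply, mul_add, Finset.sum_add_distrib]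

lemma massPairing_constSMul (c : ℝ) (ψ : TestFunction T Ω ℝ) (t : ℝ) :
    massPairing ρ (ψ.constSMul c) t = c * massPairing ρ ψ t := by
  unfold massPairing
  rw [← integral_const_mul]
  exact integral_congr_ae (ae_of_all _ fun x => by simp; ring)

lemma massRate_constSMul (c : ℝ) (ψ : TestFunction T Ω ℝ) (t : ℝ) :
    massRate ρ m (ψ.constSMul c) t = c * massRate ρ m ψ t := by
  unfold massRate
  rw [← integral_const_mul]
  exact integral_congr_ae (ae_of_all _ fun x => by simp; ring)

lemma momentumPairing_constSMul (c : ℝ) (φ : TestFunction T Ω (Vec d)) (t : ℝ) :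
    momentumPairing m (φ.constSMul c) t = c * momentumPairing m φ t := by
  unfold momentumPairing
  rw [← integral_const_mul]
  exact integral_congr_ae (ae_of_all _ fun x => by simp [inner_smul_right])

lemma momentumRate_constSMul (c : ℝ) (φ : TestFunction T Ω (Vec d)) (t : ℝ) :
    momentumRate γ ρ m (φ.constSMul c) t = c * momentumRate γ ρ m φ t := by
  unfold momentumRate
  rw [← integral_const_mul]
  refine integral_congr_ae (ae_of_all _ fun x => ?_)
  simp only [TestFunction.constSMul_dt, TestFunction.constSMul_grad, inner_smul_right, jac_smul,
    frob_smul_right]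
  ring

lemma massPairing_zero (t : ℝ) : massPairing ρ (TestFunction.zero T Ω ℝ) t = 0 := by
  simp [massPairing]

lemma massRate_zero (t : ℝ) : massRate ρ m (TestFunction.zero T Ω ℝ) t = 0 := by
  simp [massRate]

lemma momentumPairing_zero (t : ℝ) :
    momentumPairing m (TestFunction.zero T Ω (Vec d)) t = 0 := by
  simp [momentumPairing]

lemma jac_zero : jac (0 : Vec d →L[ℝ] Vec d) = 0 := by
  ext i j; simp [jac]

lemma momentumRate_zero (t : ℝ) :
    momentumRate γ ρ m (TestFunction.zero T Ω (Vec d)) t = 0 := by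
  simp [momentumRate, jac_zero, frob]

lemma timeWeight_eq_zero {I K : Type*} [TopologicalSpace I] [TopologicalSpace K] [CompactSpace K]
    (hγ : 1 < γ) {S : C(I × K, Mat d)} {q : C(I × K, ℝ)}
    (hS : ∀ x (v : Fin d → ℝ), 0 ≤ v ⬝ᵥ (S x).mulVec v) (hq : ∀ x, 0 ≤ q x) (t : I) :
    timeWeight γ S q t = 0 := by
  refine le_antisymm (timeWeight_le hγ le_rfl (fun x => ?_) fun x => ?_) (timeWeight_nonneg _ _ _ _)
  · rw [negBound_eq_zero (hS (t, x)), mul_zero]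
  · have := mul_nonneg (sub_nonneg.mpr hγ.le) (hq (t, x))
    linarith

lemma weightAt_zero [CompactSpace (closure Ω)] (hT : 0 ≤ T) (hγ : 1 < γ) (τ : ℝ) :
    weightAt hT γ (TestFunction.zero T Ω (Vec d)) τ = 0 :=
  timeWeight_eq_zero hγ (fun x v => by simp [gradField_apply, jac_zero])
    (fun x => by simp [divField_apply, jac_zero]) _

lemma weightAt_constSMul [CompactSpace (closure Ω)] (hT : 0 ≤ T) (hγ : 1 < γ) {c : ℝ} (hc : 0 < c)
    (φ : TestFunction T Ω (Vec d)) (τ : ℝ) :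
    weightAt hT γ (φ.constSMul c) τ = c * weightAt hT γ φ τ := by
  unfold weightAt
  rw [gradField_constSMul, divField_constSMul, timeWeight_smul hγ hc]

namespace EnergyState

variable (h : EnergyState T Ω γ ρ m E)
  (hineq : ∀ (ψ : TestFunction T Ω ℝ) (φ : TestFunction T Ω (Vec d)), φ.IsTangential →
    ForAETimes T (EnergyVariationalInequality γ ρ m E ψ φ))
include h hineq

lemma forAETimes_le : ForAETimes T fun s t => E t ≤ E s := by
  have hcs := h.compactSpace_closure
  refine ((hineq (.zero T Ω ℝ) (.zero T Ω (Vec d)) TestFunction.isTangential_zero).and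
    (h.inequality_iff (.zero T Ω ℝ) (.zero T Ω (Vec d)))).mp ?_
  refine ForAETimes.of_ae (G := fun _ => True) trivial (ae_of_all _ fun _ => trivial) ?_
  rintro s t - - - - - ⟨h1, h2⟩
  rw [h2] at h1
  simp only [massPairing_zero, massRate_zero, momentumPairing_zero, momentumRate_zero,
    weightAt_zero h.pos.le h.one_lt, zero_mul, intervalIntegral.integral_zero] at h1
  linarith

/-- Multiples `n ψ` with `n ∈ ℤ` turn the inequality into the continuity equation. -/
lemma forAETimes_continuityEquation (ψ : TestFunction T Ω ℝ) :
    ForAETimes T (ContinuityEquation ρ m ψ) := by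
  have hcs := h.compactSpace_closure
  have hall := ForAETimes.forall_of_countable fun n : ℤ =>
    (hineq (ψ.constSMul n) (.zero T Ω (Vec d)) TestFunction.isTangential_zero).and
      (h.inequality_iff (ψ.constSMul n) (.zero T Ω (Vec d)))
  refine hall.mp ?_
  refine ForAETimes.of_ae (G := fun _ => True) trivial (ae_of_all _ fun _ => trivial) ?_
  rintro s t - - - - - hn
  set X : ℝ := -(massPairing ρ ψ t - massPairing ρ ψ s) + ∫ τ in s..t, massRate ρ m ψ τ with hX
  change X = 0
  have key : ∀ n : ℤ, E t - E s + n * X ≤ 0 := by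
    intro n
    have h1 := (hn n).2.mp (hn n).1
    simp only [massPairing_constSMul, massRate_constSMul, momentumPairing_zero, momentumRate_zero,
      weightAt_zero h.pos.le h.one_lt, zero_mul, intervalIntegral.integral_zero,
      intervalIntegral.integral_const_mul] at h1
    rw [hX]
    linarith
  have hb : ∀ n : ℕ, (n : ℝ) * |X| ≤ E s - E t := by
    intro n
    have h1 := key n
    have h2 := key (-n)
    push_cast at h1 h2
    rcases abs_cases X with ⟨hx, -⟩ | ⟨hx, -⟩ <;> rw [hx] <;> linarith
  by_contra hne
  obtain ⟨n, hn'⟩ := exists_nat_gt ((E s - E t) / |X|)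
  rw [div_lt_iff₀ (abs_pos.mpr hne)] at hn'
  linarith [hb n]

/-- Large multiples of `φ` remove the energy from the inequality. -/
lemma forAETimes_momentum_le [CompactSpace (closure Ω)] {φ : TestFunction T Ω (Vec d)}
    (hφ : φ.IsTangential) :
    ForAETimes T fun s t => -(momentumPairing m φ t - momentumPairing m φ s) +
      (∫ τ in s..t, momentumRate γ ρ m φ τ) ≤
        ∫ τ in s..t, weightAt h.pos.le γ φ τ * defect Ω γ ρ m E τ := by
  have hall := ForAETimes.forall_of_countable fun n : ℕ =>
    (hineq (.zero T Ω ℝ) (φ.constSMul (n + 1 : ℝ)) (hφ.constSMul _)).and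
      (h.inequality_iff (.zero T Ω ℝ) (φ.constSMul (n + 1 : ℝ)))
  refine hall.mp ?_
  refine ForAETimes.of_ae (G := fun _ => True) trivial (ae_of_all _ fun _ => trivial) ?_
  rintro s t - - - - - hn
  set Y : ℝ := -(momentumPairing m φ t - momentumPairing m φ s) +
      (∫ τ in s..t, momentumRate γ ρ m φ τ) with hY
  set W : ℝ := ∫ τ in s..t, weightAt h.pos.le γ φ τ * defect Ω γ ρ m E τ with hW
  have key : ∀ n : ℕ, ((n : ℝ) + 1) * (Y - W) ≤ E s - E t := by
    intro n
    have h1 := (hn n).2.mp (hn n).1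
    simp only [massPairing_zero, massRate_zero, momentumPairing_constSMul, momentumRate_constSMul,
      weightAt_constSMul h.pos.le h.one_lt (Nat.cast_add_one_pos n), mul_assoc,
      intervalIntegral.integral_zero, intervalIntegral.integral_const_mul] at h1
    rw [hY, hW]
    linarith
  by_contra hlt
  have hpos : 0 < Y - W := sub_pos.mpr (not_le.mp hlt)
  obtain ⟨n, hn'⟩ := exists_nat_gt ((E s - E t) / (Y - W))
  rw [div_lt_iff₀ hpos] at hn'
  linarith [key n]

end EnergyState

/-- Test functions vanishing near the final time. -/
def VanishesNearEnd (φ : TestFunction T Ω (Vec d)) : Prop :=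
  ∃ δ > 0, ∀ t ∈ Icc 0 T, T - δ < t → ∀ x ∈ closure Ω,
    φ.val t x = 0 ∧ φ.grad t x = 0 ∧ φ.dt t x = 0

/-- The action of the momentum equation, without the Reynolds stress, on test functions vanishing
near the final time. -/
def momentumAction (γ : ℝ) (ρ : ℝ → Vec d → ℝ) (m : ℝ → Vec d → Vec d)
    (φ : TestFunction T Ω (Vec d)) : ℝ :=
  momentumPairing m φ 0 + ∫ τ in (0)..T, momentumRate γ ρ m φ τ

/-- A test function vanishing near the final time is tested up to one of the good times close to
`T`, after which only the nonnegative right-hand side is left. -/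
lemma EnergyState.momentumAction_le [CompactSpace (closure Ω)] (h : EnergyState T Ω γ ρ m E)
    (hineq : ∀ (ψ : TestFunction T Ω ℝ) (φ : TestFunction T Ω (Vec d)), φ.IsTangential →
      ForAETimes T (EnergyVariationalInequality γ ρ m E ψ φ))
    {φ : TestFunction T Ω (Vec d)} (hφ : φ.IsTangential) (hv : VanishesNearEnd φ) :
    momentumAction γ ρ m φ ≤ ∫ τ in (0)..T, weightAt h.pos.le γ φ τ * defect Ω γ ρ m E τ := by
  obtain ⟨δ, hδ, hv⟩ := hv
  have hae := (h.forAETimes_momentum_le hineq hφ).2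
  have hT := h.pos
  -- a good time close to `T`
  obtain ⟨t, ⟨ht1, ht2⟩, ht⟩ : ∃ t ∈ Ioo (max 0 (T - δ)) T,
      -(momentumPairing m φ t - momentumPairing m φ 0) +
      (∫ τ in (0)..t, momentumRate γ ρ m φ τ) ≤
        ∫ τ in (0)..t, weightAt h.pos.le γ φ τ * defect Ω γ ρ m E τ := by
    have hlt : max 0 (T - δ) < T := max_lt hT (by linarith)
    rw [ae_restrict_iff' measurableSet_Ioo] at hae
    obtain ⟨t, ht, ht'⟩ := (Measure.dense_of_ae hae).inter_open_nonempty _ isOpen_Ioo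
      (nonempty_Ioo.mpr hlt)
    exact ⟨t, ht, ht' ⟨(le_max_left _ _).trans_lt ht.1, ht.2⟩⟩
  have ht0 : 0 < t := (le_max_left _ _).trans_lt ht1
  have htδ : T - δ < t := (le_max_right _ _).trans_lt ht1
  have hsub : ∀ x ∈ Ω, x ∈ closure Ω := fun x hx => subset_closure hx
  have e1 : momentumPairing m φ t = 0 := by
    refine setIntegral_eq_zero_of_forall_eq_zero fun x hx => ?_
    rw [(hv t ⟨ht0.le, ht2.le⟩ htδ x (hsub x hx)).1, inner_zero_right]
  have e2 : ∫ τ in t..T, momentumRate γ ρ m φ τ = 0 := by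
    rw [intervalIntegral.integral_congr (g := fun _ => 0), intervalIntegral.integral_zero]
    intro τ hτ
    rw [uIcc_of_le ht2.le] at hτ
    refine setIntegral_eq_zero_of_forall_eq_zero fun x hx => ?_
    obtain ⟨-, h2, h3⟩ := hv τ ⟨ht0.le.trans hτ.1, hτ.2⟩ (htδ.trans_le hτ.1) x (hsub x hx)
    rw [h2, h3, inner_zero_right, jac_zero]
    simp [frob]
  have hB := h.integrable_momentumRate h.isBounded h.isOpen h.one_lt φ
  have hW := h.integrable_mul_defect (continuous_weightAt h.pos.le γ φ)
  have e3 : 0 ≤ ∫ τ in t..T, weightAt h.pos.le γ φ τ * defect Ω γ ρ m E τ := by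
    rw [intervalIntegral.integral_of_le ht2.le]
    refine integral_nonneg_of_ae ?_
    filter_upwards [ae_restrict_interval h.ae_defect_nonneg ht0.le le_rfl] with τ hτ
    exact mul_nonneg (timeWeight_nonneg _ _ _ _) hτ
  unfold momentumAction
  rw [← intervalIntegral.integral_add_adjacent_intervals
      (intervalIntegrable_of_Ioo hB le_rfl ht0.le ht2.le)
      (intervalIntegrable_of_Ioo hB ht0.le ht2.le le_rfl),
    ← intervalIntegral.integral_add_adjacent_intervals
      (intervalIntegrable_of_Ioo hW le_rfl ht0.le ht2.le)
      (intervalIntegrable_of_Ioo hW ht0.le ht2.le le_rfl), e2]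
  rw [e1] at ht
  linarith

end Scaling

/-! ### Disintegration in time -/

section Disintegration

/-- A measure on space-time whose time marginal is dominated by an integrable function is a family
`g τ • κ τ` of measures on space, of masses bounded by that function. -/
theorem exists_time_disintegration {T : ℝ} (hT : 0 ≤ T) {K : Type*} [MeasurableSpace K]
    [StandardBorelSpace K] [Nonempty K] (θ : Measure (Icc 0 T × K)) [IsFiniteMeasure θ]
    {w : ℝ → ℝ} (hw : IntegrableOn w (Ioo 0 T))
    (hw0 : ∀ᵐ τ ∂(volume.restrict (Ioo 0 T)), 0 ≤ w τ)
    (hθ : ∀ χ : C(Icc 0 T, ℝ), 0 ≤ χ →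
      ∫ q, χ q.1 ∂θ ≤ ∫ τ in Ioo 0 T, χ (projIcc 0 T hT τ) * w τ) :
    ∃ (κ : ProbabilityTheory.Kernel ℝ K) (g : ℝ → ℝ≥0), ProbabilityTheory.IsMarkovKernel κ ∧
      Measurable g ∧ (∀ᵐ τ ∂(volume.restrict (Ioo 0 T)), (g τ : ℝ) ≤ w τ) ∧
      ∀ (F : ℝ × K → ℝ) (C : ℝ), Measurable F → (∀ q, |F q| ≤ C) →
        IntegrableOn (fun τ => (g τ : ℝ) * ∫ x, F (τ, x) ∂κ τ) (Ioo 0 T) ∧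
        ∫ q, F (q.1, q.2) ∂θ = ∫ τ in Ioo 0 T, (g τ : ℝ) * ∫ x, F (τ, x) ∂κ τ := by
  set lam := volume.restrict (Ioo 0 T) with hlam
  set ν := lam.withDensity fun τ => ENNReal.ofReal (w τ) with hν
  have hνfin : IsFiniteMeasure ν := isFiniteMeasure_withDensity_ofReal hw.2
  have hwm : AEMeasurable (fun τ => ENNReal.ofReal (w τ)) lam :=
    hw.aestronglyMeasurable.aemeasurable.ennreal_ofReal
  have hproj : Measurable (projIcc 0 T hT) := continuous_projIcc.measurable
  have hνint : ∀ χ : C(Icc 0 T, ℝ),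
      ∫ t, χ t ∂(ν.map (projIcc 0 T hT)) = ∫ τ in Ioo 0 T, χ (projIcc 0 T hT τ) * w τ := by
    intro χ
    rw [integral_map hproj.aemeasurable χ.continuous.aestronglyMeasurable, hν,
      integral_withDensity_eq_integral_toReal_smul₀ hwm
        (ae_of_all _ fun _ => ENNReal.ofReal_lt_top)]
    refine integral_congr_ae ?_
    filter_upwards [hw0] with τ hτ
    rw [ENNReal.toReal_ofReal hτ, smul_eq_mul, mul_comm]
  -- the marginal on the interval is dominated
  have hle : θ.fst ≤ ν.map (projIcc 0 T hT) := by
    have : IsFiniteMeasure (ν.map (projIcc 0 T hT)) := inferInstance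
    refine measure_le_of_integral_continuousMap fun χ hχ => ?_
    rw [hνint, Measure.fst, integral_map measurable_fst.aemeasurable
      χ.continuous.aestronglyMeasurable]
    exact hθ χ hχ
  -- extend to the real line
  have hval : Measurable (fun q : Icc 0 T × K => ((q.1 : ℝ), q.2)) := by fun_prop
  set θ' : Measure (ℝ × K) := θ.map fun q => ((q.1 : ℝ), q.2) with hθ'
  have hfin' : IsFiniteMeasure θ' := inferInstance
  have hle' : θ'.fst ≤ ν := by
    have e1 : θ'.fst = θ.fst.map Subtype.val := by
      rw [hθ', Measure.fst, Measure.fst, Measure.map_map measurable_fst hval,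
        Measure.map_map measurable_subtype_coe measurable_fst]
      rfl
    have e2 : (ν.map (projIcc 0 T hT)).map Subtype.val = ν := by
      rw [Measure.map_map measurable_subtype_coe hproj]
      have hid : (Subtype.val ∘ projIcc 0 T hT) =ᵐ[ν] id := by
        have hmem : ∀ᵐ τ ∂lam, τ ∈ Ioo 0 T := ae_restrict_mem measurableSet_Ioo
        filter_upwards [(withDensity_absolutelyContinuous _ _).ae_le hmem] with τ hτ
        simp [projIcc_of_mem hT (Ioo_subset_Icc_self hτ)]
      rw [Measure.map_congr hid, Measure.map_id]
    rw [e1]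
    exact (Measure.map_mono hle measurable_subtype_coe).trans_eq e2
  have hac : θ'.fst ≪ lam :=
    (Measure.absolutelyContinuous_of_le hle').trans (withDensity_absolutelyContinuous _ _)
  have hrn := Measure.withDensity_rnDeriv_eq _ _ hac
  have hrnm := Measure.measurable_rnDeriv θ'.fst lam
  have hrnfin : ∀ᵐ τ ∂lam, θ'.fst.rnDeriv lam τ < ∞ := Measure.rnDeriv_lt_top _ _
  have hrnle : ∀ᵐ τ ∂lam, θ'.fst.rnDeriv lam τ ≤ ENNReal.ofReal (w τ) := by
    refine ae_le_of_forall_setLIntegral_le_of_sigmaFinite₀ hrnm.aemeasurable fun s hs _ => ?_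
    rw [← withDensity_apply _ hs, ← withDensity_apply _ hs, hrn]
    exact hle' s
  set g : ℝ → ℝ≥0 := fun τ => (θ'.fst.rnDeriv lam τ).toNNReal with hg
  have hgm : Measurable g := hrnm.ennreal_toNNReal
  have hfst : θ'.fst = lam.withDensity fun τ => (g τ : ℝ≥0∞) := by
    rw [← hrn]
    exact (withDensity_congr_ae (coe_toNNReal_ae_eq hrnfin)).symm
  refine ⟨θ'.condKernel, g, inferInstance, hgm, ?_, ?_⟩
  · filter_upwards [hrnle, hw0] with τ h1 h2
    exact ENNReal.toReal_le_of_le_ofReal h2 h1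
  · intro F C hF hC
    have hFi : Integrable F θ' :=
      Integrable.of_bound hF.aestronglyMeasurable C (ae_of_all _ hC)
    constructor
    · have h1 := hFi.integral_condKernel
      rw [hfst, integrable_withDensity_iff_integrable_smul hgm] at h1
      exact h1
    · have h1 := Measure.integral_condKernel hFi
      have h2 : ∫ b, ∫ ω, F (b, ω) ∂(θ'.condKernel b) ∂θ'.fst =
          ∫ b, g b • ∫ ω, F (b, ω) ∂(θ'.condKernel b) ∂lam := by
        rw [← integral_withDensity_eq_integral_smul hgm, ← hfst]
      have h3 : ∫ q, F q ∂θ' = ∫ q, F (q.1, q.2) ∂θ :=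
        integral_map hval.aemeasurable hF.aestronglyMeasurable
      rw [← h3, ← h1, h2]
      rfl

end Disintegration

/-! ### Extension of the momentum equation to a functional on stresses -/

section HahnBanach

variable {d : ℕ} {T : ℝ} {Ω : Set (Vec d)} {γ : ℝ} {ρ : ℝ → Vec d → ℝ} {m : ℝ → Vec d → Vec d}
  {E : ℝ → ℝ}

lemma VanishesNearEnd.add {φ χ : TestFunction T Ω (Vec d)} (hφ : VanishesNearEnd φ)
    (hχ : VanishesNearEnd χ) : VanishesNearEnd (φ.add χ) := by
  obtain ⟨δ, hδ, h⟩ := hφ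
  obtain ⟨ε, hε, h'⟩ := hχ
  refine ⟨min δ ε, lt_min hδ hε, fun t ht htT x hx => ?_⟩
  obtain ⟨h1, h2, h3⟩ := h t ht (by linarith [min_le_left δ ε]) x hx
  obtain ⟨h1', h2', h3'⟩ := h' t ht (by linarith [min_le_right δ ε]) x hx
  simp [h1, h2, h3, h1', h2', h3']

lemma VanishesNearEnd.constSMul {φ : TestFunction T Ω (Vec d)} (hφ : VanishesNearEnd φ) (c : ℝ) :
    VanishesNearEnd (φ.constSMul c) := by
  obtain ⟨δ, hδ, h⟩ := hφ
  refine ⟨δ, hδ, fun t ht htT x hx => ?_⟩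
  obtain ⟨h1, h2, h3⟩ := h t ht htT x hx
  simp [h1, h2, h3]

lemma momentumAction_constSMul (c : ℝ) (φ : TestFunction T Ω (Vec d)) :
    momentumAction γ ρ m (φ.constSMul c) = c * momentumAction γ ρ m φ := by
  simp only [momentumAction, momentumPairing_constSMul, momentumRate_constSMul,
    intervalIntegral.integral_const_mul]
  ring

lemma EnergyState.momentumAction_add (h : EnergyState T Ω γ ρ m E)
    (φ χ : TestFunction T Ω (Vec d)) :
    momentumAction γ ρ m (φ.add χ) = momentumAction γ ρ m φ + momentumAction γ ρ m χ := by
  have e1 : momentumPairing m (φ.add χ) 0 = momentumPairing m φ 0 + momentumPairing m χ 0 := by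
    unfold momentumPairing
    rw [← integral_add (h.integrable_momentum_zero' h.isBounded h.isOpen h.pos.le φ)
      (h.integrable_momentum_zero' h.isBounded h.isOpen h.pos.le χ)]
    simp only [TestFunction.add_val, inner_add_right]
  have hrate : ∀ φ : TestFunction T Ω (Vec d),
      IntervalIntegrable (momentumRate γ ρ m φ) volume 0 T := fun φ =>
    intervalIntegrable_of_Ioo (h.integrable_momentumRate h.isBounded h.isOpen h.one_lt φ) le_rfl
      h.pos.le le_rfl
  have e2 : ∫ τ in (0)..T, momentumRate γ ρ m (φ.add χ) τ =
      (∫ τ in (0)..T, momentumRate γ ρ m φ τ) + ∫ τ in (0)..T, momentumRate γ ρ m χ τ := by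
    rw [← intervalIntegral.integral_add (hrate φ) (hrate χ),
      intervalIntegral.integral_of_le h.pos.le, intervalIntegral.integral_of_le h.pos.le]
    refine integral_congr_ae ?_
    filter_upwards [ae_restrict_interval
        (h.ae_integrable_momentumRate h.isBounded h.isOpen h.one_lt φ) le_rfl le_rfl,
      ae_restrict_interval
        (h.ae_integrable_momentumRate h.isBounded h.isOpen h.one_lt χ) le_rfl le_rfl] with τ h1 h2
    unfold momentumRate
    rw [← integral_add h1 h2]
    refine integral_congr_ae (ae_of_all _ fun x => ?_)
    simp only [TestFunction.add_dt, TestFunction.add_grad, inner_add_right, jac_add,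
      frob_add_right]
    ring
  unfold momentumAction
  rw [e1, e2]
  ring

/-- The weight of a pair of fields, integrated in time against the energy defect. -/
def defectWeight (hT : 0 ≤ T) (Ω : Set (Vec d)) [CompactSpace (closure Ω)] (γ : ℝ)
    (ρ : ℝ → Vec d → ℝ) (m : ℝ → Vec d → Vec d) (E : ℝ → ℝ)
    (p : C(Icc 0 T × closure Ω, Mat d) × C(Icc 0 T × closure Ω, ℝ)) : ℝ :=
  ∫ τ in Ioo 0 T, timeWeight γ p.1 p.2 (projIcc 0 T hT τ) * defect Ω γ ρ m E τ

lemma EnergyState.integrable_timeWeight_mul [CompactSpace (closure Ω)]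
    (h : EnergyState T Ω γ ρ m E)
    (p : C(Icc 0 T × closure Ω, Mat d) × C(Icc 0 T × closure Ω, ℝ)) :
    IntegrableOn (fun τ => timeWeight γ p.1 p.2 (projIcc 0 T h.pos.le τ) * defect Ω γ ρ m E τ)
      (Ioo 0 T) :=
  h.integrable_mul_defect ((continuous_timeWeight γ _ _).comp continuous_projIcc)

/-- The Hahn–Banach step: the momentum equation, as a functional of the gradient and the divergence
of the test function, is dominated by the sublinear functional `defectWeight`. -/
theorem EnergyState.exists_functional [CompactSpace (closure Ω)] (h : EnergyState T Ω γ ρ m E)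
    (hineq : ∀ (ψ : TestFunction T Ω ℝ) (φ : TestFunction T Ω (Vec d)), φ.IsTangential →
      ForAETimes T (EnergyVariationalInequality γ ρ m E ψ φ)) :
    ∃ l : C(Icc 0 T × closure Ω, Mat d) × C(Icc 0 T × closure Ω, ℝ) →ₗ[ℝ] ℝ,
      (∀ p, l p ≤ defectWeight h.pos.le Ω γ ρ m E p) ∧
      ∀ φ : TestFunction T Ω (Vec d), φ.IsTangential → VanishesNearEnd φ →
        l (gradField φ, divField φ) = momentumAction γ ρ m φ := by
  let G : Submodule ℝ ((C(Icc 0 T × closure Ω, Mat d) × C(Icc 0 T × closure Ω, ℝ)) × ℝ) :=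
    { carrier := {p | ∃ φ : TestFunction T Ω (Vec d), φ.IsTangential ∧ VanishesNearEnd φ ∧
        p = ((gradField φ, divField φ), momentumAction γ ρ m φ)}
      zero_mem' := ⟨(TestFunction.zero T Ω (Vec d)).constSMul 0,
        TestFunction.isTangential_zero.constSMul 0,
        ⟨1, one_pos, fun t _ _ x _ => by simp⟩, by
          rw [gradField_constSMul, divField_constSMul, momentumAction_constSMul]
          simp only [zero_smul, zero_mul]
          rfl⟩
      add_mem' := by
        rintro _ _ ⟨φ, h1, h2, rfl⟩ ⟨χ, h3, h4, rfl⟩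
        refine ⟨φ.add χ, h1.add h3, h2.add h4, ?_⟩
        rw [gradField_add, divField_add, h.momentumAction_add]
        rfl
      smul_mem' := by
        rintro c _ ⟨φ, h1, h2, rfl⟩
        refine ⟨φ.constSMul c, h1.constSMul c, h2.constSMul c, ?_⟩
        rw [gradField_constSMul, divField_constSMul, momentumAction_constSMul]
        rfl }
  have hle : ∀ φ : TestFunction T Ω (Vec d), φ.IsTangential → VanishesNearEnd φ →
      momentumAction γ ρ m φ ≤ defectWeight h.pos.le Ω γ ρ m E (gradField φ, divField φ) := by
    intro φ h1 h2
    refine (h.momentumAction_le hineq h1 h2).trans_eq ?_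
    rw [intervalIntegral.integral_of_le h.pos.le, integral_Ioc_eq_integral_Ioo]
    rfl
  have hzero : defectWeight h.pos.le Ω γ ρ m E 0 = 0 := by
    refine integral_eq_zero_of_ae (ae_of_all _ fun τ => ?_)
    simp only [Prod.fst_zero, Prod.snd_zero]
    rw [timeWeight_eq_zero h.one_lt (fun x v => by simp) (fun x => le_rfl), zero_mul]
    rfl
  have hG : ∀ p ∈ G, p.1 = 0 → p.2 = 0 := by
    rintro _ ⟨φ, h1, h2, rfl⟩ h0
    simp only at h0 ⊢
    refine le_antisymm ((hle φ h1 h2).trans_eq (by rw [h0, hzero])) ?_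
    have h3 := hle _ (h1.constSMul (-1)) (h2.constSMul (-1))
    have h4 : (gradField (φ.constSMul (-1)), divField (φ.constSMul (-1))) =
        (-1 : ℝ) • (gradField φ, divField φ) := by
      rw [gradField_constSMul, divField_constSMul]; rfl
    rw [h4, h0, smul_zero, hzero, momentumAction_constSMul] at h3
    linarith
  have hgraph : G.toLinearPMap.graph = G := Submodule.toLinearPMap_graph_eq G hG
  have hmem : ∀ x : G.toLinearPMap.domain, ∃ φ : TestFunction T Ω (Vec d), φ.IsTangential ∧
      VanishesNearEnd φ ∧ ((x : C(Icc 0 T × closure Ω, Mat d) × C(Icc 0 T × closure Ω, ℝ)),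
        G.toLinearPMap x) = ((gradField φ, divField φ), momentumAction γ ρ m φ) := fun x => by
    have : ((x : C(Icc 0 T × closure Ω, Mat d) × C(Icc 0 T × closure Ω, ℝ)),
        G.toLinearPMap x) ∈ G :=
      hgraph.le (LinearPMap.mem_graph _ x)
    exact this
  obtain ⟨l, hl1, hl2⟩ := exists_extension_of_le_sublinear G.toLinearPMap
    (defectWeight h.pos.le Ω γ ρ m E) (fun c hc p => by
      unfold defectWeight
      rw [← integral_const_mul]
      refine integral_congr_ae (ae_of_all _ fun τ => ?_)
      simp only [Prod.smul_fst, Prod.smul_snd, timeWeight_smul h.one_lt hc]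
      ring) (fun p q => by
      unfold defectWeight
      rw [← integral_add (h.integrable_timeWeight_mul p) (h.integrable_timeWeight_mul q)]
      refine integral_mono_ae (h.integrable_timeWeight_mul _)
        ((h.integrable_timeWeight_mul p).add (h.integrable_timeWeight_mul q)) ?_
      filter_upwards [h.ae_defect_nonneg] with τ hτ
      rw [← add_mul]
      exact mul_le_mul_of_nonneg_right (timeWeight_add_le h.one_lt _ _ _ _ _) hτ) (fun x => by
      obtain ⟨φ, h1, h2, h3⟩ := hmem x
      obtain ⟨h4, h5⟩ := Prod.ext_iff.mp h3
      simp only at h4 h5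
      rw [h4, h5]
      exact hle φ h1 h2)
  refine ⟨l, hl2, fun φ h1 h2 => ?_⟩
  have hin : ((gradField φ, divField φ), momentumAction γ ρ m φ) ∈ G.toLinearPMap.graph := by
    rw [hgraph]
    exact ⟨φ, h1, h2, rfl⟩
  rw [LinearPMap.mem_graph_iff] at hin
  obtain ⟨y, hy1, hy2⟩ := hin
  simp only at hy1 hy2
  rw [← hy2, ← hl1 y, hy1]

end HahnBanach

/-! ### Construction of the Reynolds stress -/

section Stress

variable {d : ℕ} {T : ℝ} {Ω : Set (Vec d)} {γ : ℝ} {ρ : ℝ → Vec d → ℝ} {m : ℝ → Vec d → Vec d}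
  {E : ℝ → ℝ}

lemma frob_symPart_left (A : Mat d) {P : Mat d} (hP : P.IsHermitian) :
    frob (symPart A) P = frob A P := by
  have hsymm : ∀ i j, P i j = P j i := fun i j => by simpa using congrFun (congrFun hP j) i
  have h1 : ∑ i, ∑ j, A j i * P i j = ∑ i, ∑ j, A i j * P i j := by
    rw [Finset.sum_comm]
    exact Finset.sum_congr rfl fun i _ => Finset.sum_congr rfl fun j _ => by rw [hsymm]
  have h2 : frob (symPart A) P =
      1 / 2 * (∑ i, ∑ j, A i j * P i j) + 1 / 2 * ∑ i, ∑ j, A j i * P i j := by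
    simp only [frob, symPart, Matrix.smul_apply, Matrix.add_apply, Matrix.transpose_apply,
      smul_eq_mul, Finset.mul_sum, ← Finset.sum_add_distrib]
    exact Finset.sum_congr rfl fun i _ => Finset.sum_congr rfl fun j _ => by ring
  rw [h2, h1, frob]
  ring

lemma abs_frob_le {A B : Mat d} {C D : ℝ} (hA : ∀ i j, |A i j| ≤ C) (hB : ∀ i j, |B i j| ≤ D)
    (hC : 0 ≤ C) : |frob A B| ≤ d * (d * (C * D)) := by
  have h : ∀ i j, |A i j * B i j| ≤ C * D := fun i j => by
    rw [abs_mul]; exact mul_le_mul (hA i j) (hB i j) (abs_nonneg _) hC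
  calc |frob A B| ≤ ∑ i : Fin d, ∑ j : Fin d, |A i j * B i j| :=
        (Finset.abs_sum_le_sum_abs _ _).trans (Finset.sum_le_sum fun i _ =>
          Finset.abs_sum_le_sum_abs _ _)
    _ ≤ ∑ i : Fin d, ∑ j : Fin d, C * D :=
        Finset.sum_le_sum fun i _ => Finset.sum_le_sum fun j _ => h i j
    _ = d * (d * (C * D)) := by simp

/-- A functional dominated by `defectWeight` is represented by a Reynolds stress whose dissipation
is bounded by the energy defect. The matrix stress pairs with symmetric parts only, but the
densities are symmetric, so the representation holds for full gradients. -/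
theorem EnergyState.exists_stress [CompactSpace (closure Ω)] (h : EnergyState T Ω γ ρ m E)
    (hne : Ω.Nonempty)
    (l : C(Icc 0 T × closure Ω, Mat d) × C(Icc 0 T × closure Ω, ℝ) →ₗ[ℝ] ℝ)
    (hl : ∀ p, l p ≤ defectWeight h.pos.le Ω γ ρ m E p) :
    ∃ (R₁ : ℝ → VectorMeasure (closure Ω) (Mat d)) (R₂ : ℝ → FiniteMeasure (closure Ω)),
      IsPosSemidefMeasureFamily T Ω R₁ ∧ IsNonnegMeasureFamily T Ω R₂ ∧
      (∀ᵐ t ∂(volume.restrict (Ioo 0 T)),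
        1 / 2 * (R₁ t univ).trace + 1 / (γ - 1) * ((R₂ t).mass : ℝ) ≤ defect Ω γ ρ m E t) ∧
      ∀ φ : TestFunction T Ω (Vec d), IntegrableOn (stressPower R₁ R₂ φ) (Ioo 0 T) ∧
        -l (gradField φ, divField φ) = ∫ τ in Ioo 0 T, stressPower R₁ R₂ φ τ := by
  have hγ' : 0 < γ - 1 := sub_pos.mpr h.one_lt
  have hT := h.pos.le
  have hKne : Nonempty (closure Ω) := hne.closure.to_subtype
  have hKsb : StandardBorelSpace (closure Ω) := isClosed_closure.measurableSet.standardBorel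
  obtain ⟨θ, P, b, hθ, hPm, hbm, hPpsd, hb0, htr, hrep, hmarg⟩ := exists_posSemidef_density l
    (fun S q hS hq => (hl (S, q)).trans_eq (integral_eq_zero_of_ae (ae_of_all _ fun τ => by
      simp only [timeWeight_eq_zero h.one_lt hS hq, zero_mul]; rfl)))
    (a := 1 / 2) (c := 1 / (γ - 1)) (by norm_num) (by positivity)
  -- the normalisation of the densities bounds them
  have htr0 : ∀ x, 0 ≤ (P x).trace := fun x => (hPpsd x).trace_nonneg
  have hP2 : ∀ x i j, |P x i j| ≤ 2 := fun x i j => by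
    have h1 := abs_apply_le_trace (hPpsd x) i j
    have h2 : 0 ≤ 1 / (γ - 1) * b x := mul_nonneg (by positivity) (hb0 x)
    linarith [htr x]
  have hb : ∀ x, b x ≤ γ - 1 := fun x => by
    have h1 : 1 / (γ - 1) * b x ≤ 1 := by linarith [htr x, htr0 x]
    rwa [one_div_mul_eq_div, div_le_one hγ'] at h1
  -- disintegration in time
  obtain ⟨κ, g, hκ, hgm, hgle, hdis⟩ := exists_time_disintegration hT θ h.integrable_defect
    h.ae_defect_nonneg (fun χ hχ => by
      have e := hmarg (χ.comp ⟨Prod.fst, continuous_fst⟩)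
      change ∫ q, χ q.1 ∂θ = _ at e
      rw [e, ← map_neg]
      refine (hl _).trans (integral_mono_ae (h.integrable_timeWeight_mul _)
        (h.integrable_mul_defect (χ.continuous.comp continuous_projIcc)) ?_)
      filter_upwards [h.ae_defect_nonneg] with τ hτ
      refine mul_le_mul_of_nonneg_right (timeWeight_le h.one_lt (hχ _) (fun x => ?_)
        fun x => ?_) hτ
      · set r := χ (projIcc 0 T hT τ) with hr
        have hr0 : 0 ≤ r := hχ _
        have e2 : (-(smulMat ((1 / 2 : ℝ) • (1 : Mat d)) (χ.comp ⟨Prod.fst, continuous_fst⟩) :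
            C(Icc 0 T × closure Ω, Mat d)) : C(Icc 0 T × closure Ω, Mat d))
            (projIcc 0 T hT τ, x) = (-(r / 2)) • (1 : Mat d) := by
          rw [ContinuousMap.neg_apply, smulMat_apply, smul_smul, ← neg_smul]
          congr 1
          change -(r * (1 / 2)) = _
          ring
        have h3 := negBound_neg_smul_one_le (d := d) (c := r / 2) (by positivity)
        change 2 * negBound ((-(smulMat ((1 / 2 : ℝ) • (1 : Mat d))
          (χ.comp ⟨Prod.fst, continuous_fst⟩) : C(Icc 0 T × closure Ω, Mat d)) :
            C(Icc 0 T × closure Ω, Mat d)) (projIcc 0 T hT τ, x)) ≤ r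
        rw [e2]
        linarith
      · refine le_of_eq ?_
        change (γ - 1) * (- -(1 / (γ - 1) * χ (projIcc 0 T hT τ))) = χ (projIcc 0 T hT τ)
        field_simp)
  -- densities at fixed times
  let pr : ℝ × closure Ω → Icc 0 T × closure Ω := fun q => (projIcc 0 T hT q.1, q.2)
  have hpr : Measurable pr :=
    (continuous_projIcc.measurable.comp measurable_fst).prodMk measurable_snd
  have hprτ : ∀ τ : ℝ, Measurable fun x : closure Ω => pr (τ, x) := fun τ =>
    hpr.comp (measurable_const.prodMk measurable_id)
  let μ : ℝ → Measure (closure Ω) := fun τ => g τ • κ τ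
  have hμ : ∀ τ, IsFiniteMeasure (μ τ) := fun τ => inferInstance
  have hPi : ∀ τ i j, Integrable (fun x : closure Ω => P (pr (τ, x)) i j) (μ τ) := fun τ i j =>
    Integrable.of_bound ((hPm i j).comp (hprτ τ)).aestronglyMeasurable 2
      (ae_of_all _ fun x => hP2 _ i j)
  have hbi : ∀ τ, Integrable (fun x : closure Ω => b (pr (τ, x))) (μ τ) := fun τ =>
    Integrable.of_bound (hbm.comp (hprτ τ)).aestronglyMeasurable (γ - 1)
      (ae_of_all _ fun x => by rw [Real.norm_of_nonneg (hb0 _)]; exact hb _)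
  let R₁ : ℝ → VectorMeasure (closure Ω) (Mat d) := fun τ =>
    matWithDensity (μ τ) fun x => P (pr (τ, x))
  let R₂ : ℝ → FiniteMeasure (closure Ω) := fun τ =>
    ⟨(μ τ).withDensity fun x => ENNReal.ofReal (b (pr (τ, x))),
      isFiniteMeasure_withDensity_ofReal (hbi τ).2⟩
  have hR₁int : ∀ τ (B : closure Ω → Mat d) (C : ℝ), (∀ i j, Measurable fun x => B x i j) →
      (∀ x i j, |B x i j| ≤ C) →
      matIntegral B (R₁ τ) = g τ * ∫ x, frob (B x) (P (pr (τ, x))) ∂κ τ := fun τ B C hB hC => by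
    rw [matIntegral_matWithDensity (hPi τ) hB hC, integral_smul_nnreal_measure]
    rfl
  have hR₂int : ∀ τ (f : closure Ω → ℝ),
      ∫ x, f x ∂(R₂ τ : Measure (closure Ω)) = g τ * ∫ x, f x * b (pr (τ, x)) ∂κ τ := fun τ f => by
    change ∫ x, f x ∂((μ τ).withDensity fun x => ENNReal.ofReal (b (pr (τ, x)))) = _
    have hbτ : Measurable fun x : closure Ω => b (pr (τ, x)) := hbm.comp (hprτ τ)
    rw [integral_withDensity_eq_integral_toReal_smul hbτ.ennreal_ofReal
      (ae_of_all _ fun _ => ENNReal.ofReal_lt_top), integral_smul_nnreal_measure]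
    change (g τ : ℝ) * _ = _
    congr 1
    refine integral_congr_ae (ae_of_all _ fun x => ?_)
    simp only [ENNReal.toReal_ofReal (hb0 _), smul_eq_mul, mul_comm]
  have hfrobm : ∀ B : ℝ × closure Ω → Mat d, (∀ i j, Measurable fun q => B q i j) →
      Measurable fun q => frob (B q) (P (pr q)) := fun B hB => by
    unfold frob
    exact Finset.measurable_sum _ fun i _ => Finset.measurable_sum _ fun j _ =>
      (hB i j).mul ((hPm i j).comp hpr)
  have hmass : ∀ τ, ((R₂ τ).mass : ℝ) = g τ * ∫ x, b (pr (τ, x)) ∂κ τ := fun τ => by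
    have h1 := hR₂int τ fun _ => 1
    rw [integral_const, smul_eq_mul, mul_one] at h1
    simp only [one_mul] at h1
    exact h1
  have htrR : ∀ τ, (R₁ τ univ).trace = g τ * ∫ x, (P (pr (τ, x))).trace ∂κ τ := fun τ => by
    rw [trace_matWithDensity (hPi τ), integral_smul_nnreal_measure]
    rfl
  obtain ⟨C, hC0, hC⟩ := h.exists_ae_defect_le
  refine ⟨R₁, R₂, ⟨fun τ A hA => matWithDensity_posSemidef (hPi τ) (fun x => hPpsd _) hA, ?_, ?_⟩,
    ⟨?_, ?_⟩, ?_, ?_⟩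
  · intro B
    obtain ⟨D, hD0, hD⟩ := exists_abs_apply_le B.continuous
    have hBm : ∀ i j, Measurable fun x => B x i j := fun i j =>
      (B.continuous.matrix_elem i j).measurable
    have h1 := (hdis (fun q => frob (B q.2) (P (pr q))) _
      (hfrobm (fun q => B q.2) fun i j => (hBm i j).comp measurable_snd)
      fun q => abs_frob_le (hD _) (hP2 _) hD0).1.1.aemeasurable
    exact h1.congr (ae_of_all _ fun τ => (hR₁int τ B D hBm hD).symm)
  · refine ⟨2 * C.toNNReal, ?_⟩
    filter_upwards [hgle, hC] with τ h1 h2 i j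
    rw [entry_matWithDensity, Measure.variation_withDensityᵥ (hPi τ i j),
      withDensity_apply _ MeasurableSet.univ, Measure.restrict_univ]
    have h3 : ∫⁻ x : closure Ω, ‖P (pr (τ, x)) i j‖ₑ ∂(μ τ) ≤ ∫⁻ _ : closure Ω, 2 ∂(μ τ) := by
      refine lintegral_mono fun x => ?_
      have h4 := ENNReal.ofReal_le_ofReal (hP2 (pr (τ, x)) i j)
      rw [← Real.norm_eq_abs, ofReal_norm] at h4
      simpa using h4
    have h5 : g τ ≤ C.toNNReal := by
      rw [Real.le_toNNReal_iff_coe_le hC0]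
      exact h1.trans h2
    refine h3.trans ?_
    rw [lintegral_const]
    have h6 : μ τ univ = g τ := by
      change (g τ • κ τ) univ = g τ
      rw [Measure.smul_apply, measure_univ, ENNReal.smul_def, smul_eq_mul, mul_one]
    rw [h6]
    push_cast
    gcongr
  · intro f
    have h1 := (hdis (fun q => f q.2 * b (pr q)) (‖f‖ * (γ - 1))
      ((f.continuous.measurable.comp measurable_snd).mul (hbm.comp hpr)) fun q => by
        rw [abs_mul, abs_of_nonneg (hb0 _)]
        exact mul_le_mul (f.norm_coe_le_norm _) (hb _) (hb0 _) (norm_nonneg _)).1.1.aemeasurable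
    exact h1.congr (ae_of_all _ fun τ => (hR₂int τ f).symm)
  · refine ⟨((γ - 1) * C).toNNReal, ?_⟩
    filter_upwards [hgle, hC] with τ h1 h2
    rw [Real.le_toNNReal_iff_coe_le (mul_nonneg hγ'.le hC0), hmass]
    have h3 : ∫ x, b (pr (τ, x)) ∂κ τ ≤ γ - 1 := by
      have := integral_mono_of_nonneg (μ := κ τ) (ae_of_all _ fun x => hb0 (pr (τ, x)))
        (integrable_const (γ - 1)) (ae_of_all _ fun x => hb (pr (τ, x)))
      simpa using this
    rw [mul_comm]
    exact mul_le_mul h3 (h1.trans h2) (g τ).2 hγ'.le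
  · filter_upwards [hgle] with τ h1
    have hPκ : Integrable (fun x : closure Ω => (P (pr (τ, x))).trace) (κ τ) :=
      integrable_finsetSum _ fun i _ => Integrable.of_bound
        ((hPm i i).comp (hprτ τ)).aestronglyMeasurable 2 (ae_of_all _ fun x => hP2 _ i i)
    have hbκ : Integrable (fun x : closure Ω => b (pr (τ, x))) (κ τ) :=
      Integrable.of_bound (hbm.comp (hprτ τ)).aestronglyMeasurable (γ - 1)
        (ae_of_all _ fun x => by rw [Real.norm_of_nonneg (hb0 _)]; exact hb _)
    have h2 : 1 / 2 * ∫ x, (P (pr (τ, x))).trace ∂κ τ +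
        1 / (γ - 1) * ∫ x, b (pr (τ, x)) ∂κ τ ≤ 1 := by
      rw [← integral_const_mul, ← integral_const_mul,
        ← integral_add (hPκ.const_mul _) (hbκ.const_mul _)]
      have h3 := integral_mono ((hPκ.const_mul (1 / 2)).add (hbκ.const_mul (1 / (γ - 1))))
        (integrable_const 1) fun x => htr (pr (τ, x))
      simpa using h3
    rw [htrR, hmass]
    calc _ = (g τ : ℝ) * (1 / 2 * ∫ x, (P (pr (τ, x))).trace ∂κ τ +
        1 / (γ - 1) * ∫ x, b (pr (τ, x)) ∂κ τ) := by ring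
      _ ≤ g τ * 1 := mul_le_mul_of_nonneg_left h2 (g τ).2
      _ ≤ _ := by rw [mul_one]; exact h1
  · intro φ
    obtain ⟨D, hD0, hD⟩ := exists_abs_apply_le (gradField φ).continuous
    have hSm : ∀ i j, Measurable fun q => gradField φ q i j := fun i j =>
      ((gradField φ).continuous.matrix_elem i j).measurable
    have hSm' : ∀ τ i j, Measurable fun x : closure Ω => gradField φ (pr (τ, x)) i j :=
      fun τ i j => (hSm i j).comp (hprτ τ)
    have hfb : ∀ q, |frob (gradField φ (pr q)) (P (pr q))| ≤ d * (d * (D * 2)) := fun q =>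
      abs_frob_le (hD _) (hP2 _) hD0
    have hqb : ∀ q, |divField φ (pr q) * b (pr q)| ≤ ‖divField φ‖ * (γ - 1) := fun q => by
      rw [abs_mul, abs_of_nonneg (hb0 _)]
      exact mul_le_mul ((divField φ).norm_coe_le_norm _) (hb _) (hb0 _) (norm_nonneg _)
    have hfm := hfrobm (fun q => gradField φ (pr q)) fun i j => (hSm i j).comp hpr
    have hqm : Measurable fun q => divField φ (pr q) * b (pr q) :=
      ((divField φ).continuous.measurable.comp hpr).mul (hbm.comp hpr)
    obtain ⟨hi, he⟩ := hdis (fun q => frob (gradField φ (pr q)) (P (pr q)) +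
      divField φ (pr q) * b (pr q)) _ (hfm.add hqm)
      fun q => (abs_add_le _ _).trans (add_le_add (hfb q) (hqb q))
    have hpow : ∀ τ ∈ Ioo 0 T, (g τ : ℝ) * ∫ x, (frob (gradField φ (pr (τ, x))) (P (pr (τ, x))) +
        divField φ (pr (τ, x)) * b (pr (τ, x))) ∂κ τ = stressPower R₁ R₂ φ τ := by
      intro τ hτ
      have hpτ : ∀ x, pr (τ, x) = (⟨τ, Ioo_subset_Icc_self hτ⟩, x) := fun x => by
        simp only [pr, projIcc_of_mem hT (Ioo_subset_Icc_self hτ)]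
      have hmk : Measurable fun x : closure Ω => ((τ : ℝ), x) :=
        measurable_const.prodMk measurable_id
      have i1 : Integrable (fun x => frob (gradField φ (pr (τ, x))) (P (pr (τ, x)))) (κ τ) :=
        Integrable.of_bound (hfm.comp hmk).aestronglyMeasurable _ (ae_of_all _ fun x => hfb (τ, x))
      have i2 : Integrable (fun x => divField φ (pr (τ, x)) * b (pr (τ, x))) (κ τ) :=
        Integrable.of_bound (hqm.comp hmk).aestronglyMeasurable _ (ae_of_all _ fun x => hqb (τ, x))
      have e1 : matIntegral (fun x : closure Ω => symPart (jac (φ.grad τ x))) (R₁ τ) =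
          g τ * ∫ x, frob (gradField φ (pr (τ, x))) (P (pr (τ, x))) ∂κ τ := by
        have hfun : (fun x : closure Ω => symPart (jac (φ.grad τ x))) =
            fun x => symPart (gradField φ (pr (τ, x))) := by
          funext x; rw [hpτ]; rfl
        have hc : Continuous fun x : closure Ω => symPart (gradField φ (pr (τ, x))) := by
          simp only [hpτ]
          exact continuous_symPart.comp (by fun_prop)
        obtain ⟨D', -, hD'⟩ := exists_abs_apply_le hc
        rw [hfun, hR₁int τ _ D' (fun i j => (hc.matrix_elem i j).measurable) hD']
        simp only [frob_symPart_left _ (hPpsd _).isHermitian]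
      have e2 : ∫ x : closure Ω, (jac (φ.grad τ x)).trace ∂(R₂ τ : Measure (closure Ω)) =
          g τ * ∫ x, divField φ (pr (τ, x)) * b (pr (τ, x)) ∂κ τ := by
        have hfun : (fun x : closure Ω => (jac (φ.grad τ x)).trace) =
            fun x => divField φ (pr (τ, x)) := by
          funext x; rw [hpτ]; rfl
        rw [hfun, hR₂int]
      rw [stressPower, e1, e2, integral_add i1 i2, mul_add]
    constructor
    · exact hi.congr_fun hpow measurableSet_Ioo
    · rw [hrep, ← setIntegral_congr_fun measurableSet_Ioo hpow, ← he]
      refine integral_congr_ae (ae_of_all _ fun q => ?_)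
      simp only [pr, projIcc_val]

end Stress

/-! ### The momentum equation at almost all times -/

section DuBoisReymond

variable {T : ℝ}

/-- A du Bois-Reymond lemma: the weak form of `M' = D`, `M 0 = M₀` determines `M` almost everywhere.
The test function is the primitive of `q` that vanishes at `T`. -/
lemma ae_eq_add_integral_of_weak (hT : 0 < T) {M D : ℝ → ℝ} (hM : IntegrableOn M (Ioo 0 T))
    (hD : IntegrableOn D (Ioo 0 T)) (M₀ : ℝ)
    (hweak : ∀ q : ℝ → ℝ, ContDiff ℝ (⊤ : ℕ∞) q → tsupport q ⊆ Ioo 0 T →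
      (∫ s in T..0, q s) * M₀ + ∫ t in (0)..T, ((∫ s in T..t, q s) * D t + q t * M t) = 0) :
    ∀ᵐ t ∂(volume.restrict (Ioo 0 T)), M t = M₀ + ∫ s in (0)..t, D s := by
  have hMi : IntervalIntegrable M volume 0 T :=
    intervalIntegrable_of_Ioo hM le_rfl hT.le le_rfl
  have hDi : IntervalIntegrable D volume 0 T :=
    intervalIntegrable_of_Ioo hD le_rfl hT.le le_rfl
  set G : ℝ → ℝ := fun t => ∫ s in (0)..t, D s with hG
  have hGac : AbsolutelyContinuousOnInterval G 0 T :=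
    hDi.absolutelyContinuousOnInterval_intervalIntegral left_mem_uIcc
  have hGi : IntervalIntegrable G volume 0 T := hGac.continuousOn.intervalIntegrable
  set f : ℝ → ℝ := fun t => M t - M₀ - G t with hf
  have hfi : IntervalIntegrable f volume 0 T :=
    (hMi.sub intervalIntegrable_const).sub hGi
  have hfOn : IntegrableOn f (Ioo 0 T) :=
    (intervalIntegrable_iff_integrableOn_Ioo_of_le hT.le).mp hfi
  have key : ∀ q : ℝ → ℝ, ContDiff ℝ (⊤ : ℕ∞) q → HasCompactSupport q → tsupport q ⊆ Ioo 0 T →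
      ∫ t, q t • f t = 0 := by
    intro q hq _ hsupp
    have hqc := hq.continuous
    set h : ℝ → ℝ := fun t => ∫ s in T..t, q s with hh
    have hderiv : ∀ t, HasDerivAt h (q t) t := fun t =>
      (hqc.integral_hasStrictDerivAt T t).hasDerivAt
    have hdh : deriv h = q := funext fun t => (hderiv t).deriv
    have hhac : AbsolutelyContinuousOnInterval h 0 T := by
      refine ContDiffOn.absolutelyContinuousOnInterval (ContDiff.contDiffOn ?_)
      rw [contDiff_one_iff_deriv, hdh]
      exact ⟨fun t => (hderiv t).differentiableAt, hqc⟩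
    have hhc : Continuous h := continuous_iff_continuousAt.mpr fun t => (hderiv t).continuousAt
    -- integration by parts against the primitive of `D`
    have h1 : ∫ t in (0)..T, h t * D t = -∫ t in (0)..T, q t * G t := by
      have e1 := hhac.integral_mul_deriv_eq_deriv_mul hGac
      have e2 : ∫ t in (0)..T, h t * deriv G t = ∫ t in (0)..T, h t * D t := by
        refine intervalIntegral.integral_congr_ae ?_
        filter_upwards [hDi.ae_hasDerivAt_integral] with t ht htm
        rw [(ht (uIoc_subset_uIcc htm) 0 left_mem_uIcc).deriv]
      have hT0 : h T = 0 := intervalIntegral.integral_same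
      have hG0 : G 0 = 0 := intervalIntegral.integral_same
      rw [e2, hT0, hG0, hdh] at e1
      rw [e1]
      ring
    have hb : ∀ g : ℝ → ℝ, IntervalIntegrable g volume 0 T →
        IntervalIntegrable (fun t => q t * g t) volume 0 T := fun g hg =>
      hg.continuousOn_mul hqc.continuousOn
    have h2 := hweak q hq hsupp
    rw [intervalIntegral.integral_add (hDi.continuousOn_mul hhc.continuousOn) (hb M hMi)] at h2
    change (∫ s in T..0, q s) * M₀ + ((∫ t in (0)..T, h t * D t) + _) = 0 at h2
    rw [h1, intervalIntegral.integral_symm] at h2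
    have h3 : ∫ t in (0)..T, q t * f t = 0 := by
      have e : ∀ t, q t * f t = q t * M t - q t * M₀ - q t * G t := fun t => by
        simp only [hf]; ring
      simp only [e]
      rw [intervalIntegral.integral_sub ((hb M hMi).sub (hb _ intervalIntegrable_const)) (hb G hGi),
        intervalIntegral.integral_sub (hb M hMi) (hb _ intervalIntegrable_const),
        intervalIntegral.integral_mul_const]
      linarith
    rw [intervalIntegral.integral_of_le hT.le, integral_Ioc_eq_integral_Ioo] at h3
    rw [← h3, setIntegral_eq_integral_of_forall_compl_eq_zero]
    · rfl
    · intro t ht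
      rw [image_eq_zero_of_notMem_tsupport fun h' => ht (hsupp h'), zero_mul]
  have hae := isOpen_Ioo.ae_eq_zero_of_integral_contDiff_smul_eq_zero
    hfOn.locallyIntegrableOn key
  rw [ae_restrict_iff' measurableSet_Ioo]
  filter_upwards [hae] with t ht htm
  have := ht htm
  simp only [hf] at this
  linarith

end DuBoisReymond

section Momentum

variable {d : ℕ} {T : ℝ} {Ω : Set (Vec d)} {γ : ℝ} {ρ : ℝ → Vec d → ℝ} {m : ℝ → Vec d → Vec d}
  {E : ℝ → ℝ}

lemma symPart_smul (c : ℝ) (A : Mat d) : symPart (c • A) = c • symPart A := by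
  simp only [symPart, Matrix.transpose_smul, ← smul_add, smul_comm c]

lemma stressPower_mulTime (R₁ : ℝ → VectorMeasure (closure Ω) (Mat d))
    (R₂ : ℝ → FiniteMeasure (closure Ω)) (φ : TestFunction T Ω (Vec d)) {h h' : ℝ → ℝ}
    (hh : ∀ t, HasDerivAt h (h' t) t) (hh' : Continuous h') (τ : ℝ) :
    stressPower R₁ R₂ (φ.mulTime h h' hh hh') τ = h τ * stressPower R₁ R₂ φ τ := by
  unfold stressPower matIntegral
  simp only [TestFunction.mulTime_grad, jac_smul, symPart_smul, Matrix.smul_apply,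
    Matrix.trace_smul, smul_eq_mul, integral_const_mul]
  have e : ∀ i j, (entry (R₁ τ) i j).integral
      (fun x : closure Ω => h τ * symPart (jac (φ.grad τ x)) i j) (ContinuousLinearMap.lsmul ℝ ℝ) =
      h τ * (entry (R₁ τ) i j).integral
      (fun x : closure Ω => symPart (jac (φ.grad τ x)) i j) (ContinuousLinearMap.lsmul ℝ ℝ) :=
    fun i j => VectorMeasure.integral_fun_smul _ _ _ _
  simp only [e, mul_add, Finset.mul_sum]

lemma EnergyState.ae_momentumRate_mulTime (hs : EnergyState T Ω γ ρ m E)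
    (φ : TestFunction T Ω (Vec d)) {h h' : ℝ → ℝ}
    (hh : ∀ t, HasDerivAt h (h' t) t) (hh' : Continuous h') :
    ∀ᵐ τ ∂(volume.restrict (Ioo 0 T)), momentumRate γ ρ m (φ.mulTime h h' hh hh') τ =
      h τ * momentumRate γ ρ m φ τ + h' τ * momentumPairing m φ τ := by
  filter_upwards [hs.ae_integrable_momentum hs.isBounded hs.isOpen hs.one_lt φ,
    hs.ae_integrable_momentumRate hs.isBounded hs.isOpen hs.one_lt φ] with τ h1 h2
  unfold momentumRate momentumPairing
  rw [← integral_const_mul, ← integral_const_mul,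
    ← integral_add (h2.const_mul _) (h1.const_mul _)]
  refine integral_congr_ae (ae_of_all _ fun x => ?_)
  simp only [TestFunction.mulTime_dt, TestFunction.mulTime_grad, inner_add_right,
    inner_smul_right, jac_smul, frob_smul_right]
  ring

/-- A stress representing the momentum equation on test functions vanishing near the final time
turns it into an identity between almost all times. -/
theorem EnergyState.forAETimes_momentumEquation (h : EnergyState T Ω γ ρ m E)
    {R₁ : ℝ → VectorMeasure (closure Ω) (Mat d)} {R₂ : ℝ → FiniteMeasure (closure Ω)}
    (hint : ∀ φ : TestFunction T Ω (Vec d), IntegrableOn (stressPower R₁ R₂ φ) (Ioo 0 T))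
    (hact : ∀ φ : TestFunction T Ω (Vec d), φ.IsTangential → VanishesNearEnd φ →
      momentumAction γ ρ m φ = -∫ τ in Ioo 0 T, stressPower R₁ R₂ φ τ)
    {φ : TestFunction T Ω (Vec d)} (hφ : φ.IsTangential) :
    ForAETimes T (MomentumEquation γ ρ m R₁ R₂ φ) := by
  have hB := h.integrable_momentumRate h.isBounded h.isOpen h.one_lt φ
  have hS := hint φ
  have hM := h.integrable_momentumPairing h.isBounded h.isOpen h.one_lt φ
  have hii : ∀ {f : ℝ → ℝ}, IntegrableOn f (Ioo 0 T) → IntervalIntegrable f volume 0 T :=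
    fun hf => intervalIntegrable_of_Ioo hf le_rfl h.pos.le le_rfl
  have hae := ae_eq_add_integral_of_weak h.pos hM (hB.add hS) (momentumPairing m φ 0) (by
    intro q hq hsupp
    have hqc := hq.continuous
    have hderiv : ∀ t, HasDerivAt (fun t => ∫ s in T..t, q s) (q t) t := fun t =>
      (hqc.integral_hasStrictDerivAt T t).hasDerivAt
    have hhc : Continuous fun t => ∫ s in T..t, q s :=
      continuous_iff_continuousAt.mpr fun t => (hderiv t).continuousAt
    have hvan : VanishesNearEnd (φ.mulTime _ q hderiv hqc) := by
      have hT : T ∈ (tsupport q)ᶜ := fun hTq => (hsupp hTq).2.ne rfl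
      obtain ⟨δ, hδ, hball⟩ := Metric.isOpen_iff.mp (isClosed_tsupport q).isOpen_compl T hT
      have hq0 : ∀ t, T - δ < t → t ≤ T → q t = 0 := fun t h1 h2 =>
        image_eq_zero_of_notMem_tsupport (hball (by
          rw [Metric.mem_ball, Real.dist_eq, abs_sub_lt_iff]; constructor <;> linarith))
      refine ⟨δ, hδ, fun t ht htδ x _ => ?_⟩
      have hz : ∫ s in T..t, q s = 0 := by
        rw [intervalIntegral.integral_congr (g := fun _ => 0), intervalIntegral.integral_zero]
        intro s hs
        rw [uIcc_of_ge ht.2] at hs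
        exact hq0 s (htδ.trans_le hs.1) hs.2
      simp [hz, hq0 t htδ ht.2]
    have h1 := hact _ (hφ.mulTime hderiv hqc) hvan
    simp only [stressPower_mulTime] at h1
    rw [momentumAction] at h1
    have e1 : momentumPairing m (φ.mulTime _ q hderiv hqc) 0 =
        (∫ s in T..0, q s) * momentumPairing m φ 0 := by
      unfold momentumPairing
      rw [← integral_const_mul]
      exact integral_congr_ae (ae_of_all _ fun x => by
        simp only [TestFunction.mulTime_val, inner_smul_right])
    have e2 : ∫ τ in (0)..T, momentumRate γ ρ m (φ.mulTime _ q hderiv hqc) τ =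
        ∫ τ in (0)..T, ((∫ s in T..τ, q s) * momentumRate γ ρ m φ τ +
          q τ * momentumPairing m φ τ) := by
      rw [intervalIntegral.integral_of_le h.pos.le, intervalIntegral.integral_of_le h.pos.le]
      exact integral_congr_ae
        (ae_restrict_interval (h.ae_momentumRate_mulTime φ hderiv hqc) le_rfl le_rfl)
    rw [e1, e2, ← integral_Ioc_eq_integral_Ioo, ← intervalIntegral.integral_of_le h.pos.le,
      intervalIntegral.integral_add ((hii hB).continuousOn_mul hhc.continuousOn)
        ((hii hM).continuousOn_mul hqc.continuousOn)] at h1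
    have e3 : ∀ t, (∫ s in T..t, q s) * (momentumRate γ ρ m φ + stressPower R₁ R₂ φ) t +
        q t * momentumPairing m φ t = (∫ s in T..t, q s) * momentumRate γ ρ m φ t +
          (∫ s in T..t, q s) * stressPower R₁ R₂ φ t + q t * momentumPairing m φ t := fun t => by
      rw [Pi.add_apply]; ring
    simp only [e3]
    rw [intervalIntegral.integral_add (((hii hB).continuousOn_mul hhc.continuousOn).add
        ((hii hS).continuousOn_mul hhc.continuousOn))
        ((hii hM).continuousOn_mul hqc.continuousOn),
      intervalIntegral.integral_add ((hii hB).continuousOn_mul hhc.continuousOn)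
        ((hii hS).continuousOn_mul hhc.continuousOn)]
    linarith)
  refine ForAETimes.of_ae (G := fun t => momentumPairing m φ t = momentumPairing m φ 0 +
    ∫ s in (0)..t, (momentumRate γ ρ m φ + stressPower R₁ R₂ φ) s) (by simp) hae ?_
  intro s t hs hst ht hGs hGt
  have hts : ∀ {f : ℝ → ℝ}, IntegrableOn f (Ioo 0 T) → IntervalIntegrable f volume s t :=
    fun hf => intervalIntegrable_of_Ioo hf hs hst.le ht.le
  have hadj := intervalIntegral.integral_add_adjacent_intervals
    (intervalIntegrable_of_Ioo (hB.add hS) le_rfl hs (hst.le.trans ht.le)) (hts (hB.add hS))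
  have hsum : ∫ τ in s..t, (momentumRate γ ρ m φ + stressPower R₁ R₂ φ) τ =
      (∫ τ in s..t, momentumRate γ ρ m φ τ) + ∫ τ in s..t, stressPower R₁ R₂ φ τ :=
    intervalIntegral.integral_add (hts hB) (hts hS)
  change -(momentumPairing m φ t - momentumPairing m φ s) +
    (∫ τ in s..t, momentumRate γ ρ m φ τ) + (∫ τ in s..t, stressPower R₁ R₂ φ τ) = 0
  linarith

end Momentum

end IsentropicEuler

end

open IsentropicEuler in
theorem theorem4p3 (d : ℕ) (hd : 1 ≤ d) (Ω : Set (Vec d)) (hΩ : IsBoundedLipschitzDomain Ω)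
    (γ : ℝ) (hγ : 1 < γ) (T : ℝ) (hT : 0 < T)
    (ρ₀ : Vec d → ℝ)
    (hρ₀ : MeasureTheory.MemLp ρ₀ (ENNReal.ofReal γ) (MeasureTheory.volume.restrict Ω))
    (m₀ : Vec d → Vec d)
    (hm₀ : MeasureTheory.MemLp m₀ (ENNReal.ofReal (2 * γ / (γ + 1)))
      (MeasureTheory.volume.restrict Ω))
    (ρ : ℝ → Vec d → ℝ) (m : ℝ → Vec d → Vec d) (E : ℝ → ℝ) :
    IsEnergyVariationalSolution T Ω γ ρ₀ m₀ ρ m E ↔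
      IsDissipativeWeakSolution T Ω γ ρ₀ m₀ ρ m E := by
  have hcompact : CompactSpace (closure Ω) :=
    isCompact_iff_compactSpace.mp hΩ.isBounded.isCompact_closure
  constructor
  · intro h
    have hen := h.energy_le.mono fun t ht => energy_ne_top_and_toReal_le ht
    have hs := energyState_update hΩ.isOpen hΩ.isBounded hγ hT hρ₀ hm₀ h.memLp_density
      h.memLp_momentum h.boundedVariation hen
    obtain ⟨l, hl, hlφ⟩ := hs.exists_functional h.inequality
    obtain ⟨R₁, R₂, hR₁, hR₂, hdiss, hrep⟩ :=
      hs.exists_stress hΩ.isConnected.nonempty l hl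
    refine ⟨h.memLp_density, h.memLp_momentum, h.boundedVariation,
      isNonincreasing_of_forAETimes hT h.boundedVariation (hs.forAETimes_le h.inequality),
      R₁, R₂, hR₁, hR₂, fun ψ φ hφ => ?_, ?_⟩
    · refine (hs.forAETimes_continuityEquation h.inequality ψ).and
        (hs.forAETimes_momentumEquation (fun χ => (hrep χ).1) (fun χ h1 h2 => ?_) hφ)
      rw [← hlφ χ h1 h2, ← (hrep χ).2, neg_neg]
    · filter_upwards [hdiss, hen, ae_update_eq ρ ρ₀, ae_update_eq m m₀] with t h1 h2 h3 h4
      rw [defect, h3, h4] at h1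
      exact coe_le_sub_of_le_sub_toReal h2.1 h1
  · intro h
    obtain ⟨R₁, R₂, hR₁, hR₂, heq, hdiss⟩ := h.exists_reynolds
    have hdiss' := hdiss.mono fun t ht => le_sub_toReal_of_coe_le_sub ht
    have hen : ∀ᵐ t ∂(volume.restrict (Ioo 0 T)),
        energy Ω γ (ρ t) (m t) ≠ ∞ ∧ (energy Ω γ (ρ t) (m t)).toReal ≤ E t := by
      filter_upwards [hdiss'] with t ht
      have h1 := (hR₁.posSemidef t univ MeasurableSet.univ).trace_nonneg
      have h2 : 0 ≤ 1 / (γ - 1) * ((R₂ t).mass : ℝ) :=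
        mul_nonneg (one_div_nonneg.mpr (sub_nonneg.mpr hγ.le)) (R₂ t).mass.2
      exact ⟨ht.1, by linarith [ht.2]⟩
    have hs := energyState_update hΩ.isOpen hΩ.isBounded hγ hT hρ₀ hm₀ h.memLp_density
      h.memLp_momentum h.boundedVariation hen
    refine ⟨h.memLp_density, h.memLp_momentum, h.boundedVariation, ?_, fun ψ φ hφ =>
      hs.forAETimes_inequality h.nonincreasing hR₁.posSemidef ?_ (heq ψ φ hφ)⟩
    · filter_upwards [hen] with t ht
      rw [← ENNReal.ofReal_toReal ht.1, EReal.coe_ennreal_ofReal,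
        max_eq_left ENNReal.toReal_nonneg, EReal.coe_le_coe_iff]
      exact ht.2
    · filter_upwards [hdiss', ae_update_eq ρ ρ₀, ae_update_eq m m₀] with t h2 h3 h4
      rw [defect, h3, h4]
      exact h2.2
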